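/- **Setting.** Let $S=S_0\oplus S_1$ be the real Grassmann algebra on a (possibly infinite) set of generators; an even element is called *positive* if its body (constant term) is positive, and $\sqrt{\cdot}$ of a positive even element is the positive square root. Supermatrices are $3\times3$ with rows and columns $1,3$ even and $2$ odd, multiplied with an extra sign $-1$ for each product of two odd entries; $SL(1|2)_0$ consists of the even supermatrices of Berezinian $1$ with positive central entry. It acts by conjugation on $\mathbb R^{2,2|4}$, the set of $$(x_1,x_2,y,z\,|\,\xi_1^+,\xi_2^+,\xi_1^-,\xi_2^-):=\begin{pmatrix} z-y&\xi_1^+&x_1\\ \xi_1^-&2z&\xi_2^+\\ -x_2&\xi_2^-&z+y\end{pmatrix},\qquad \langle M,N\rangle=-\tfrac12\,\mathrm{str}(MN).$$ Let $\Psi$ be the involution $(x_1,x_2,y,z|\xi_1^+,\xi_2^+,\xi_1^-,\xi_2^-)\mapsto(x_1,x_2,y,-z|\xi_2^+,\xi_1^+,-\xi_2^-,-\xi_1^-)$, let $\widetilde{SL}(1|2)=\Psi\ltimes SL(1|2)_0$, and let $\mathcal L_0$ be the orbit of $(1,0,0,0|0,0,0,0)$. Put $Z_a=\mathrm{diag}(a,a^2,a)$,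 $D_a=\mathrm{diag}(a,1,a^{-1})$, $c_\theta=1+\frac{\theta_1\theta_2}{6}$, $$J=\begin{pmatrix}0&0&1\\0&1&0\\-1&0&0\end{pmatrix},\quad P'=\begin{pmatrix}\frac{\theta_1\theta_2}2-1&\theta_1&1\\-\theta_2&1&0\\-1&0&0\end{pmatrix},\quad P^\theta_{h,k}=Z_{c_\theta}Z_k^{-1}P'Z_h,\quad \Upsilon^\chi_h=JD_{\sqrt\chi}Z_h .$$ A triple is in *standard position* $\mathcal S^\theta$, $\theta=(\theta_1,\theta_2)$, if it is $r(0,1,0,0|0,0,0,0)$, $t(1,1,1,\frac{\theta_1\theta_2}2|\theta_1,\theta_2,-\theta_2,\theta_1)$, $s(1,0,0,0|0,0,0,0)$ with $r,s,t$ positive. Write $h\theta=(h\theta_1,h^{-1}\theta_2)$ and $\theta^{op}=(\theta_2,\theta_1)$. A quadruple $ABCD$ of cross-ratio $\chi$ is in position $\mathcal S^{\theta,\sigma}_h$ if $ABC\in\mathcal S^{h\theta}$ and $\Upsilon^\chi_h\cdot CDA\in\mathcal S^{h^{-1}\sigma}$. **Coordinates and lifts.** Let $\Delta$ be an ideal triangulation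 of a connected oriented punctured surface $F$, with dual trivalent fatgraph $\tau$, and let $\omega_\sigma,\omega_\iota$ be two orientations of the edges of $\tau$ (representatives of two spin structures). Let $\delta(x)=1$ on the edges on which they agree and $\delta(x)=-1$ on the others. A coordinate vector assigns to every edge of $\Delta$ a positive even $\lambda$-length (denoted like the edge), to every triangle an ordered pair of odd coordinates, and to every side $x$ of every triangle a positive even ratio $h_x$, such that the two ratios $h_x,h_x'$ across a common edge satisfy $h_xh_x'=1$ if $\delta(x)=1$ and $h_x=h_x'$ if $\delta(x)=-1$. The cross-ratio of the diagonal $e=CA$ of the quadrilateral $ABCD$ with consecutive sides $a=AB$, $b=BC$, $c=CD$, $d=DA$ (in clockwise order) is $\chi=\frac{ac}{bd}$. A *lift* is a map $\ell$ from the ideal vertices of the lifted triangulation of the universal cover to $\mathcal L_0$ for which there are $g_x\in\widetilde{SL}(1|2)$, one for every side $x=CA$ of every triangle $ABC$, with $CDA$ the adjacent triangle, such that $\langle \ell(A),\ell(C)\rangle$ is the square of the $\lambda$-length of $x$ and the following holds, where $\theta,\sigma$ are the odd coordinates of $ABC$ and $CDA$, $h=h_x$ is the ratio of $x$ in $ABC$,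 and $\varepsilon=1$ if the edge of $\tau$ across $x$ points in $\omega_\sigma$ toward $ABC$, $\varepsilon=-1$ otherwise: (i) $g_x\cdot\ell(ABCD)\in\mathcal S_h^{\theta,\varepsilon\sigma}$ if $\delta(x)=1$ and $g_x\cdot\ell(ABCD)\in\mathcal S_h^{\theta,\varepsilon\sigma^{op}}$ if $\delta(x)=-1$; (ii) $g_{AB}=P^\theta_{h,h_{AB}}\,g_x$, where $AB$ is the next side of the triangle $ABC$; (iii) $g_{x'}=Z_\varepsilon\Upsilon^\chi_h\,g_x$ if $\delta(x)=1$ and $g_{x'}=Z_\varepsilon\Psi\Upsilon^\chi_h\,g_x$ if $\delta(x)=-1$, where $x'$ is the same edge as a side of $CDA$. **Theorem.** Let $ABCD$ be a quadrilateral of $\Delta$ with diagonal $e=CA$ whose sides $a,b,c,d$ are four different edges of $\Delta$, and suppose that in both $\omega_\sigma$ and $\omega_\iota$ the edge of $\tau$ across $e$ points from $CDA$ to $ABC$. Flip $e$ to the diagonal $f=BD$. Let the orientations evolve by the spin graph rule: the edge of the new fatgraph across $f$ points from $BCD$ to $ABD$, the orientation of the edge across $b$ is reversed, all others are kept. Let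 a coordinate vector be given, with odd coordinates $\theta$ of $ABC$ and $\sigma$ of $CDA$, with $h_a,h_b,h_e$ the ratios of the sides of $ABC$ and $h_c,h_d$ those of the sides $c,d$ of $CDA$. Put $$\mathcal D=\sqrt{1+\chi+\tfrac{\sqrt\chi}{2}\left(h_e^{-1}\sigma_1\theta_2+h_e\sigma_2\theta_1\right)} .$$ Then there is a coordinate vector for the flipped triangulation and the evolved orientations which agrees with the given one away from the quadrilateral and in $a,b,c,d$, with $$ef=(ac+bd)\left(1+\frac{h_e^{-1}\sigma_1\theta_2+h_e\sigma_2\theta_1}{2(\sqrt\chi+\sqrt\chi^{-1})}\right),$$ with odd coordinates $\mu$ on $ABD$ and $\nu$ on $BCD$ given by $$\mu_1=\frac{h_e\theta_1+\sqrt\chi\,\sigma_1}{\mathcal D},\quad \mu_2=\frac{h_e^{-1}\theta_2+\sqrt\chi\,\sigma_2}{\mathcal D},\quad \nu_1=\frac{\sigma_1-\sqrt\chi\,h_e\theta_1}{\mathcal D},\quad \nu_2=\frac{\sigma_2-\sqrt\chi\,h_e^{-1}\theta_2}{\mathcal D},$$ and with ratios, those of $a,d,f$ as sides of $ABD$ and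 those of $b,c$ as sides of $BCD$, given by $$h_a'=\frac{h_a}{h_ec_\theta},\quad h_b'=\frac{h_bc_\theta}{h_e},\quad h_c'=h_c\frac{c_\theta}{c_\mu},\quad h_d'=h_d\frac{c_\nu}{c_\theta},\quad h_f=\frac{c_\sigma}{c_\theta^2},$$ and the two coordinate vectors produce the same lift: lifts for the given coordinate vector exist, and, with the ideal vertices before and after the flip (performed at all preimages of $e$ in the universal cover) identified, a map $\ell$ is a lift for the given coordinate vector if and only if it is a lift for the new one. -/

import Mathlib

noncomputable section

namespace SuperTeich

open MulOpposite
open scoped Ring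

universe u v

/-! ### Grassmann algebra -/

/-- The real Grassmann algebra on a (possibly infinite) set `ι` of generators. -/
abbrev Grassmann (ι : Type u) : Type u := ExteriorAlgebra ℝ (ι →₀ ℝ)

section Numbers

variable {ι : Type u}

/-- Even (bosonic) elements. -/
def IsEven (x : Grassmann ι) : Prop :=
  x ∈ CliffordAlgebra.evenOdd (0 : QuadraticForm ℝ (ι →₀ ℝ)) 0

/-- Odd (fermionic) elements. -/
def IsOdd (x : Grassmann ι) : Prop :=
  x ∈ CliffordAlgebra.evenOdd (0 : QuadraticForm ℝ (ι →₀ ℝ)) 1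

/-- The body: the constant term of an element. -/
def body (x : Grassmann ι) : ℝ := ExteriorAlgebra.algebraMapInv x

/-- Positive even elements: even, with positive body. -/
def IsPos (x : Grassmann ι) : Prop := IsEven x ∧ 0 < body x

open Classical in
/-- The square root with positive body of a positive even element (junk value `0` otherwise). -/
def gsqrt (x : Grassmann ι) : Grassmann ι :=
  if hx : ∃ y : Grassmann ι, IsPos y ∧ y * y = x then hx.choose else 0

/-! ### Supermatrices and the group acting on Minkowski superspace -/

/-- Supermatrices, rows and columns `0, 2` being even and `1` odd.  The product of even
supermatrices carries the sign `-` on every product of two odd entries; since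
`- p * q = q * p` for odd `p, q`, this is matrix multiplication over the opposite algebra. -/
abbrev SMat (ι : Type u) : Type u := Matrix (Fin 3) (Fin 3) (Grassmann ι)ᵐᵒᵖ

/-- The `(i, j)` entry of a supermatrix, as an element of the Grassmann algebra. -/
def entry (M : SMat ι) (i j : Fin 3) : Grassmann ι := unop (M i j)

/-- The supermatrix with the given entries. -/
def smat (a p b q f r c s d : Grassmann ι) : SMat ι :=
  !![op a, op p, op b; op q, op f, op r; op c, op s, op d]

/-- Pure even supermatrices: even blocks have even entries, off-diagonal blocks odd ones. -/
def IsEvenMat (M : SMat ι) : Prop :=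
  ∀ i j : Fin 3, if (i = 1 ↔ j = 1) then IsEven (entry M i j) else IsOdd (entry M i j)

/-- The supertrace. -/
def str (M : SMat ι) : Grassmann ι := entry M 0 0 + entry M 2 2 - entry M 1 1

/-- The Berezinian `(det D)⁻¹ det (A + B D⁻¹ C)`, where `A` is the `2 × 2` block with indices
`0, 2`, and `D` is the central entry. -/
def sdet (M : SMat ι) : Grassmann ι :=
  let N : Fin 3 → Fin 3 → Grassmann ι := fun i j =>
    entry M i j + entry M i 1 * (entry M 1 1)⁻¹ʳ * entry M 1 j
  (entry M 1 1)⁻¹ʳ * (N 0 0 * N 2 2 - N 0 2 * N 2 0)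

/-- `SL(1|2)₀`: pure even supermatrices of Berezinian `1` whose central entry is positive. -/
def SL0 (ι : Type u) : Set (SMat ι) :=
  {M | IsEvenMat M ∧ IsPos (entry M 1 1) ∧ sdet M = 1}

/-- Adjoint action (conjugation). -/
def ad (M X : SMat ι) : SMat ι := M * X * M⁻¹ʳ

/-- The point `(x₁, x₂, y, z | ξ₁⁺, ξ₂⁺, ξ₁⁻, ξ₂⁻)` of Minkowski superspace. -/
def vec (x₁ x₂ y z p₁ p₂ m₁ m₂ : Grassmann ι) : SMat ι :=
  smat (z - y) p₁ x₁ m₁ (2 * z) p₂ (-x₂) m₂ (z + y)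

/-- The involution
`(x₁, x₂, y, z | ξ₁⁺, ξ₂⁺, ξ₁⁻, ξ₂⁻) ↦ (x₁, x₂, y, -z | ξ₂⁺, ξ₁⁺, -ξ₂⁻, -ξ₁⁻)`,
written on matrix entries. -/
def Psi (M : SMat ι) : SMat ι :=
  !![-M 2 2, M 1 2, M 0 2; -M 2 1, -M 1 1, M 0 1; M 2 0, -M 1 0, -M 0 0]

/-- The group `Ψ ⋉ SL(1|2)₀`, as the group of transformations it induces: it is generated by
`Ψ` and the conjugations by elements of `SL(1|2)₀`. -/
def SLtilde (ι : Type u) : Subgroup (Equiv.Perm (SMat ι)) :=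
  Subgroup.closure
    {φ | (∃ M ∈ SL0 ι, ∀ X, φ X = ad M X) ∨ ∀ X, φ X = Psi X}

/-- The special light cone: the orbit of `(1, 0, 0, 0 | 0, 0, 0, 0)`. -/
def LightCone (ι : Type u) : Set (SMat ι) :=
  {M | ∃ φ ∈ SLtilde ι, M = φ (vec 1 0 0 0 0 0 0 0)}

/-- The pairing `⟨M, N⟩ = -(1/2) str (M N)`. -/
def pairing (M N : SMat ι) : Grassmann ι := (-(1 / 2) : ℝ) • str (M * N)

/-! ### Standard positions and admissible transformations -/

/-- `D_{a,c} = diag (a, a c, c)`. -/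
def Dgen (a c : Grassmann ι) : SMat ι := smat a 0 0 0 (a * c) 0 0 0 c

/-- `D_a = D_{a, a⁻¹}`. -/
def Dmat (a : Grassmann ι) : SMat ι := Dgen a a⁻¹ʳ

/-- `Z_a = D_{a, a}`. -/
def Zmat (a : Grassmann ι) : SMat ι := Dgen a a

/-- The matrix `J`. -/
def Jmat : SMat ι := smat 0 0 1 0 1 0 (-1) 0 0

/-- `c_θ = 1 + θ₁ θ₂ / 6`. -/
def cc (θ₁ θ₂ : Grassmann ι) : Grassmann ι := 1 + (1 / 6 : ℝ) • (θ₁ * θ₂)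

/-- The prime transformation `P'`. -/
def Pprime (θ₁ θ₂ : Grassmann ι) : SMat ι :=
  smat ((1 / 2 : ℝ) • (θ₁ * θ₂) - 1) θ₁ 1 (-θ₂) 1 0 (-1) 0 0

/-- The general prime transformation `P_{h, k}^θ = Z_{c_θ} Z_k⁻¹ P' Z_h`. -/
def Pgen (θ₁ θ₂ h k : Grassmann ι) : SMat ι :=
  Zmat (cc θ₁ θ₂) * Zmat k⁻¹ʳ * Pprime θ₁ θ₂ * Zmat h

/-- The upside-down transformation `Υ_h^χ = J D_{√χ} Z_h`. -/
def Upsilon (χ h : Grassmann ι) : SMat ι := Jmat * Dmat (gsqrt χ) * Zmat h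

/-- The triple `A, B, C` is in standard position with odd parameters `(θ₁, θ₂)`. -/
def StdTriangle (θ₁ θ₂ : Grassmann ι) (A B C : SMat ι) : Prop :=
  ∃ r s t : Grassmann ι, IsPos r ∧ IsPos s ∧ IsPos t ∧
    A = op r • vec 0 1 0 0 0 0 0 0 ∧
    B = op t • vec 1 1 1 ((1 / 2 : ℝ) • (θ₁ * θ₂)) θ₁ θ₂ (-θ₂) θ₁ ∧
    C = op s • vec 1 0 0 0 0 0 0 0

/-- The quadrilateral `A, B, C, D` of cross-ratio `χ` is in standard `(θ, σ)`-position with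
ratio `h`. -/
def StdQuad (χ h θ₁ θ₂ σ₁ σ₂ : Grassmann ι) (A B C D : SMat ι) : Prop :=
  StdTriangle (h * θ₁) (h⁻¹ʳ * θ₂) A B C ∧
  StdTriangle (h⁻¹ʳ * σ₁) (h * σ₂)
    (ad (Upsilon χ h) C) (ad (Upsilon χ h) D) (ad (Upsilon χ h) A)

end Numbers

/-! ### Ideal triangulations and dual trivalent fatgraphs -/

/-- An ideal triangulation of an oriented punctured surface, given by its gluing pattern.
`H` is the set of sides of the triangles (the half-edges of the dual trivalent fatgraph);
`rot` sends a side of a triangle to the next side of the same triangle in clockwise order, and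
`opp` sends it to the same edge, regarded as a side of the triangle across it.
For a clockwise triangle with vertices `A, B, C` the sides `AB, BC, CA` are cyclically
permuted by `rot`, and the side `AB` starts at `A` and ends at `B`. -/
structure Triangulation (H : Type v) where
  rot : H → H
  opp : H → H
  rot_rot_rot : ∀ x, rot (rot (rot x)) = x
  rot_ne : ∀ x, rot x ≠ x
  opp_opp : ∀ x, opp (opp x) = x
  opp_ne : ∀ x, opp x ≠ x

/-- The two moves on sides of triangles. -/
inductive Move
  | rot
  | opp

/-- Homotopy classes of paths in a trivalent fatgraph: words in the two moves, subject to
`rot ^ 3 = 1` and `opp ^ 2 = 1` only. -/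
abbrev Paths : Type :=
  PresentedGroup ({FreeGroup.of Move.rot ^ 3, FreeGroup.of Move.opp ^ 2} : Set (FreeGroup Move))

namespace Triangulation

variable {H : Type v} (T : Triangulation H)

/-- `rot` as a permutation. -/
def rotPerm : Equiv.Perm H where
  toFun := T.rot
  invFun x := T.rot (T.rot x)
  left_inv := T.rot_rot_rot
  right_inv := T.rot_rot_rot

/-- `opp` as a permutation. -/
def oppPerm : Equiv.Perm H where
  toFun := T.opp
  invFun := T.opp
  left_inv := T.opp_opp
  right_inv := T.opp_opp

/-- The permutation given by a move. -/
def movePerm : Move → Equiv.Perm H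
  | .rot => T.rotPerm
  | .opp => T.oppPerm

/-- The action of (homotopy classes of) paths on the sides. -/
def follow : Paths →* Equiv.Perm H :=
  PresentedGroup.toGroup (f := T.movePerm) (by
    intro r hr
    rcases hr with rfl | rfl
    · ext x
      simp [movePerm, pow_succ, rotPerm, T.rot_rot_rot]
    · ext x
      simp [movePerm, pow_succ, oppPerm, T.opp_opp])

/-- The surface is connected. -/
def Connected : Prop := ∀ x y : H, ∃ w : Paths, T.follow w x = y

/-- The covering projection from the sides of the triangulation of the universal cover. -/
def proj (x₀ : H) (w : Paths) : H := T.follow w x₀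

/-- The triangulation of the universal cover: its sides are the homotopy classes of paths in the
dual fatgraph that start at the side `x₀`. -/
def universalCover (x₀ : H) : Triangulation Paths where
  rot w := PresentedGroup.of Move.rot * w
  opp w := PresentedGroup.of Move.opp * w
  rot_rot_rot w := by
    have h3 : (PresentedGroup.of Move.rot : Paths) ^ 3 = 1 := by
      have := PresentedGroup.one_of_mem
        (rels := ({FreeGroup.of Move.rot ^ 3, FreeGroup.of Move.opp ^ 2} : Set (FreeGroup Move)))
        (x := FreeGroup.of Move.rot ^ 3) (by simp)
      simpa [PresentedGroup.of] using this
    rw [← mul_assoc, ← mul_assoc, ← pow_two, ← pow_succ, h3, one_mul]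
  rot_ne w h := by
    have h1 : (PresentedGroup.of Move.rot : Paths) = 1 := by simpa using h
    have h2 := congrArg (fun p => T.follow p x₀) h1
    simp [follow, movePerm, rotPerm, T.rot_ne] at h2
  opp_opp w := by
    have h3 : (PresentedGroup.of Move.opp : Paths) ^ 2 = 1 := by
      have := PresentedGroup.one_of_mem
        (rels := ({FreeGroup.of Move.rot ^ 3, FreeGroup.of Move.opp ^ 2} : Set (FreeGroup Move)))
        (x := FreeGroup.of Move.opp ^ 2) (by simp)
      simpa [PresentedGroup.of] using this
    rw [← mul_assoc, ← pow_two, h3, one_mul]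
  opp_ne w h := by
    have h1 : (PresentedGroup.of Move.opp : Paths) = 1 := by simpa using h
    have h2 := congrArg (fun p => T.follow p x₀) h1
    simp [follow, movePerm, oppPerm, T.opp_ne] at h2

/-- The ideal vertices: a side is identified with every side having the same starting point. -/
def IdealPoint : Type v := Quot (fun x y : H => y = T.rot (T.opp x))

/-- The ideal vertex at which a side starts. -/
def start (x : H) : T.IdealPoint := Quot.mk _ x

/-! ### Flips -/

/-- A set of edges (given by a set `E` of sides) such that no triangle has two sides in it. -/
structure Flippable (E : Set H) : Prop where
  opp_mem : ∀ x ∈ E, T.opp x ∈ E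
  rot_notMem : ∀ x ∈ E, T.rot x ∉ E

variable {T}

/-- No triangle has two sides in a flippable set. -/
theorem Flippable.rot_rot_notMem {E : Set H} (hE : T.Flippable E) (x : H) (hx : x ∈ E) :
    T.rot (T.rot x) ∉ E := fun h => hE.rot_notMem _ h (by rwa [T.rot_rot_rot])

variable (T)

open Classical in
/-- The next side of a triangle after all edges in `E` have been flipped.  The triangles
`a, b, e` and `c, d, e'` (with `e' = opp e`) become `a, e, d` and `b, c, e'`, where `e, e'` now
denote the two sides of the new diagonal. -/
def flipRot (E : Set H) (x : H) : H :=
  if x ∈ E then T.rot (T.rot (T.opp x))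
  else if T.rot (T.rot x) ∈ E then T.rot (T.rot x)
  else if T.rot x ∈ E then T.rot (T.opp (T.rot x))
  else T.rot x

theorem flipRot_mem {E : Set H} {x : H} (hx : x ∈ E) :
    T.flipRot E x = T.rot (T.rot (T.opp x)) := if_pos hx

theorem flipRot_left {E : Set H} (hE : T.Flippable E) {x : H} (hx : x ∈ E) :
    T.flipRot E (T.rot x) = x := by
  simp [flipRot, hE.rot_notMem x hx, T.rot_rot_rot, hx]

theorem flipRot_right {E : Set H} (hE : T.Flippable E) {x : H} (hx : x ∈ E) :
    T.flipRot E (T.rot (T.rot x)) = T.rot (T.opp x) := by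
  simp [flipRot, hE.rot_notMem x hx, hE.rot_rot_notMem x hx, T.rot_rot_rot, hx]

theorem flipRot_other {E : Set H} {x : H} (h0 : x ∉ E) (h1 : T.rot x ∉ E)
    (h2 : T.rot (T.rot x) ∉ E) : T.flipRot E x = T.rot x := by
  simp [flipRot, h0, h1, h2]

/-- The triangulation obtained by flipping all the edges in `E`. -/
def flip (E : Set H) (hE : T.Flippable E) : Triangulation H where
  rot := T.flipRot E
  opp := T.opp
  opp_opp := T.opp_opp
  opp_ne := T.opp_ne
  rot_rot_rot x := by
    by_cases h0 : x ∈ E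
    · rw [T.flipRot_mem h0, T.flipRot_right hE (hE.opp_mem x h0), T.opp_opp,
        T.flipRot_left hE h0]
    by_cases h1 : T.rot x ∈ E
    · have hx : x = T.rot (T.rot (T.rot x)) := (T.rot_rot_rot x).symm
      have h2 := T.flipRot_right hE h1
      rw [T.rot_rot_rot] at h2
      rw [h2, T.flipRot_left hE (hE.opp_mem _ h1), T.flipRot_mem (hE.opp_mem _ h1), T.opp_opp,
        T.rot_rot_rot]
    by_cases h2 : T.rot (T.rot x) ∈ E
    · have h3 := T.flipRot_left hE h2
      rw [T.rot_rot_rot] at h3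
      rw [h3, T.flipRot_mem h2, T.flipRot_right hE (hE.opp_mem _ h2), T.opp_opp, T.rot_rot_rot]
    · rw [T.flipRot_other h0 h1 h2, T.flipRot_other h1 h2 (by rwa [T.rot_rot_rot]),
        T.flipRot_other h2 (by rwa [T.rot_rot_rot]) (by rwa [T.rot_rot_rot]), T.rot_rot_rot]
  rot_ne x h := by
    by_cases h0 : x ∈ E
    · rw [T.flipRot_mem h0] at h
      exact hE.rot_rot_notMem _ (hE.opp_mem x h0) (by rwa [h])
    by_cases h1 : T.rot x ∈ E
    · have h2 := T.flipRot_right hE h1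
      rw [T.rot_rot_rot] at h2
      rw [h2] at h
      refine hE.rot_rot_notMem _ (hE.opp_mem _ h1) ?_
      rwa [h]
    by_cases h2 : T.rot (T.rot x) ∈ E
    · have h3 := T.flipRot_left hE h2
      rw [T.rot_rot_rot] at h3
      exact h0 (by rw [← h, h3]; exact h2)
    · rw [T.flipRot_other h0 h1 h2] at h
      exact T.rot_ne x h

theorem start_rot_opp (x : H) : T.start (T.rot (T.opp x)) = T.start x :=
  (Quot.sound (r := fun x y : H => y = T.rot (T.opp x)) (a := x) rfl).symm

open Classical in
/-- The ideal vertex of `T` at which the side `x` of the flipped triangulation starts: a side which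
is not flipped keeps its starting point, and the side `e = CA` of the quadrilateral `ABCD`
becomes `BD`. -/
def oldPoint (E : Set H) (x : H) : T.IdealPoint :=
  if x ∈ E then T.start (T.rot (T.rot x)) else T.start x

open Classical in
/-- The ideal vertex of the flipped triangulation at which the side `x` of `T` starts. -/
def newPoint (E : Set H) (hE : T.Flippable E) (x : H) : (T.flip E hE).IdealPoint :=
  if x ∈ E then (T.flip E hE).start (T.rot (T.opp x)) else (T.flip E hE).start x

theorem oldPoint_rel {E : Set H} (hE : T.Flippable E) (x : H) :
    T.oldPoint E x = T.oldPoint E (T.flipRot E (T.opp x)) := by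
  by_cases h0 : x ∈ E
  · rw [T.flipRot_mem (hE.opp_mem x h0), T.opp_opp, oldPoint, oldPoint, if_pos h0,
      if_neg (hE.rot_rot_notMem x h0)]
  have h0' : T.opp x ∉ E := fun h => h0 (by simpa [T.opp_opp] using hE.opp_mem _ h)
  rw [oldPoint, if_neg h0, oldPoint]
  by_cases h1 : T.rot (T.opp x) ∈ E
  · have h2 := T.flipRot_right hE h1
    rw [T.rot_rot_rot] at h2
    rw [h2, if_neg (hE.rot_notMem _ (hE.opp_mem _ h1)), start_rot_opp, start_rot_opp]
  by_cases h2 : T.rot (T.rot (T.opp x)) ∈ E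
  · have h3 := T.flipRot_left hE h2
    rw [T.rot_rot_rot] at h3
    rw [h3, if_pos h2, T.rot_rot_rot, start_rot_opp]
  · rw [T.flipRot_other h0' h1 h2, if_neg h1, start_rot_opp]

theorem start_flipRot_opp {E : Set H} (hE : T.Flippable E) (x : H) :
    (T.flip E hE).start (T.flipRot E (T.opp x)) = (T.flip E hE).start x :=
  (T.flip E hE).start_rot_opp x

theorem newPoint_rel {E : Set H} (hE : T.Flippable E) (x : H) :
    T.newPoint E hE x = T.newPoint E hE (T.rot (T.opp x)) := by
  by_cases h0 : x ∈ E
  · rw [newPoint, newPoint, if_pos h0, if_neg (hE.rot_notMem _ (hE.opp_mem x h0))]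
  have h0' : T.opp x ∉ E := fun h => h0 (by simpa [T.opp_opp] using hE.opp_mem _ h)
  rw [newPoint, if_neg h0, newPoint, ← T.start_flipRot_opp hE x]
  by_cases h1 : T.rot (T.opp x) ∈ E
  · have h2 := T.flipRot_right hE h1
    rw [T.rot_rot_rot] at h2
    rw [h2, if_pos h1]
  rw [if_neg h1]
  by_cases h2 : T.rot (T.rot (T.opp x)) ∈ E
  · have h3 := T.flipRot_left hE h2
    rw [T.rot_rot_rot] at h3
    rw [h3, ← T.start_flipRot_opp hE (T.rot (T.rot (T.opp x))),
      T.flipRot_mem (hE.opp_mem _ h2), T.opp_opp, T.rot_rot_rot]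
  · rw [T.flipRot_other h0' h1 h2]

/-- The identification of the ideal vertices after and before a flip. -/
def flipPoint (E : Set H) (hE : T.Flippable E) : (T.flip E hE).IdealPoint ≃ T.IdealPoint where
  toFun := Quot.lift (T.oldPoint E) (by rintro x y rfl; exact T.oldPoint_rel hE x)
  invFun := Quot.lift (T.newPoint E hE) (by rintro x y rfl; exact T.newPoint_rel hE x)
  left_inv := by
    rintro ⟨x⟩
    change Quot.lift _ _ (T.oldPoint E x) = (T.flip E hE).start x
    by_cases h0 : x ∈ E
    · rw [oldPoint, if_pos h0]
      change T.newPoint E hE (T.rot (T.rot x)) = _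
      rw [newPoint, if_neg (hE.rot_rot_notMem x h0), ← T.start_flipRot_opp hE x,
        T.flipRot_mem (hE.opp_mem x h0), T.opp_opp]
    · rw [oldPoint, if_neg h0]
      exact if_neg h0
  right_inv := by
    rintro ⟨x⟩
    change Quot.lift _ _ (T.newPoint E hE x) = T.start x
    by_cases h0 : x ∈ E
    · rw [newPoint, if_pos h0]
      change T.oldPoint E (T.rot (T.opp x)) = _
      rw [oldPoint, if_neg (hE.rot_notMem _ (hE.opp_mem x h0)), start_rot_opp]
    · rw [newPoint, if_neg h0]
      exact if_neg h0

/-- `x` and `y` are sides along the same edge. -/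
def SameEdge (x y : H) : Prop := y = x ∨ y = T.opp x

/-- The four sides `a, b, c, d` of the quadrilateral with diagonal `e` lie on four different
edges.  Here `e` is regarded as a side of the triangle `a, b, e`, while `opp e` is a side of the
triangle `c, d, opp e`. -/
def DistinctSides (e : H) : Prop :=
  List.Pairwise (fun x y => ¬ T.SameEdge x y)
    [T.rot e, T.rot (T.rot e), T.rot (T.opp e), T.rot (T.rot (T.opp e))]

variable {T}

theorem DistinctSides.flippable {e : H} (he : T.DistinctSides e) :
    T.Flippable {x | T.SameEdge e x} where
  opp_mem x hx := by
    rcases hx with rfl | rfl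
    · exact Or.inr rfl
    · exact Or.inl (T.opp_opp e)
  rot_notMem x hx h := by
    simp only [DistinctSides, SameEdge, List.pairwise_cons, List.mem_cons, not_or] at he
    have h1 := he.1
    have key : T.rot e ≠ T.opp e ∧ T.rot (T.opp e) ≠ e := by
      constructor
      · intro hh
        have := (he.2.1 (T.rot (T.opp e)) (Or.inl rfl)).1
        exact this (by rw [hh])
      · intro hh
        have := (he.1 (T.rot (T.rot (T.opp e))) (Or.inr (Or.inr (Or.inl rfl)))).1
        exact this (by rw [hh])
    rcases hx with rfl | rfl
    · rcases h with h | h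
      · exact T.rot_ne _ h
      · exact key.1 h
    · rcases h with h | h
      · exact key.2 h
      · exact T.rot_ne _ h

variable (T)

/-- The flip of the diagonal `e` of a quadrilateral with distinct sides. -/
def flipEdge (e : H) (he : T.DistinctSides e) : Triangulation H :=
  T.flip {x | T.SameEdge e x} he.flippable

/-- The set of all sides of the universal cover lying over the edge `e`. -/
theorem flippable_cover {e : H} (he : T.DistinctSides e) (x₀ : H) :
    (T.universalCover x₀).Flippable {w | T.SameEdge e (T.proj x₀ w)} where
  opp_mem w hw := by
    have : T.proj x₀ ((T.universalCover x₀).opp w) = T.opp (T.proj x₀ w) := by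
      simp [proj, universalCover, follow, movePerm, oppPerm]
    have h := he.flippable.opp_mem _ hw
    rw [← this] at h
    exact h
  rot_notMem w hw := by
    have : T.proj x₀ ((T.universalCover x₀).rot w) = T.rot (T.proj x₀ w) := by
      simp [proj, universalCover, follow, movePerm, rotPerm]
    have h := he.flippable.rot_notMem _ hw
    rw [← this] at h
    exact h

/-- The triangulation of the universal cover after flipping all the lifts of `e`. -/
def flipCover (e : H) (he : T.DistinctSides e) (x₀ : H) : Triangulation Paths :=
  (T.universalCover x₀).flip _ (T.flippable_cover he x₀)

end Triangulation

/-! ### Orientations, coordinates and lifts -/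

section Coordinates

variable {ι : Type u} {H : Type v}

/-- An orientation of the edges of the dual fatgraph (a representative of a spin structure):
`toward x` holds when the fatgraph edge across the side `x` points toward the triangle which
has `x` as a side. -/
structure EdgeOrientation (T : Triangulation H) where
  toward : H → Bool
  toward_opp : ∀ x, toward (T.opp x) = !toward x

open Classical in
/-- The evolution rule of orientations under a flip.  The fatgraph edge across the diagonal must
point toward the triangle `a, b, e`; after the flip the one across the new diagonal points toward
the triangle `a, e, d`, the orientation across `b` is reversed, and the others are kept. -/
def EdgeOrientation.flipEdge {T : Triangulation H} (ω : EdgeOrientation T) (e : H)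
    (he : T.DistinctSides e) : EdgeOrientation (T.flipEdge e he) where
  toward x := if T.SameEdge (T.rot (T.rot e)) x then !ω.toward x else ω.toward x
  toward_opp x := by
    have h : T.SameEdge (T.rot (T.rot e)) (T.opp x) ↔ T.SameEdge (T.rot (T.rot e)) x := by
      unfold Triangulation.SameEdge
      constructor
      · rintro (h | h)
        · right; rw [← h, T.opp_opp]
        · left; rw [← T.opp_opp x, h, T.opp_opp]
      · rintro (h | h)
        · right; rw [h]
        · left; rw [h, T.opp_opp]
    change (if T.SameEdge _ (T.opp x) then !ω.toward (T.opp x) else ω.toward (T.opp x)) = _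
    simp only [h, ω.toward_opp]
    split <;> rfl

/-- Coordinate vectors: a positive even `λ`-length for every edge, a positive even ratio for every
side of every triangle, and an ordered pair of odd coordinates for every triangle.  Across an edge
on which the two orientations agree, the two ratios are inverse to each other; across an edge
on which they differ (so that the lift interchanges the two fermions, whose rescalings are inverse
to each other) the two ratios agree. -/
structure Coord (ι : Type u) (T : Triangulation H) (ωσ ωι : EdgeOrientation T) where
  lam : H → Grassmann ι
  ratio : H → Grassmann ι
  odd₁ : H → Grassmann ι
  odd₂ : H → Grassmann ι
  lam_pos : ∀ x, IsPos (lam x)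
  lam_opp : ∀ x, lam (T.opp x) = lam x
  ratio_pos : ∀ x, IsPos (ratio x)
  ratio_opp : ∀ x, ratio (T.opp x) =
    if ωσ.toward x = ωι.toward x then (ratio x)⁻¹ʳ else ratio x
  odd₁_isOdd : ∀ x, IsOdd (odd₁ x)
  odd₂_isOdd : ∀ x, IsOdd (odd₂ x)
  odd₁_rot : ∀ x, odd₁ (T.rot x) = odd₁ x
  odd₂_rot : ∀ x, odd₂ (T.rot x) = odd₂ x

namespace Coord

variable {T : Triangulation H} {ωσ ωι : EdgeOrientation T} (c : Coord ι T ωσ ωι)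

/-- The cross-ratio `a c / (b d)` of an edge. -/
def crossRatio (x : H) : Grassmann ι :=
  (c.lam (T.rot x) * c.lam (T.rot (T.opp x))) *
    (c.lam (T.rot (T.rot x)) * c.lam (T.rot (T.rot (T.opp x))))⁻¹ʳ

/-- The odd coordinates of the triangle across the side `x`, in the order and with the sign in
which they enter the standard position of the quadrilateral around `x`: the sign is `+` if the
fatgraph edge points toward the triangle of `x` and `-` otherwise, and the order is reversed if
the two orientations differ. -/
def across₁ (x : H) : Grassmann ι :=
  (if ωσ.toward x = true then 1 else -1) *
    (if ωσ.toward x = ωι.toward x then c.odd₁ (T.opp x) else c.odd₂ (T.opp x))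

/-- See `across₁`. -/
def across₂ (x : H) : Grassmann ι :=
  (if ωσ.toward x = true then 1 else -1) *
    (if ωσ.toward x = ωι.toward x then c.odd₂ (T.opp x) else c.odd₁ (T.opp x))

/-- The admissible transformation which turns the quadrilateral around `x` upside down: `Υ`,
followed by the involution `Ψ` if the two orientations differ, and by the sign change `Z_{-1}` if
the fatgraph edge points away from the triangle of `x`. -/
def crossing (x : H) (X : SMat ι) : SMat ι :=
  let Y := ad (Upsilon (c.crossRatio x) (c.ratio x)) X
  let Y' := if ωσ.toward x = ωι.toward x then Y else Psi Y
  if ωσ.toward x = true then Y' else ad (Zmat (-1)) Y'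

/-- The map `ℓ` from the ideal vertices of the triangulation `U` of the universal cover to the
special light cone is a lift for the coordinates `c` (pulled back by the projection `π`).
The frame `g x` is the transformation which brings the quadrilateral with diagonal `x = CA` to
standard position; frames are related by admissible transformations only. -/
def IsLift {K : Type} (U : Triangulation K) (π : K → H)
    (c : Coord ι T ωσ ωι) (ℓ : U.IdealPoint → LightCone ι) : Prop :=
  ∃ g : K → SLtilde ι, ∀ x : K,
    (let A : SMat ι := ℓ (U.start (U.rot x))
     let B : SMat ι := ℓ (U.start (U.rot (U.rot x)))
     let C : SMat ι := ℓ (U.start x)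
     let D : SMat ι := ℓ (U.start (U.rot (U.rot (U.opp x))))
     let γ : SMat ι → SMat ι := (g x : Equiv.Perm (SMat ι))
     pairing A C = c.lam (π x) ^ 2 ∧
     StdQuad (c.crossRatio (π x)) (c.ratio (π x)) (c.odd₁ (π x)) (c.odd₂ (π x))
       (c.across₁ (π x)) (c.across₂ (π x)) (γ A) (γ B) (γ C) (γ D) ∧
     (∀ X, (g (U.rot x) : Equiv.Perm (SMat ι)) X =
       ad (Pgen (c.odd₁ (π x)) (c.odd₂ (π x)) (c.ratio (π x)) (c.ratio (T.rot (π x)))) (γ X)) ∧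
     (∀ X, (g (U.opp x) : Equiv.Perm (SMat ι)) X = c.crossing (π x) (γ X)))

/-- `c'` is obtained from `c` by a Ptolemy transform along the flip of `e`: the coordinates away
from the quadrilateral are unchanged, and the two coordinate vectors produce the same lift
(they have a common lift, and every lift of one of them is a lift of the other). -/
structure IsPtolemyTransform (c : Coord ι T ωσ ωι) (e : H) (he : T.DistinctSides e)
    (c' : Coord ι (T.flipEdge e he) (ωσ.flipEdge e he) (ωι.flipEdge e he)) : Prop where
  lam_eq : ∀ x, ¬ T.SameEdge e x → c'.lam x = c.lam x
  ratio_eq : ∀ x, (∀ y ∈ [e, T.rot e, T.rot (T.rot e), T.rot (T.opp e), T.rot (T.rot (T.opp e))],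
    ¬ T.SameEdge y x) → c'.ratio x = c.ratio x
  odd_eq : ∀ x, x ∉ [e, T.rot e, T.rot (T.rot e),
      T.opp e, T.rot (T.opp e), T.rot (T.rot (T.opp e))] →
    c'.odd₁ x = c.odd₁ x ∧ c'.odd₂ x = c.odd₂ x
  exists_lift : ∀ x₀ : H, ∃ ℓ : (T.universalCover x₀).IdealPoint → LightCone ι,
    IsLift (T.universalCover x₀) (T.proj x₀) c ℓ
  same_lift : ∀ (x₀ : H) (ℓ : (T.universalCover x₀).IdealPoint → LightCone ι),
    IsLift (T.universalCover x₀) (T.proj x₀) c ℓ ↔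
      IsLift (T.flipCover e he x₀) (T.proj x₀) c'
        (ℓ ∘ (T.universalCover x₀).flipPoint _ (T.flippable_cover he x₀))

end Coord

end Coordinates

end SuperTeich

end

open SuperTeich
open scoped Ring

/-!
# Flips of decorated super-Teichmüller coordinates

Let `g` be the transformations which certify that `ℓ` is a lift, and normalise them to
`G x = Z_h g x`, where `h` is the ratio of the side `x`. Writing `Q_θ = Z_{c_θ} P'` and
`X_x = K_x J D_{√χ} Z_h⁻¹`, where `K_x` collects the sign `Z_{-1}` and the involution `Ψ` attached to
the edge of `x`, the conditions on `g` become
`G (rot x) = Q_θ * G x` and `G (opp x) = X_x * G x` (`Coord.IsFrame`),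
and the conditions on the vertices become the single requirement that `G x` moves the vertex at which
`x` starts to a multiple of `(1, 0, 0, 0 | 0, 0, 0, 0)` which is determined by the `λ`-lengths
(`Coord.IsPlaced`). This reformulation is `Coord.isLift_iff_isFramed`. It uses that the group
preserves the pairing, and that `Q_θ` rotates the vertices of the standard triangle.

*Existence of lifts.* As `Q_θ³ = 1` (`qG_cube`) and `X_{opp x} X_x = 1` (`Coord.crossElt_opp_mul`), a
frame can be transported along the paths which make up the universal cover; the transported frames
determine where the ideal vertices have to be, and these positions are consistent around each vertex
(`Coord.exists_isLift`).

*Flips.* A flip replaces `G x` by `M_x * G x`, where `M_x` (`Coord.flipChange`) is `1` away from the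
quadrilateral, and along its four sides is one of the diagonal transformations `changeA`, `changeB`,
`changeC`, `changeD`. Being diagonal, these commute with crossing an edge up to the changes of the
cross-ratio, of the ratio and of the orientation of that edge (`Coord.crossElt_mul_flipChange`); this
is where the formulas for the new ratios, the new diagonal and the reversal of the edge across `b`
come from. Inside the quadrilateral the relations among the old frames and those among the new ones
are equivalent as soon as three identities in the group hold (`quadrilateral_iff`): `changeD_mul`,
`changeC_mul` and `changeB_mul`. They reduce to the matrix identities `flipMatrix_sideD`,
`flipMatrix_sideC` and `flipMatrix_sideB`, whose entries are checked in a commutative ring: the even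
entries involve only the products in `FlipRel`, and the odd entries are linear in odd elements over
the even part (`OddFlipRel`). Altogether `Coord.isFrame_flip_iff` and `Coord.isPlaced_flip_iff` give
`Coord.isFramed_flip_iff`: both coordinate vectors have the same lifts.

The formula for the new diagonal is `Coord.lam_mul_flipDiag`, a computation with `𝒟²`.
-/

noncomputable section

namespace SuperTeich

open MulOpposite
open scoped Ring

universe u v

section

variable {ι : Type u}

/-! ### Even and odd elements of the Grassmann algebra -/

namespace IsEven

theorem mul {x y : Grassmann ι} (hx : IsEven x) (hy : IsEven y) : IsEven (x * y) :=
  CliffordAlgebra.evenOdd_mul_le _ 0 0 (Submodule.mul_mem_mul hx hy)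

theorem mul_odd {x y : Grassmann ι} (hx : IsEven x) (hy : IsOdd y) : IsOdd (x * y) :=
  CliffordAlgebra.evenOdd_mul_le _ 0 1 (Submodule.mul_mem_mul hx hy)

theorem add {x y : Grassmann ι} (hx : IsEven x) (hy : IsEven y) : IsEven (x + y) :=
  Submodule.add_mem _ hx hy

theorem sub {x y : Grassmann ι} (hx : IsEven x) (hy : IsEven y) : IsEven (x - y) :=
  Submodule.sub_mem _ hx hy

theorem neg {x : Grassmann ι} (hx : IsEven x) : IsEven (-x) :=
  Submodule.neg_mem _ hx

theorem smul {x : Grassmann ι} (r : ℝ) (hx : IsEven x) : IsEven (r • x) :=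
  Submodule.smul_mem _ r hx

theorem algebraMap (r : ℝ) : IsEven (algebraMap ℝ (Grassmann ι) r) :=
  SetLike.algebraMap_mem_graded _ _

theorem zero : IsEven (0 : Grassmann ι) := Submodule.zero_mem _

theorem one : IsEven (1 : Grassmann ι) := SetLike.one_mem_graded _

end IsEven

namespace IsOdd

theorem mul {x y : Grassmann ι} (hx : IsOdd x) (hy : IsOdd y) : IsEven (x * y) :=
  CliffordAlgebra.evenOdd_mul_le _ 1 1 (Submodule.mul_mem_mul hx hy)

theorem mul_even {x y : Grassmann ι} (hx : IsOdd x) (hy : IsEven y) : IsOdd (x * y) :=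
  CliffordAlgebra.evenOdd_mul_le _ 1 0 (Submodule.mul_mem_mul hx hy)

theorem add {x y : Grassmann ι} (hx : IsOdd x) (hy : IsOdd y) : IsOdd (x + y) :=
  Submodule.add_mem _ hx hy

theorem sub {x y : Grassmann ι} (hx : IsOdd x) (hy : IsOdd y) : IsOdd (x - y) :=
  Submodule.sub_mem _ hx hy

theorem neg {x : Grassmann ι} (hx : IsOdd x) : IsOdd (-x) :=
  Submodule.neg_mem _ hx

theorem zero : IsOdd (0 : Grassmann ι) := Submodule.zero_mem _

end IsOdd

theorem ι_mul_ι_swap (m m' : ι →₀ ℝ) :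
    ExteriorAlgebra.ι ℝ m * ExteriorAlgebra.ι ℝ m' =
      -(ExteriorAlgebra.ι ℝ m' * ExteriorAlgebra.ι ℝ m) :=
  eq_neg_of_add_eq_zero_left (ExteriorAlgebra.ι_add_mul_swap m m')

/-- Even elements are central. -/
theorem IsEven.commute {x : Grassmann ι} (hx : IsEven x) (y : Grassmann ι) : Commute x y := by
  have key : ∀ m : ι →₀ ℝ, Commute x (ExteriorAlgebra.ι ℝ m) := by
    intro m
    induction x, hx using CliffordAlgebra.even_induction with
    | algebraMap r => exact Algebra.commute_algebraMap_left r _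
    | add x y _ _ hx hy => exact hx.add_left hy
    | ι_mul_ι_mul a b x _ hx =>
      refine Commute.mul_left ?_ hx
      change ExteriorAlgebra.ι ℝ a * ExteriorAlgebra.ι ℝ b * ExteriorAlgebra.ι ℝ m =
        ExteriorAlgebra.ι ℝ m * (ExteriorAlgebra.ι ℝ a * ExteriorAlgebra.ι ℝ b)
      rw [mul_assoc, ι_mul_ι_swap b m, mul_neg, ← mul_assoc, ι_mul_ι_swap a m, neg_mul, neg_neg,
        mul_assoc]
  induction y using ExteriorAlgebra.induction with
  | algebraMap r => exact Algebra.commute_algebraMap_right r _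
  | ι m => exact key m
  | mul a b ha hb => exact ha.mul_right hb
  | add a b ha hb => exact ha.add_right hb

/-- Odd elements anticommute. -/
theorem IsOdd.anticomm {x y : Grassmann ι} (hx : IsOdd x) (hy : IsOdd y) : x * y = -(y * x) := by
  have key : ∀ m : ι →₀ ℝ, x * ExteriorAlgebra.ι ℝ m = -(ExteriorAlgebra.ι ℝ m * x) := by
    intro m
    induction x, hx using CliffordAlgebra.odd_induction with
    | ι v => exact ι_mul_ι_swap v m
    | add x y _ _ hx hy => rw [add_mul, mul_add, hx, hy, neg_add]
    | ι_mul_ι_mul a b x _ hx =>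
      have h := IsEven.commute (CliffordAlgebra.ι_mul_ι_mem_evenOdd_zero
        (0 : QuadraticForm ℝ (ι →₀ ℝ)) a b) (ExteriorAlgebra.ι ℝ m)
      rw [mul_assoc, hx, mul_neg, ← mul_assoc, h.eq, mul_assoc]
  induction y, hy using CliffordAlgebra.odd_induction with
  | ι v => exact key v
  | add y z _ _ hy hz => rw [add_mul, mul_add, hy, hz, neg_add]
  | ι_mul_ι_mul a b y _ hy =>
    have h := IsEven.commute (CliffordAlgebra.ι_mul_ι_mem_evenOdd_zero
        (0 : QuadraticForm ℝ (ι →₀ ℝ)) a b) x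
    rw [← mul_assoc, ← h.eq, mul_assoc, hy, mul_neg, ← mul_assoc]

theorem IsOdd.mul_self {x : Grassmann ι} (hx : IsOdd x) : x * x = 0 := by
  have h2 : (2 : ℝ) • (x * x) = 0 := by
    rw [two_smul]
    exact eq_neg_iff_add_eq_zero.mp (hx.anticomm hx)
  exact (smul_eq_zero.mp h2).resolve_left two_ne_zero

/-! ### The body and positive even elements -/

@[simp] theorem body_mul (x y : Grassmann ι) : body (x * y) = body x * body y := map_mul _ x y

@[simp] theorem body_add (x y : Grassmann ι) : body (x + y) = body x + body y := map_add _ x y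

@[simp] theorem body_one : body (1 : Grassmann ι) = 1 := map_one _

@[simp] theorem body_algebraMap (r : ℝ) : body (algebraMap ℝ (Grassmann ι) r) = r :=
  ExteriorAlgebra.algebraMap_leftInverse _ r

@[simp] theorem body_smul (r : ℝ) (x : Grassmann ι) : body (r • x) = r * body x :=
  map_smul ExteriorAlgebra.algebraMapInv r x

theorem body_ι (m : ι →₀ ℝ) : body (ExteriorAlgebra.ι ℝ m) = 0 := by
  simp [body, ExteriorAlgebra.algebraMapInv]

theorem IsOdd.body {x : Grassmann ι} (hx : IsOdd x) : body x = 0 := by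
  induction x, hx using CliffordAlgebra.odd_induction with
  | ι v => exact body_ι v
  | add x y _ _ hx hy => rw [body_add, hx, hy, add_zero]
  | ι_mul_ι_mul a b x _ hx => rw [body_mul, hx, mul_zero]

/-- The even part of the Grassmann algebra, as a commutative ring. -/
abbrev EvenPart (ι : Type u) := CliffordAlgebra.even (0 : QuadraticForm ℝ (ι →₀ ℝ))

theorem mem_evenPart {x : Grassmann ι} : x ∈ EvenPart ι ↔ IsEven x := by
  rw [← Subalgebra.mem_toSubmodule, CliffordAlgebra.even_toSubmodule]; rfl

instance : CommRing (EvenPart ι) :=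
  { (inferInstance : Ring (EvenPart ι)) with
    mul_comm := fun x y => Subtype.ext ((mem_evenPart.mp x.2).commute y) }

/-- An even element is the sum of its body and a nilpotent element. -/
theorem isNilpotent_sub_body (x : EvenPart ι) :
    IsNilpotent (x - algebraMap ℝ (EvenPart ι) (body (x : Grassmann ι))) := by
  obtain ⟨x, hx'⟩ := x
  have hx := mem_evenPart.mp hx'
  induction x, hx using CliffordAlgebra.even_induction with
  | algebraMap r =>
    have : (⟨_, hx'⟩ : EvenPart ι) = algebraMap ℝ (EvenPart ι) r := rfl
    rw [this]
    have h2 : body ((algebraMap ℝ (EvenPart ι) r : EvenPart ι) : Grassmann ι) = r :=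
      body_algebraMap r
    rw [h2, sub_self]
    exact IsNilpotent.zero
  | add x y hx0 hy0 hx hy =>
    have h1 := hx (mem_evenPart.mpr hx0)
    have h2 := hy (mem_evenPart.mpr hy0)
    have hsplit : (⟨x + y, hx'⟩ : EvenPart ι) =
      ⟨x, mem_evenPart.mpr hx0⟩ + ⟨y, mem_evenPart.mpr hy0⟩ := rfl
    have hb : body ((⟨x + y, hx'⟩ : EvenPart ι) : Grassmann ι) = body x + body y := body_add x y
    rw [hb, hsplit, map_add, add_sub_add_comm]
    exact (Commute.all _ _).isNilpotent_add h1 h2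
  | ι_mul_ι_mul a b x hx0 hx =>
    have hb : body (CliffordAlgebra.ι (0 : QuadraticForm ℝ (ι →₀ ℝ)) a *
        CliffordAlgebra.ι (0 : QuadraticForm ℝ (ι →₀ ℝ)) b * x) = 0 := by
      have := body_ι a
      rw [body_mul, body_mul]
      erw [this]
      simp
    have hab := CliffordAlgebra.ι_mul_ι_mem_evenOdd_zero
        (0 : QuadraticForm ℝ (ι →₀ ℝ)) a b
    have hsplit : (⟨_, hx'⟩ : EvenPart ι) =
      (⟨_, mem_evenPart.mpr hab⟩ : EvenPart ι) * ⟨x, mem_evenPart.mpr hx0⟩ := rfl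
    rw [hb, map_zero, sub_zero, hsplit]
    refine (Commute.all _ _).isNilpotent_mul_right ⟨2, Subtype.ext ?_⟩
    change (ExteriorAlgebra.ι ℝ a * ExteriorAlgebra.ι ℝ b) ^ 2 = 0
    rw [pow_two, mul_assoc, ← mul_assoc _ (ExteriorAlgebra.ι ℝ a), ι_mul_ι_swap b a]
    simp [mul_assoc]

theorem isUnit_of_body_ne_zero {x : EvenPart ι} (hx : body (x : Grassmann ι) ≠ 0) : IsUnit x := by
  have h := (isNilpotent_sub_body x).isUnit_add_left_of_commute
    (u := algebraMap ℝ (EvenPart ι) (body (x : Grassmann ι)))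
    ((IsUnit.mk0 _ hx).map (algebraMap ℝ (EvenPart ι))) (Commute.all _ _)
  simpa using h

theorem IsPos.isUnit_even {x : Grassmann ι} (hx : IsPos x) :
    IsUnit (⟨x, mem_evenPart.mpr hx.1⟩ : EvenPart ι) :=
  isUnit_of_body_ne_zero hx.2.ne'

theorem IsPos.isUnit {x : Grassmann ι} (hx : IsPos x) : IsUnit x :=
  hx.isUnit_even.map (EvenPart ι).val

theorem IsPos.mul {x y : Grassmann ι} (hx : IsPos x) (hy : IsPos y) : IsPos (x * y) :=
  ⟨hx.1.mul hy.1, by rw [body_mul]; exact mul_pos hx.2 hy.2⟩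

theorem IsPos.add {x y : Grassmann ι} (hx : IsPos x) (hy : IsPos y) : IsPos (x + y) :=
  ⟨hx.1.add hy.1, by rw [body_add]; exact add_pos hx.2 hy.2⟩

theorem IsPos.one : IsPos (1 : Grassmann ι) := ⟨IsEven.one, by simp⟩

theorem IsPos.inverse {x : Grassmann ι} (hx : IsPos x) : IsPos x⁻¹ʳ := by
  obtain ⟨u, hu⟩ := hx.isUnit_even
  have h1 : x * ((u⁻¹ : (EvenPart ι)ˣ) : EvenPart ι) = 1 := by
    have := congrArg Subtype.val u.mul_inv
    rw [hu] at this
    exact this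
  have h2 : x⁻¹ʳ = ((u⁻¹ : (EvenPart ι)ˣ) : EvenPart ι) := by
    rw [← mul_one x⁻¹ʳ, ← h1, ← mul_assoc, Ring.inverse_mul_cancel _ hx.isUnit, one_mul]
  refine ⟨h2 ▸ mem_evenPart.mp (Subtype.prop _), ?_⟩
  have h3 := congrArg body h1
  rw [← h2, body_mul, body_one] at h3
  exact pos_of_mul_pos_right (by rw [h3]; exact one_pos) hx.2.le

/-- Positive even elements with equal squares are equal. -/
theorem IsPos.eq_of_mul_self_eq {x y : Grassmann ι} (hx : IsPos x) (hy : IsPos y)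
    (h : x * x = y * y) : x = y := by
  have h1 : (x + y) * (x - y) = (x + y) * 0 := by
    rw [add_mul, mul_sub, mul_sub, h, (hx.1.commute y).eq]
    simp
  exact sub_eq_zero.mp ((hx.add hy).isUnit.mul_left_cancel h1)

/-- Existence of square roots, by lifting the square root of the body along the nilpotent soul. -/
theorem IsPos.exists_sqrt {x : Grassmann ι} (hx : IsPos x) : ∃ y, IsPos y ∧ y * y = x := by
  set X : EvenPart ι := ⟨x, mem_evenPart.mpr hx.1⟩ with hX
  set P : Polynomial (EvenPart ι) := Polynomial.X ^ 2 - Polynomial.C X with hP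
  set s : EvenPart ι := algebraMap ℝ _ (Real.sqrt (body x)) with hs
  have hss : s ^ 2 = algebraMap ℝ _ (body x) := by
    rw [hs, ← map_pow, Real.sq_sqrt hx.2.le]
  have h1 : IsNilpotent (Polynomial.aeval s P) := by
    have : Polynomial.aeval s P = -(X - algebraMap ℝ _ (body x)) := by
      simp [hP, hss]
    rw [this]
    exact (isNilpotent_sub_body X).neg
  have h2 : IsUnit (Polynomial.aeval s (Polynomial.derivative P)) := by
    have : Polynomial.aeval s (Polynomial.derivative P) =
        algebraMap ℝ _ (2 * Real.sqrt (body x)) := by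
      simp only [hP, hs, Polynomial.derivative_sub, Polynomial.derivative_X_pow,
        Polynomial.derivative_C, map_mul]
      simp [map_ofNat (algebraMap ℝ (EvenPart ι)) 2]
    rw [this]
    exact (IsUnit.mk0 _ (by have := Real.sqrt_pos.mpr hx.2; positivity)).map _
  obtain ⟨r, ⟨hr1, hr2⟩, -⟩ := Polynomial.existsUnique_nilpotent_sub_and_aeval_eq_zero h1 h2
  have hr3 : r ^ 2 = X := by simpa [hP, sub_eq_zero] using hr2
  refine ⟨r, ⟨mem_evenPart.mp r.2, ?_⟩, ?_⟩
  · have h3 : IsNilpotent (body ((s - r : EvenPart ι) : Grassmann ι)) :=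
      hr1.map ((ExteriorAlgebra.algebraMapInv : Grassmann ι →ₐ[ℝ] ℝ).comp (EvenPart ι).val)
    have h4 := h3.eq_zero
    have h5 : body (s : Grassmann ι) = Real.sqrt (body x) := body_algebraMap _
    have h6 : body ((s - r : EvenPart ι) : Grassmann ι) = body (s : Grassmann ι) - body r.1 :=
      map_sub (ExteriorAlgebra.algebraMapInv : Grassmann ι →ₐ[ℝ] ℝ) _ _
    have h7 : body r.1 = Real.sqrt (body x) := by linarith
    rw [h7]
    exact Real.sqrt_pos.mpr hx.2
  · rw [← pow_two]
    exact congrArg Subtype.val hr3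

theorem IsPos.gsqrt_spec {x : Grassmann ι} (hx : IsPos x) :
    IsPos (gsqrt x) ∧ gsqrt x * gsqrt x = x := by
  have h := hx.exists_sqrt
  rw [gsqrt, dif_pos h]
  exact h.choose_spec

end

section

variable {ι : Type u}

/-! ### The group of positive even elements and pairs of odd elements -/

/-- The positive even elements, as a group under multiplication. -/
def Pos (ι : Type u) : Type u := {x : Grassmann ι // IsPos x}

namespace Pos

instance : CoeOut (Pos ι) (Grassmann ι) := ⟨Subtype.val⟩

@[ext] theorem ext {a b : Pos ι} (h : (a : Grassmann ι) = b) : a = b := Subtype.ext h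

instance : Mul (Pos ι) := ⟨fun a b => ⟨a.1 * b.1, a.2.mul b.2⟩⟩
instance : One (Pos ι) := ⟨⟨1, IsPos.one⟩⟩
instance : Inv (Pos ι) := ⟨fun a => ⟨a.1⁻¹ʳ, a.2.inverse⟩⟩

@[simp] theorem coe_mul (a b : Pos ι) : ((a * b : Pos ι) : Grassmann ι) = a * b := rfl
@[simp] theorem coe_one : ((1 : Pos ι) : Grassmann ι) = 1 := rfl
theorem coe_inv (a : Pos ι) : ((a⁻¹ : Pos ι) : Grassmann ι) = (a : Grassmann ι)⁻¹ʳ := rfl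

instance : CommGroup (Pos ι) where
  mul_assoc a b c := Pos.ext (mul_assoc a.1 b.1 c.1)
  one_mul a := Pos.ext (one_mul a.1)
  mul_one a := Pos.ext (mul_one a.1)
  inv_mul_cancel a := Pos.ext (Ring.inverse_mul_cancel _ a.2.isUnit)
  mul_comm a b := Pos.ext (a.2.1.commute b.1)

theorem isEven (a : Pos ι) : IsEven (a : Grassmann ι) := a.2.1

@[simp] theorem mul_inv_coe (a : Pos ι) : (a : Grassmann ι) * ((a⁻¹ : Pos ι) : Grassmann ι) = 1 :=
  congrArg Subtype.val (mul_inv_cancel a)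

@[simp] theorem inv_mul_coe (a : Pos ι) : ((a⁻¹ : Pos ι) : Grassmann ι) * (a : Grassmann ι) = 1 :=
  congrArg Subtype.val (inv_mul_cancel a)

theorem comm (a : Pos ι) (x : Grassmann ι) : x * (a : Grassmann ι) = a * x :=
  (a.isEven.commute x).eq.symm

@[simp] theorem mul_inv_cancel_left_coe (a : Pos ι) (x : Grassmann ι) :
    (a : Grassmann ι) * (((a⁻¹ : Pos ι) : Grassmann ι) * x) = x := by
  rw [← mul_assoc, mul_inv_coe, one_mul]

@[simp] theorem inv_mul_cancel_left_coe (a : Pos ι) (x : Grassmann ι) :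
    ((a⁻¹ : Pos ι) : Grassmann ι) * ((a : Grassmann ι) * x) = x := by
  rw [← mul_assoc, inv_mul_coe, one_mul]

theorem eq_of_mul_self_eq {a b : Pos ι} (h : a * a = b * b) : a = b :=
  Pos.ext (a.2.eq_of_mul_self_eq b.2 (congrArg Subtype.val h))

/-- A positive even element as an element of the even part. -/
def even (a : Pos ι) : EvenPart ι := ⟨a, mem_evenPart.mpr a.isEven⟩

/-- The positive square root. -/
def sqrt (a : Pos ι) : Pos ι := ⟨gsqrt a, a.2.gsqrt_spec.1⟩

@[simp] theorem sqrt_mul_sqrt (a : Pos ι) : a.sqrt * a.sqrt = a := Pos.ext a.2.gsqrt_spec.2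

theorem sqrt_eq {a b : Pos ι} (h : b * b = a) : a.sqrt = b :=
  eq_of_mul_self_eq (by rw [sqrt_mul_sqrt, h])

theorem sqrt_mul (a b : Pos ι) : (a * b).sqrt = a.sqrt * b.sqrt :=
  sqrt_eq (by rw [mul_mul_mul_comm, sqrt_mul_sqrt, sqrt_mul_sqrt])

theorem sqrt_inv (a : Pos ι) : a⁻¹.sqrt = a.sqrt⁻¹ :=
  sqrt_eq (by rw [← mul_inv, sqrt_mul_sqrt])

theorem sqrt_sq (a : Pos ι) : (a * a).sqrt = a := sqrt_eq rfl

/-- The constant `2`. -/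
def two : Pos ι := ⟨algebraMap ℝ _ 2, IsEven.algebraMap 2, by rw [body_algebraMap]; exact two_pos⟩

end Pos

/-- Ordered pairs of odd elements. -/
@[ext] structure OddPair (ι : Type u) where
  fst : Grassmann ι
  snd : Grassmann ι
  fst_odd : IsOdd fst
  snd_odd : IsOdd snd

namespace OddPair

/-- The rescaled pair `(a θ₁, a⁻¹ θ₂)`. -/
def scale (a : Pos ι) (θ : OddPair ι) : OddPair ι :=
  ⟨a * θ.fst, (a⁻¹ : Pos ι) * θ.snd, a.isEven.mul_odd θ.fst_odd, a⁻¹.isEven.mul_odd θ.snd_odd⟩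

/-- The pair in the opposite order. -/
def swap (θ : OddPair ι) : OddPair ι := ⟨θ.snd, θ.fst, θ.snd_odd, θ.fst_odd⟩

/-- The pair `(-θ₁, -θ₂)`. -/
def neg (θ : OddPair ι) : OddPair ι := ⟨-θ.fst, -θ.snd, θ.fst_odd.neg, θ.snd_odd.neg⟩

theorem even_mul (θ : OddPair ι) : IsEven (θ.fst * θ.snd) := θ.fst_odd.mul θ.snd_odd

/-- The product `θ₁ θ₂`. -/
def prod (θ : OddPair ι) : EvenPart ι := ⟨θ.fst * θ.snd, mem_evenPart.mpr θ.even_mul⟩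

/-- The constant `c_θ`. -/
def cPos (θ : OddPair ι) : Pos ι :=
  ⟨cc θ.fst θ.snd, IsEven.one.add (θ.even_mul.smul _), by
    rw [cc, body_add, body_smul, body_mul, θ.fst_odd.body]; simp⟩

theorem cPos_coe (θ : OddPair ι) :
    (θ.cPos : Grassmann ι) = 1 + (1 / 6 : ℝ) • (θ.fst * θ.snd) := rfl

theorem fst_mul_fst (θ : OddPair ι) : θ.fst * θ.fst = 0 := θ.fst_odd.mul_self
theorem snd_mul_snd (θ : OddPair ι) : θ.snd * θ.snd = 0 := θ.snd_odd.mul_self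
theorem snd_mul_fst (θ : OddPair ι) : θ.snd * θ.fst = -(θ.fst * θ.snd) :=
  θ.snd_odd.anticomm θ.fst_odd

theorem prod_mul_prod (θ : OddPair ι) : θ.fst * θ.snd * (θ.fst * θ.snd) = 0 := by
  rw [mul_assoc, ← mul_assoc θ.snd, snd_mul_fst, neg_mul, mul_assoc, snd_mul_snd]; simp

theorem fst_mul_prod (θ : OddPair ι) : θ.fst * (θ.fst * θ.snd) = 0 := by
  rw [← mul_assoc, fst_mul_fst, zero_mul]

theorem prod_mul_snd (θ : OddPair ι) : θ.fst * θ.snd * θ.snd = 0 := by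
  rw [mul_assoc, snd_mul_snd, mul_zero]

theorem prod_mul_fst (θ : OddPair ι) : θ.fst * θ.snd * θ.fst = 0 := by
  rw [(θ.even_mul.commute _).eq, fst_mul_prod]

theorem snd_mul_prod (θ : OddPair ι) : θ.snd * (θ.fst * θ.snd) = 0 := by
  rw [← (θ.even_mul.commute _).eq, prod_mul_snd]

theorem scale_prod (a : Pos ι) (θ : OddPair ι) :
    (a.1 * θ.fst) * ((a⁻¹ : Pos ι) * θ.snd) = θ.fst * θ.snd := by
  rw [mul_assoc, ← mul_assoc θ.fst, Pos.comm, mul_assoc, Pos.mul_inv_cancel_left_coe]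

theorem cPos_scale (a : Pos ι) (θ : OddPair ι) : (θ.scale a).cPos = θ.cPos :=
  Pos.ext (by rw [cPos_coe, cPos_coe]; simp only [scale]; rw [scale_prod])

end OddPair

/-! ### Calculus of supermatrices -/

theorem smat_mul (a p b q f r c s d a' p' b' q' f' r' c' s' d' : Grassmann ι) :
    smat a p b q f r c s d * smat a' p' b' q' f' r' c' s' d' =
      smat (a' * a + q' * p + c' * b) (p' * a + f' * p + s' * b) (b' * a + r' * p + d' * b)
        (a' * q + q' * f + c' * r) (p' * q + f' * f + s' * r) (b' * q + r' * f + d' * r)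
        (a' * c + q' * s + c' * d) (p' * c + f' * s + s' * d) (b' * c + r' * s + d' * d) := by
  ext i j
  fin_cases i <;> fin_cases j <;> simp [smat, Matrix.mul_apply, Fin.sum_univ_three]

theorem smat_one : (1 : SMat ι) = smat 1 0 0 0 1 0 0 0 1 := by
  ext i j
  fin_cases i <;> fin_cases j <;> simp [smat]

theorem smat_smul (t a p b q f r c s d : Grassmann ι) :
    op t • smat a p b q f r c s d =
      smat (a * t) (p * t) (b * t) (q * t) (f * t) (r * t) (c * t) (s * t) (d * t) := by
  ext i j
  fin_cases i <;> fin_cases j <;> simp [smat]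

theorem smat_entries (M : SMat ι) : smat (entry M 0 0) (entry M 0 1) (entry M 0 2) (entry M 1 0)
    (entry M 1 1) (entry M 1 2) (entry M 2 0) (entry M 2 1) (entry M 2 2) = M := by
  ext i j
  fin_cases i <;> fin_cases j <;> simp [smat, entry]

theorem Psi_smat (a p b q f r c s d : Grassmann ι) :
    Psi (smat a p b q f r c s d) = smat (-d) r b (-s) (-f) p c (-q) (-a) := by
  ext i j
  fin_cases i <;> fin_cases j <;> simp [smat, Psi]

/-! ### Invertible supermatrices acting by conjugation -/

/-- Conjugation by invertible supermatrices. -/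
def conj : (SMat ι)ˣ →* Equiv.Perm (SMat ι) where
  toFun u :=
    { toFun := fun X => u * X * (u⁻¹ : (SMat ι)ˣ)
      invFun := fun X => (u⁻¹ : (SMat ι)ˣ) * X * u
      left_inv := fun X => by simp [mul_assoc]
      right_inv := fun X => by simp [mul_assoc] }
  map_one' := by ext X : 1; simp
  map_mul' u w := by ext X : 1; simp [mul_assoc]

theorem conj_apply (u : (SMat ι)ˣ) (X : SMat ι) : conj u X = u * X * (u⁻¹ : (SMat ι)ˣ) := rfl

theorem ad_coe (u : (SMat ι)ˣ) (X : SMat ι) : ad u X = conj u X := by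
  rw [ad, conj_apply, Ring.inverse_unit]

theorem conj_eq {u : (SMat ι)ˣ} {X Y : SMat ι} (h : (u : SMat ι) * X = Y * u) : conj u X = Y := by
  rw [conj_apply, h, Units.mul_inv_cancel_right]

theorem Dgen_mul (a c a' c' : Pos ι) :
    Dgen (a : Grassmann ι) c * Dgen (a' : Grassmann ι) c' =
      Dgen ((a * a' : Pos ι) : Grassmann ι) ((c * c' : Pos ι) : Grassmann ι) := by
  have h1 : (a' : Grassmann ι) * a = (a * a' : Pos ι) := congrArg Subtype.val (mul_comm a' a)
  have h2 : (c' : Grassmann ι) * c = (c * c' : Pos ι) := congrArg Subtype.val (mul_comm c' c)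
  have h3 : (a' : Grassmann ι) * c' * (a * c) = (a * a' : Pos ι) * (c * c' : Pos ι) :=
    congrArg Subtype.val (show a' * c' * (a * c) = a * a' * (c * c') by
      rw [mul_mul_mul_comm, mul_comm a', mul_comm c'])
  simp only [Dgen, smat_mul, mul_zero, zero_mul, add_zero, zero_add, h1, h2, h3]

theorem Dgen_one : Dgen (1 : Grassmann ι) 1 = 1 := by
  rw [smat_one, Dgen, one_mul]

/-- The diagonal supermatrices `diag (a, a c, c)`, as a homomorphism to the group of units. -/
def dgenU : Pos ι × Pos ι →* (SMat ι)ˣ :=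
  MonoidHom.toHomUnits
    { toFun := fun x => Dgen x.1 x.2
      map_one' := Dgen_one
      map_mul' := fun x y => (Dgen_mul x.1 x.2 y.1 y.2).symm }

/-- `Z_a` as a unit. -/
def zU : Pos ι →* (SMat ι)ˣ := dgenU.comp ((MonoidHom.id _).prod (MonoidHom.id _))

/-- `D_a` as a unit. -/
def dU : Pos ι →* (SMat ι)ˣ := dgenU.comp ((MonoidHom.id _).prod (invMonoidHom))

theorem dU_coe (a : Pos ι) : (dU a : SMat ι) = Dmat (a : Grassmann ι) := rfl

theorem zU_smat (a : Pos ι) : (zU a : SMat ι) =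
    smat (a : Grassmann ι) 0 0 0 ((a : Grassmann ι) * a) 0 0 0 a := rfl

theorem dU_smat (a : Pos ι) : (dU a : SMat ι) =
    smat (a : Grassmann ι) 0 0 0 1 0 0 0 (a⁻¹ : Pos ι) := by
  rw [dU_coe, Dmat, Dgen, ← Pos.coe_inv, Pos.mul_inv_coe]

theorem Zmat_neg_one : Zmat (-1 : Grassmann ι) = smat (-1) 0 0 0 1 0 0 0 (-1) := by
  simp [Zmat, Dgen]

/-- `Z_{-1}` as a unit. -/
def nU : (SMat ι)ˣ where
  val := Zmat (-1)
  inv := Zmat (-1)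
  val_inv := by rw [Zmat_neg_one, smat_mul, smat_one]; simp
  inv_val := by rw [Zmat_neg_one, smat_mul, smat_one]; simp

theorem nU_coe : ((nU : (SMat ι)ˣ) : SMat ι) = smat (-1) 0 0 0 1 0 0 0 (-1) := Zmat_neg_one

/-- `J` as a unit. -/
def jU : (SMat ι)ˣ where
  val := Jmat
  inv := smat 0 0 (-1) 0 1 0 1 0 0
  val_inv := by rw [Jmat, smat_mul, smat_one]; simp
  inv_val := by rw [Jmat, smat_mul, smat_one]; simp

theorem jU_coe : ((jU : (SMat ι)ˣ) : SMat ι) = smat 0 0 1 0 1 0 (-1) 0 0 := rfl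

/-- The normalised prime transformation `Q_θ = Z_{c_θ} P'`, which rotates a triangle in standard
position. -/
def Qmat (θ : OddPair ι) : SMat ι :=
  smat ((1 / 3 : ℝ) • (θ.fst * θ.snd) - 1) θ.fst θ.cPos (-θ.snd)
    (1 + (1 / 3 : ℝ) • (θ.fst * θ.snd)) 0 (-θ.cPos) 0 0

theorem Zmat_mul_Pprime (θ : OddPair ι) :
    Zmat (cc θ.fst θ.snd) * Pprime θ.fst θ.snd = Qmat θ := by
  simp only [Zmat, Dgen, Pprime, smat_mul, Qmat, OddPair.cPos_coe, cc]
  congr 1 <;> simp only [mul_add, add_mul, sub_mul, mul_one, one_mul, mul_zero, zero_mul,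
    add_zero, zero_add, smul_mul_assoc, mul_smul_comm, θ.prod_mul_prod, θ.fst_mul_prod,
    θ.snd_mul_prod, smul_zero, neg_mul] <;> module

theorem Qmat_sq (θ : OddPair ι) : Qmat θ * Qmat θ =
    smat 0 0 ((1 / 6 : ℝ) • (θ.fst * θ.snd) - 1) 0 (1 - (1 / 3 : ℝ) • (θ.fst * θ.snd)) (-θ.snd)
      (1 - (1 / 6 : ℝ) • (θ.fst * θ.snd)) (-θ.fst) (-(1 + (1 / 3 : ℝ) • (θ.fst * θ.snd))) := by
  simp only [smat_mul, Qmat, OddPair.cPos_coe]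
  congr 1 <;> simp only [mul_add, add_mul, sub_mul, mul_sub, mul_one, one_mul, mul_zero, zero_mul,
    add_zero, smul_mul_assoc, mul_smul_comm, θ.prod_mul_prod, θ.fst_mul_prod,
    θ.prod_mul_fst, θ.prod_mul_snd, θ.snd_mul_fst,
    θ.snd_mul_prod, smul_zero, neg_mul, mul_neg, neg_neg] <;> module

theorem Qmat_cube (θ : OddPair ι) : Qmat θ * (Qmat θ * Qmat θ) = 1 := by
  rw [Qmat_sq, smat_one]
  simp only [smat_mul, Qmat, OddPair.cPos_coe]
  congr 1 <;> simp only [mul_add, add_mul, sub_mul, mul_sub, mul_one, one_mul, mul_zero, zero_mul,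
    add_zero, smul_mul_assoc, mul_smul_comm, θ.prod_mul_prod, θ.fst_mul_prod,
    θ.prod_mul_fst, θ.prod_mul_snd, θ.snd_mul_fst,
    θ.snd_mul_prod, smul_zero, neg_mul, mul_neg, neg_neg] <;> module

/-- `Q_θ` as a unit. -/
def qU (θ : OddPair ι) : (SMat ι)ˣ where
  val := Qmat θ
  inv := Qmat θ * Qmat θ
  val_inv := Qmat_cube θ
  inv_val := by rw [mul_assoc, Qmat_cube]

theorem qU_coe (θ : OddPair ι) : (qU θ : SMat ι) = Qmat θ := rfl

theorem qU_cube (θ : OddPair ι) : qU θ * (qU θ * qU θ) = 1 := Units.ext (Qmat_cube θ)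

end

section

variable {R : Type*} [CommRing R] {κ q qi D Di u v β γ m n : R}

/-! ### Identities among even elements -/

/-- The relations among the even elements `u = θ₁ θ₂`, `v = σ₁ σ₂`, `β = σ₁ θ₂`, `γ = σ₂ θ₁`,
`m = μ₁ μ₂` and `n = ν₁ ν₂` attached to a flip, where `κ = 1 / 6`, `q = √χ`, `D = 𝒟`, and `qi`,
`Di` are inverse to `q`, `D`. They are stated in an arbitrary commutative ring; thus
`c_θ = 1 + κ * u`, and similarly for `σ`, `μ`, `ν`. -/
structure FlipRel (κ q qi D Di u v β γ m n : R) : Prop where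
  h6 : 6 * κ = 1
  hq : q * qi = 1
  hD : D * Di = 1
  hDD : D * D = 1 + q ^ 2 + 3 * κ * q * (β + γ)
  huu : u * u = 0
  hvv : v * v = 0
  huβ : u * β = 0
  huγ : u * γ = 0
  hvβ : v * β = 0
  hvγ : v * γ = 0
  hββ : β * β = 0
  hγγ : γ * γ = 0
  hβγ : β * γ = u * v
  hm : m = (u + q * (β - γ) + q ^ 2 * v) * (Di * Di)
  hn : n = (v - q * (β - γ) + q ^ 2 * u) * (Di * Di)

namespace FlipRel
variable (H : FlipRel κ q qi D Di u v β γ m n)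
include H

theorem m_mul_sq : m * (D * D) = u + q * (β - γ) + q ^ 2 * v := by
  rw [H.hm]; linear_combination (u + q * (β - γ) + q ^ 2 * v) * (1 + D * Di) * H.hD

theorem n_mul_sq : n * (D * D) = v - q * (β - γ) + q ^ 2 * u := by
  rw [H.hn]; linear_combination (v - q * (β - γ) + q ^ 2 * u) * (1 + D * Di) * H.hD

theorem sq_mul_inv_sq : (1 + q ^ 2 + 3 * κ * q * (β + γ)) * (Di * Di) = 1 := by
  rw [← H.hDD]; linear_combination (1 + D * Di) * H.hD

theorem mm : m * m = 0 := by
  obtain ⟨h6, hq, hD, hDD, huu, hvv, huβ, huγ, hvβ, hvγ, hββ, hγγ, hβγ, hm, hn⟩ := H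
  have : (u + q * (β - γ) + q ^ 2 * v) * (u + q * (β - γ) + q ^ 2 * v) = 0 := by
    clear hm hn hDD hD
    grind
  rw [hm]; linear_combination (Di * Di) ^ 2 * this

theorem nn : n * n = 0 := by
  obtain ⟨h6, hq, hD, hDD, huu, hvv, huβ, huγ, hvβ, hvγ, hββ, hγγ, hβγ, hm, hn⟩ := H
  have : (v - q * (β - γ) + q ^ 2 * u) * (v - q * (β - γ) + q ^ 2 * u) = 0 := by
    clear hm hn hDD hD
    grind
  rw [hn]; linear_combination (Di * Di) ^ 2 * this

theorem uv_mul_inv_sq : u * v * (1 + q ^ 2) * (Di * Di) = u * v := by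
  linear_combination u * v * H.sq_mul_inv_sq - 3 * κ * q * (Di * Di) * u * (H.hvβ + H.hvγ)

theorem mn : m * n = u * v := by
  have hYi := H.sq_mul_inv_sq
  have h := H.uv_mul_inv_sq
  obtain ⟨h6, hq, hD, hDD, huu, hvv, huβ, huγ, hvβ, hvγ, hββ, hγγ, hβγ, hm, hn⟩ := H
  have : (u + q * (β - γ) + q ^ 2 * v) * (v - q * (β - γ) + q ^ 2 * u) =
      u * v * (1 + q ^ 2) ^ 2 := by
    clear hm hn hDD hD hYi h
    grind
  rw [hm, hn]; linear_combination (Di * Di) ^ 2 * this + ((1 + q ^ 2) * (Di * Di) + 1) * h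

theorem add_eq : m + n = u + v := by
  have hYi := H.sq_mul_inv_sq
  obtain ⟨h6, hq, hD, hDD, huu, hvv, huβ, huγ, hvβ, hvγ, hββ, hγγ, hβγ, hm, hn⟩ := H
  rw [hm, hn]
  linear_combination (u + v) * hYi - 3 * κ * q * (Di * Di) * (huβ + huγ + hvβ + hvγ)

/-- `c_μ c_ν = c_θ c_σ`. -/
theorem c_mul : (1 + κ * m) * (1 + κ * n) = (1 + κ * u) * (1 + κ * v) := by
  linear_combination κ * H.add_eq + κ ^ 2 * H.mn

/-- The `(0, 0)` entry of `flipMatrix_sideC`, with the denominators cleared. -/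
theorem sideC_00_aux : (1 + κ * u) *
    (-q * (1 + κ * v) * (2 * κ * u - 1) + β - (2 * κ * v - 1) * (1 + κ * u) * qi) =
    (1 + κ * m) * (1 - 2 * κ * n) * ((D * D) * qi) * (1 + κ * u) := by
  have : (1 + κ * m) * (1 - 2 * κ * n) * (D * D) = 1 + q ^ 2 + 3 * κ * q * (β + γ) +
      κ * (u + q * (β - γ) + q ^ 2 * v) - 2 * κ * (v - q * (β - γ) + q ^ 2 * u) -
      2 * κ ^ 2 * (u * v * (D * D)) := by
    rw [← H.hDD, ← H.m_mul_sq, ← H.n_mul_sq, ← H.mn]; ring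
  rw [← mul_assoc _ (D * D), this, H.hDD]
  clear this
  obtain ⟨h6, hq, hD, hDD, huu, hvv, huβ, huγ, hvβ, hvγ, hββ, hγγ, hβγ, hm, hn⟩ := H
  clear hDD hm hn hD
  grind

/-- The `(0, 0)` entry of `flipMatrix_sideC`. -/
theorem sideC_00 : Di * ((1 + κ * u) * (1 - κ * m)) * (-(Di * q * (1 - κ * u))) *
    (-q * (1 + κ * v) * (2 * κ * u - 1) + β - (2 * κ * v - 1) * (1 + κ * u) * qi) =
    2 * κ * n - 1 := by
  linear_combination (-(Di * q * (1 - κ * u))) * Di * (1 - κ * m) * H.sideC_00_aux -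
    (1 - 2 * κ * n) * (1 - κ ^ 2 * u ^ 2) * (D * D * Di * Di * q * qi) * κ ^ 2 * (-H.mm) +
    (-(1 - 2 * κ * n)) * (D * D * Di * Di * q * qi) * κ ^ 2 * (-H.huu) -
    (1 - 2 * κ * n) * (q * qi * (1 + D * Di) * H.hD + H.hq)

/-- The `(0, 2)` entry of `flipMatrix_sideC`. -/
theorem sideC_02 : Di * ((1 + κ * u) * (1 - κ * m)) * (-(D * qi * (1 - κ * u))) *
    (-q * (1 + κ * v) * (1 + κ * u)) = 1 + κ * n := by
  have h1 := H.c_mul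
  have h2 := H.mm
  have h3 := H.huu
  have h4 := H.hq
  have h5 := H.hD
  have h6 : (1 - κ * m) * (1 + κ * m) = 1 := by linear_combination (-κ ^ 2) * h2
  have h7 : (1 - κ * u) * (1 + κ * u) = 1 := by linear_combination (-κ ^ 2) * h3
  grind

/-- The `(2, 0)` entry of `flipMatrix_sideC`. -/
theorem sideC_20 : D * ((1 + κ * u) * (1 - κ * m)) * (-(Di * q * (1 - κ * u))) *
    (qi * (1 + κ * v) * (1 + κ * u)) = -(1 + κ * n) := by
  have h1 := H.c_mul
  have h2 := H.mm
  have h3 := H.huu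
  have h4 := H.hq
  have h5 := H.hD
  have h6 : (1 - κ * m) * (1 + κ * m) = 1 := by linear_combination (-κ ^ 2) * h2
  have h7 : (1 - κ * u) * (1 + κ * u) = 1 := by linear_combination (-κ ^ 2) * h3
  grind

/-- The `(1, 1)` entry of `flipMatrix_sideC`. -/
theorem sideC_11 : ((1 + κ * u) * (1 - κ * m)) * ((1 + κ * u) * (1 - κ * m)) * (1 - 2 * κ * u) *
    ((1 + 2 * κ * v) * (1 + 2 * κ * u)) = (1 + 2 * κ * n) := by
  have h1 := H.c_mul
  have h2 := H.mm
  have h3 := H.huu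
  have h8 := H.hvv
  have h9 := H.nn
  have h6 : (1 - κ * m) * (1 + κ * m) = 1 := by linear_combination (-κ ^ 2) * h2
  have h7 : (1 - κ * u) * (1 + κ * u) = 1 := by linear_combination (-κ ^ 2) * h3
  have : ((1 + κ * u) * (1 - κ * m)) * (1 - κ * u) * ((1 + κ * v) * (1 + κ * u)) =
      1 + κ * n := by grind
  have := congrArg (fun x => x * x) this
  clear h6 h7
  grind

/-- The `(0, 2)` entry of `flipMatrix_sideD`. -/
theorem sideD_02 : D * qi * ((1 + κ * n) * (1 - κ * u)) * (Di * (1 + κ * u)) *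
    (-q * (κ * v - 1) * (κ * u - 1)) = κ * m - 1 := by
  have h1 := H.c_mul
  have h2 := H.mm
  have h3 := H.huu
  have h4 := H.hq
  have h5 := H.hD
  have h8 := H.hvv
  have h6 : (1 - κ * m) * (1 + κ * m) = 1 := by linear_combination (-κ ^ 2) * h2
  have h7 : (1 - κ * u) * (1 + κ * u) = 1 := by linear_combination (-κ ^ 2) * h3
  have h9 : (1 - κ * v) * (1 + κ * v) = 1 := by linear_combination (-κ ^ 2) * h8
  grind

/-- The `(2, 0)` entry of `flipMatrix_sideD`. -/
theorem sideD_20 : q * Di * ((1 + κ * n) * (1 - κ * u)) * (D * (1 + κ * u)) *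
    (qi * (1 - κ * v) * (1 - κ * u)) = 1 - κ * m := by
  have h1 := H.c_mul
  have h2 := H.mm
  have h3 := H.huu
  have h4 := H.hq
  have h5 := H.hD
  have h8 := H.hvv
  have h6 : (1 - κ * m) * (1 + κ * m) = 1 := by linear_combination (-κ ^ 2) * h2
  have h7 : (1 - κ * u) * (1 + κ * u) = 1 := by linear_combination (-κ ^ 2) * h3
  have h9 : (1 - κ * v) * (1 + κ * v) = 1 := by linear_combination (-κ ^ 2) * h8
  grind

/-- The `(1, 1)` entry of `flipMatrix_sideD`. -/
theorem sideD_11 : ((1 + κ * n) * (1 - κ * u)) * ((1 + κ * n) * (1 - κ * u)) * (1 + 2 * κ * u) *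
    ((1 - 2 * κ * v) * (1 - 2 * κ * u)) = (1 - 2 * κ * m) := by
  have h1 := H.c_mul
  have h2 := H.mm
  have h3 := H.huu
  have h8 := H.hvv
  have h9 := H.nn
  have h6 : (1 - κ * m) * (1 + κ * m) = 1 := by linear_combination (-κ ^ 2) * h2
  have h7 : (1 - κ * u) * (1 + κ * u) = 1 := by linear_combination (-κ ^ 2) * h3
  have h9 : (1 - κ * v) * (1 + κ * v) = 1 := by linear_combination (-κ ^ 2) * h8
  have : ((1 + κ * n) * (1 - κ * u)) * (1 + κ * u) * ((1 - κ * v) * (1 - κ * u)) =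
      1 - κ * m := by grind
  have := congrArg (fun x => x * x) this
  clear h6 h7 h9
  grind

/-- The `(2, 2)` entry of `flipMatrix_sideD`. -/
theorem sideD_22 : q * Di * ((1 + κ * n) * (1 - κ * u)) * (Di * (1 + κ * u)) *
    (-q * (1 + 2 * κ * v) * (1 - κ * u) - β - qi * (1 - κ * v) * (1 + 2 * κ * u)) =
    -(1 + 2 * κ * m) := by
  have e1 : (1 + κ * n) * (1 - κ * u) * (1 + κ * u) *
      (q * (-q * (1 + 2 * κ * v) * (1 - κ * u) - β - qi * (1 - κ * v) * (1 + 2 * κ * u))) =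
      -(1 + 2 * κ * m) * (D * D) := by
    have e2 : (1 + κ * m) * (1 - κ * m) = 1 := by linear_combination (-κ ^ 2) * H.mm
    have e3 : (1 + κ * n) * (1 - κ * n) = 1 := by linear_combination (-κ ^ 2) * H.nn
    have e4 : (1 + κ * u) * (1 - κ * u) = 1 := by linear_combination (-κ ^ 2) * H.huu
    have e5 : (1 + 2 * κ * m) * (1 - κ * n) * (D * D) =
        1 + q ^ 2 + 3 * κ * q * (β + γ) + 2 * κ * (u + q * (β - γ) + q ^ 2 * v) -
        κ * (v - q * (β - γ) + q ^ 2 * u) -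
        2 * κ ^ 2 * (u * v * (1 + q ^ 2 + 3 * κ * q * (β + γ))) := by
      rw [← H.hDD, ← H.m_mul_sq, ← H.n_mul_sq, ← H.mn]; ring
    have e6 : q * (-q * (1 + 2 * κ * v) * (1 - κ * u) - β - qi * (1 - κ * v) * (1 + 2 * κ * u)) =
        -((1 + 2 * κ * m) * (1 - κ * n) * (D * D)) := by
      rw [e5]
      obtain ⟨h6, hq, hD, hDD, huu, hvv, huβ, huγ, hvβ, hvγ, hββ, hγγ, hβγ, hm, hn⟩ := H
      clear hDD hm hn hD e2 e3 e4 e5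
      grind
    rw [e6]
    linear_combination (-(1 + κ * n) * ((1 + 2 * κ * m) * (1 - κ * n) * (D * D))) * e4 -
      (1 + 2 * κ * m) * (D * D) * e3
  linear_combination Di * Di * e1 - (1 + 2 * κ * m) * (1 + D * Di) * H.hD

/-- `c_θ² c_σ⁻¹ c_μ c_ν = c_θ³`. -/
theorem p_mul_one_add (p : R) (hp : p = (1 + 2 * κ * u) * (1 - κ * v)) :
    p * ((1 + κ * n) * (1 + κ * m)) = (1 + 3 * κ * u) := by
  rw [mul_comm (1 + κ * n), H.c_mul, hp]
  obtain ⟨h6, hq, hD, hDD, huu, hvv, huβ, huγ, hvβ, hvγ, hββ, hγγ, hβγ, hm, hn⟩ := H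
  clear hDD hm hn hD
  grind

/-- The `(0, 0)` entry of `flipMatrix_sideB`. -/
theorem sideB_00 (β' : R) (hβ' : β' * (D * D) = (β + q * (v - u) + q ^ 2 * γ)) (p : R)
    (hp : p = (1 + 2 * κ * u) * (1 - κ * v)) :
    -(Di * q * (1 - κ * u)) * (Di * (1 - κ * u)) *
      (-(p * qi) * (1 + κ * n) * (2 * κ * m - 1) + p * p * β' -
        (q * p) * (2 * κ * n - 1) * (1 + κ * m)) = 2 * κ * u - 1 := by
  have e1 : (-p * (1 + κ * n) * (2 * κ * m - 1) + q * (p * p) * β' -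
      (q ^ 2 * p) * (2 * κ * n - 1) * (1 + κ * m)) * (D * D) =
        (1 - 2 * κ * u) * (1 + 2 * κ * u) * (D * D) * (D * D) := by
    have : (-p * (1 + κ * n) * (2 * κ * m - 1) + q * (p * p) * β' -
        (q ^ 2 * p) * (2 * κ * n - 1) * (1 + κ * m)) * (D * D) =
        -p * (2 * κ * (m * (D * D)) - κ * (n * (D * D)) - D * D + 2 * κ ^ 2 * ((m * n) * (D * D))) +
          q * (p * p) * (β' * (D * D)) -
          (q ^ 2 * p) * (2 * κ * (n * (D * D)) - κ * (m * (D * D)) - D * D +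
            2 * κ ^ 2 * ((m * n) * (D * D))) := by
      ring
    rw [this, H.m_mul_sq, H.n_mul_sq, H.mn, hβ', hp, H.hDD]
    obtain ⟨h6, hq, hD, hDD, huu, hvv, huβ, huγ, hvβ, hvγ, hββ, hγγ, hβγ, hm, hn⟩ := H
    clear hDD hm hn hD this hβ' hp
    grind
  set X := -p * (1 + κ * n) * (2 * κ * m - 1) + q * (p * p) * β' -
      (q ^ 2 * p) * (2 * κ * n - 1) * (1 + κ * m) with hX
  have e2 : X * (D * D) = (D * D) * (D * D) := by
    rw [e1]; linear_combination (-4 * κ ^ 2 * (D * D) * (D * D)) * H.huu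
  have e3 : X * (Di * Di) = 1 := by
    linear_combination (Di * Di) * (Di * Di) * e2 +
      ((1 + D * Di) * (D * D * Di * Di + 1 - X * Di * Di)) * H.hD
  rw [hX] at e3
  linear_combination (-(1 - κ * u) ^ 2) * e3 - (κ ^ 2) * H.huu +
    (p * (1 + κ * n) * (2 * κ * m - 1)) * (Di * (1 - κ * u)) * (Di * (1 - κ * u)) * H.hq

/-- The `(0, 2)` entry of `flipMatrix_sideB`. -/
theorem sideB_02 (p : R) (hp : p = (1 + 2 * κ * u) * (1 - κ * v)) :
    -(Di * q * (1 - κ * u)) * (D * (1 - κ * u)) * (-(p * qi) * (1 + κ * n) * (1 + κ * m)) =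
      1 + κ * u := by
  have h1 := H.p_mul_one_add p hp
  have h2 : (1 - κ * u) ^ 2 * (1 + 3 * κ * u) = 1 + κ * u := by
    linear_combination (-5 * κ ^ 2 + 3 * κ ^ 3 * u) * H.huu
  linear_combination (q * qi * D * Di * (1 - κ * u) ^ 2) * h1 + q * qi * D * Di * h2 +
    (1 + κ * u) * (D * Di * H.hq + H.hD)

/-- The `(2, 0)` entry of `flipMatrix_sideB`. -/
theorem sideB_20 (p : R) (hp : p = (1 + 2 * κ * u) * (1 - κ * v)) :
    -(qi * D * (1 - κ * u)) * (Di * (1 - κ * u)) * ((q * p) * (1 + κ * n) * (1 + κ * m)) =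
      -(1 + κ * u) := by
  linear_combination (-1) * H.sideB_02 p hp

/-- The `(1, 1)` entry of `flipMatrix_sideB`. -/
theorem sideB_11 (p : R) (hp : p = (1 + 2 * κ * u) * (1 - κ * v)) :
    (1 - 2 * κ * u) * (1 - 2 * κ * u) * (p * p * (1 + 2 * κ * n) * (1 + 2 * κ * m)) =
      1 + 2 * κ * u := by
  have h1 := congrArg (fun x => x * x) (H.p_mul_one_add p hp)
  have h2 : (1 - 2 * κ * u) ^ 2 * (1 + 6 * κ * u) = 1 + 2 * κ * u := by
    linear_combination (-20 * κ ^ 2 + 24 * κ ^ 3 * u) * H.huu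
  have h3 : (1 + κ * n) * (1 + κ * n) = 1 + 2 * κ * n := by linear_combination κ ^ 2 * H.nn
  have h4 : (1 + κ * m) * (1 + κ * m) = 1 + 2 * κ * m := by linear_combination κ ^ 2 * H.mm
  rw [← h3, ← h4]
  have h5 : (1 + 3 * κ * u) * (1 + 3 * κ * u) = 1 + 6 * κ * u := by
    linear_combination 9 * κ ^ 2 * H.huu
  linear_combination (1 - 2 * κ * u) ^ 2 * h1 + (1 - 2 * κ * u) ^ 2 * h5 + h2

end FlipRel

/-! ### Identities among odd elements -/

/-- The relations which hold between the elements of `FlipRel` and a pair of odd elements `t`, `s`,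
namely `θ₁`, `σ₁` with `ε = -1` or `θ₂`, `σ₂` with `ε = 1`. As only expressions linear in `t` and
`s` occur, `t` and `s` may be treated as elements of a commutative ring. -/
structure OddFlipRel {A : Type*} [CommRing A] (κ q qi D Di u v ε m n t s : A) : Prop where
  h6 : 6 * κ = 1
  hq : q * qi = 1
  hut : u * t = 0
  hvs : v * s = 0
  hmt : m * t = - (q * m * s)
  hns : n * s = q * n * t
  hms : (1 + q ^ 2) * m * s = u * s - q * v * t
  hnt : (1 + q ^ 2) * n * t = v * t + q * u * s
  huu : u * u * s = 0
  hvv : v * v * t = 0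
  hum : u * m * s = 0
  hvn : v * n * t = 0
  hmm : m * m * s = 0
  hnn : n * n * t = 0
  hmns : m * n * s = 0
  hmnt : m * n * t = 0
  hDD : D * D * t = (1 + q ^ 2) * t + 3 * ε * κ * q * u * s
  hD : D * Di = 1

variable {A : Type*} [CommRing A] {κ q qi D Di u v ε m n t s : A}
namespace OddFlipRel
variable (H : OddFlipRel κ q qi D Di u v ε m n t s)
include H

/-- The `(0, 1)` entry of `flipMatrix_sideC`. -/
theorem sideC_01 : Di * ((1 + κ * u) * (1 - κ * m)) * (1 - 2 * κ * u) *
    ((-q) * (1 + κ * v) * t + (1 + 2 * κ * u) * s) = Di * (s - q * t) := by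
  obtain ⟨h6, hq, hut, hvs, hmt, hns, hms, hnt, huu, hvv, hum, hvn, hmm, hnn, hmns, hmnt, hDD,
    hD⟩ := H
  clear hDD hD
  have : ((1 + κ * u) * (1 - κ * m)) * (1 - 2 * κ * u) *
      (-q * (1 + κ * v) * t + (1 + 2 * κ * u) * s) = (s - q * t) := by
    grind
  linear_combination Di * this

/-- The `(1, 0)` entry of `flipMatrix_sideC`. -/
theorem sideC_10 : ((1 + κ * u) * (1 - κ * m)) * ((1 + κ * u) * (1 - κ * m)) *
    (Di * q * (1 - κ * u)) * (-(1 + 2 * κ * v) * t + qi * (1 + κ * u) * s) = Di * (s - q * t) := by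
  obtain ⟨h6, hq, hut, hvs, hmt, hns, hms, hnt, huu, hvv, hum, hvn, hmm, hnn, hmns, hmnt, hDD,
    hD⟩ := H
  clear hDD hD
  have : ((1 + κ * u) * (1 - κ * m)) * ((1 + κ * u) * (1 - κ * m)) * (q * (1 - κ * u)) *
      (-(1 + 2 * κ * v) * t + qi * (1 + κ * u) * s) = (s - q * t) := by
    grind
  linear_combination Di * this

/-- The `(1, 2)` entry of `flipMatrix_sideD`. -/
theorem sideD_12 : ((1 + κ * n) * (1 - κ * u)) * ((1 + κ * n) * (1 - κ * u)) * (Di * (1 + κ * u)) *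
    (-q * (1 - κ * u) * s - (1 - 2 * κ * v) * t) = -(Di * (t + q * s)) := by
  obtain ⟨h6, hq, hut, hvs, hmt, hns, hms, hnt, huu, hvv, hum, hvn, hmm, hnn, hmns, hmnt, hDD,
    hD⟩ := H
  clear hDD hD
  have : ((1 + κ * n) * (1 - κ * u)) * ((1 + κ * n) * (1 - κ * u)) * ((1 + κ * u)) *
      (-q * (1 - κ * u) * s - (1 - 2 * κ * v) * t) = -((t + q * s)) := by
    grind
  linear_combination Di * this

/-- The `(2, 1)` entry of `flipMatrix_sideD`. -/
theorem sideD_21 : q * Di * ((1 + κ * n) * (1 - κ * u)) * (1 + 2 * κ * u) *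
    (-(1 - 2 * κ * u) * s - qi * (1 - κ * v) * t) = -(Di * (t + q * s)) := by
  obtain ⟨h6, hq, hut, hvs, hmt, hns, hms, hnt, huu, hvv, hum, hvn, hmm, hnn, hmns, hmnt, hDD,
    hD⟩ := H
  clear hDD hD
  have : q * ((1 + κ * n) * (1 - κ * u)) * (1 + 2 * κ * u) *
      (-(1 - 2 * κ * u) * s - qi * (1 - κ * v) * t) = -((t + q * s)) := by
    grind
  linear_combination Di * this

/-- The `(0, 1)` entry of `flipMatrix_sideB`. -/
theorem sideB_01 (hε : ε = -1) (p : A) (hp : p = (1 + 2 * κ * u) * (1 - κ * v)) :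
    -(Di * q * (1 - κ * u)) * (1 - 2 * κ * u) *
      (-(p * qi) * (1 + κ * n) * (Di * (t + q * s)) +
      p * p * (1 + 2 * κ * m) * (Di * (s - q * t))) = t := by
  obtain ⟨h6, hq, hut, hvs, hmt, hns, hms, hnt, huu, hvv, hum, hvn, hmm, hnn, hmns, hmnt, hDD,
    hD⟩ := H
  have : -(q * (1 - κ * u)) * (1 - 2 * κ * u) *
      (-(p * qi) * (1 + κ * n) * ((t + q * s)) + p * p * (1 + 2 * κ * m) * ((s - q * t))) =
      D * D * t := by
    rw [hDD, hp, hε]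
    clear hDD hD hp hε
    grind
  linear_combination Di * Di * this + t * (1 + D * Di) * hD

/-- The `(1, 0)` entry of `flipMatrix_sideB`. -/
theorem sideB_10 (hε : ε = 1) (p : A) (hp : p = (1 + 2 * κ * u) * (1 - κ * v)) :
    (1 - 2 * κ * u) * (Di * (1 - κ * u)) *
      (- (p * p) * (1 + 2 * κ * n) * (Di * (t + q * s)) +
      (q * p) * (1 + κ * m) * (Di * (s - q * t))) = -t := by
  obtain ⟨h6, hq, hut, hvs, hmt, hns, hms, hnt, huu, hvv, hum, hvn, hmm, hnn, hmns, hmnt, hDD,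
    hD⟩ := H
  have : (1 - 2 * κ * u) * ((1 - κ * u)) *
      (- (p * p) * (1 + 2 * κ * n) * ((t + q * s)) + (q * p) * (1 + κ * m) * ((s - q * t))) =
      -(D * D * t) := by
    rw [hDD, hp, hε]
    clear hDD hD hp hε
    grind
  linear_combination Di * Di * this - t * (1 + D * Di) * hD
end OddFlipRel

end

section

/-! ### Odd elements as a module over the even part -/

/-- The hypotheses of `OddFlipRel` for elements `t`, `s` of a module. -/
structure OddModRel {R V : Type*} [CommRing R] [AddCommGroup V] [Module R V]
    (κ q qi D Di u v ε m n : R) (t s : V) : Prop where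
  h6 : 6 * κ = 1
  hq : q * qi = 1
  hut : u • t = 0
  hvs : v • s = 0
  hmt : m • t = - ((q * m) • s)
  hns : n • s = (q * n) • t
  hms : ((1 + q ^ 2) * m) • s = u • s - (q * v) • t
  hnt : ((1 + q ^ 2) * n) • t = v • t + (q * u) • s
  huu : (u * u) • s = 0
  hvv : (v * v) • t = 0
  hum : (u * m) • s = 0
  hvn : (v * n) • t = 0
  hmm : (m * m) • s = 0
  hnn : (n * n) • t = 0
  hmns : (m * n) • s = 0
  hmnt : (m * n) • t = 0
  hDD : (D * D) • t = (1 + q ^ 2) • t + (3 * ε * κ * q * u) • s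
  hD : D * Di = 1

open TrivSqZeroExt

theorem fst_ofNat_literal {R V : Type*} [CommRing R] [AddCommGroup V] (n : ℕ) [n.AtLeastTwo] :
    fst (ofNat(n) : TrivSqZeroExt R V) = ofNat(n) := fst_natCast n

theorem snd_ofNat_literal {R V : Type*} [CommRing R] [AddCommGroup V] (n : ℕ) [n.AtLeastTwo] :
    snd (ofNat(n) : TrivSqZeroExt R V) = 0 := snd_natCast n

section
variable {R V : Type*} [CommRing R] [AddCommGroup V] [Module R V]
  {κ q qi D Di u v ε m n : R} {t s : V}

/-- The odd elements are a module over the even ones, not elements of a commutative ring; inside the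
trivial square-zero extension of the ring by the module they become so. -/
theorem OddModRel.toTrivSqZeroExt [Module Rᵐᵒᵖ V] [IsCentralScalar R V]
    (H : OddModRel κ q qi D Di u v ε m n t s) :
    OddFlipRel (A := TrivSqZeroExt R V) (inl κ) (inl q) (inl qi) (inl D) (inl Di) (inl u) (inl v)
      (inl ε) (inl m) (inl n) (inr t) (inr s) := by
  obtain ⟨h6, hq, hut, hvs, hmt, hns, hms, hnt, huu, hvv, hum, hvn, hmm, hnn, hmns, hmnt,
    hDD, hD⟩ := H
  constructor <;> ext <;> simp [*, fst_ofNat_literal, snd_ofNat_literal]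

/-- The right action of a commutative ring on a module, equal to the left action. -/
abbrev rightModule (R V : Type*) [CommRing R] [AddCommGroup V] [Module R V] : Module Rᵐᵒᵖ V :=
  Module.compHom V ((RingHom.id R).fromOpposite mul_comm)

theorem OddModRel.sideC_01 (H : OddModRel κ q qi D Di u v ε m n t s) :
    (Di * ((1 + κ * u) * (1 - κ * m)) * (1 - 2 * κ * u)) •
      ((-q * (1 + κ * v)) • t + (1 + 2 * κ * u) • s) = Di • (s - q • t) := by
  let _ := rightModule R V
  have : IsCentralScalar R V := ⟨fun _ _ => rfl⟩
  simpa [fst_ofNat_literal, snd_ofNat_literal] using congrArg snd H.toTrivSqZeroExt.sideC_01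

theorem OddModRel.sideC_10 (H : OddModRel κ q qi D Di u v ε m n t s) :
    (((1 + κ * u) * (1 - κ * m)) * ((1 + κ * u) * (1 - κ * m)) * (Di * q * (1 - κ * u))) •
      ((-(1 + 2 * κ * v)) • t + (qi * (1 + κ * u)) • s) = Di • (s - q • t) := by
  let _ := rightModule R V
  have : IsCentralScalar R V := ⟨fun _ _ => rfl⟩
  simpa [fst_ofNat_literal, snd_ofNat_literal] using congrArg snd H.toTrivSqZeroExt.sideC_10

theorem OddModRel.sideD_12 (H : OddModRel κ q qi D Di u v ε m n t s) :
    (((1 + κ * n) * (1 - κ * u)) * ((1 + κ * n) * (1 - κ * u)) * (Di * (1 + κ * u))) •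
      ((-q * (1 - κ * u)) • s - (1 - 2 * κ * v) • t) = -(Di • (t + q • s)) := by
  let _ := rightModule R V
  have : IsCentralScalar R V := ⟨fun _ _ => rfl⟩
  simpa [fst_ofNat_literal, snd_ofNat_literal] using congrArg snd H.toTrivSqZeroExt.sideD_12

theorem OddModRel.sideD_21 (H : OddModRel κ q qi D Di u v ε m n t s) :
    (q * Di * ((1 + κ * n) * (1 - κ * u)) * (1 + 2 * κ * u)) •
      ((-(1 - 2 * κ * u)) • s - (qi * (1 - κ * v)) • t) = -(Di • (t + q • s)) := by
  let _ := rightModule R V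
  have : IsCentralScalar R V := ⟨fun _ _ => rfl⟩
  simpa [fst_ofNat_literal, snd_ofNat_literal] using congrArg snd H.toTrivSqZeroExt.sideD_21

theorem OddModRel.sideB_01 (H : OddModRel κ q qi D Di u v (-1) m n t s) (p : R)
    (hp : p = (1 + 2 * κ * u) * (1 - κ * v)) :
    (-(Di * q * (1 - κ * u)) * (1 - 2 * κ * u)) •
      ((-(p * qi) * (1 + κ * n)) • (Di • (t + q • s)) +
        (p * p * (1 + 2 * κ * m)) • (Di • (s - q • t))) = t := by
  let _ := rightModule R V
  have : IsCentralScalar R V := ⟨fun _ _ => rfl⟩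
  have h := H.toTrivSqZeroExt.sideB_01 (by ext <;> simp) (inl p)
      (by rw [hp]; ext <;> simp [fst_ofNat_literal, snd_ofNat_literal])
  have h2 := congrArg snd h
  simp [fst_ofNat_literal, snd_ofNat_literal] at h2 ⊢
  exact (add_comm _ _).trans h2

theorem OddModRel.sideB_10 (H : OddModRel κ q qi D Di u v 1 m n t s) (p : R)
    (hp : p = (1 + 2 * κ * u) * (1 - κ * v)) :
    ((1 - 2 * κ * u) * (Di * (1 - κ * u))) •
      ((-(p * p) * (1 + 2 * κ * n)) • (Di • (t + q • s)) +
        (q * p * (1 + κ * m)) • (Di • (s - q • t))) = -t := by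
  let _ := rightModule R V
  have : IsCentralScalar R V := ⟨fun _ _ => rfl⟩
  have h := H.toTrivSqZeroExt.sideB_10 (by ext <;> simp) (inl p)
      (by rw [hp]; ext <;> simp [fst_ofNat_literal, snd_ofNat_literal])
  have h2 := congrArg snd h
  simp [fst_ofNat_literal, snd_ofNat_literal] at h2 ⊢
  rw [← h2]
  abel

theorem FlipRel.toOddModRel {β γ : R} (H : FlipRel κ q qi D Di u v β γ m n)
    (hut : u • t = 0) (hvs : v • s = 0) (hδt : (β - γ) • t = -(u • s))
    (hδs : (β - γ) • s = -(v • t)) (hw : (β + γ) • t = (ε * u) • s) :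
    OddModRel κ q qi D Di u v ε m n t s := by
  have hu : (1 + q ^ 2) * (Di * Di) * u = u := by
    linear_combination u * H.sq_mul_inv_sq - 3 * κ * q * (Di * Di) * (H.huβ + H.huγ)
  have hv : (1 + q ^ 2) * (Di * Di) * v = v := by
    linear_combination v * H.sq_mul_inv_sq - 3 * κ * q * (Di * Di) * (H.hvβ + H.hvγ)
  have hus : ((1 + q ^ 2) * (Di * Di) * u) • s = u • s := by rw [hu]
  have hut' : ((1 + q ^ 2) * (Di * Di) * v) • t = v • t := by rw [hv]
  have hum : u * m = q ^ 2 * (Di * Di) * u * v := by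
    rw [H.hm]
    linear_combination (Di * Di) * (H.huu + q * (H.huβ - H.huγ))
  have hvn : v * n = q ^ 2 * (Di * Di) * v * u := by
    rw [H.hn]
    linear_combination (Di * Di) * (H.hvv - q * (H.hvβ - H.hvγ))
  exact {
    h6 := H.h6
    hq := H.hq
    hut := hut
    hvs := hvs
    hmt := by
      rw [H.hm]
      linear_combination (norm := module) (Di * Di) • hut + (Di * Di * q) • hδt +
        (Di * Di * q ^ 2) • hδs + (Di * Di * q ^ 3) • hvs
    hns := by
      rw [H.hn]
      linear_combination (norm := module) (Di * Di) • hvs - (Di * Di * q) • hδs +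
        (Di * Di * q ^ 2) • hδt - (Di * Di * q ^ 3) • hut
    hms := by
      rw [H.hm]
      linear_combination (norm := module) hus - q • hut' + ((1 + q ^ 2) * (Di * Di) * q) • hδs +
        ((1 + q ^ 2) * (Di * Di) * q ^ 2) • hvs
    hnt := by
      rw [H.hn]
      linear_combination (norm := module) hut' + q • hus - ((1 + q ^ 2) * (Di * Di) * q) • hδt +
        ((1 + q ^ 2) * (Di * Di) * q ^ 2) • hut
    huu := by rw [H.huu, zero_smul]
    hvv := by rw [H.hvv, zero_smul]
    hum := by rw [hum, mul_smul, hvs, smul_zero]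
    hvn := by rw [hvn, mul_smul, hut, smul_zero]
    hmm := by rw [H.mm, zero_smul]
    hnn := by rw [H.nn, zero_smul]
    hmns := by rw [H.mn, mul_smul, hvs, smul_zero]
    hmnt := by rw [H.mn, mul_comm, mul_smul, hut, smul_zero]
    hDD := by
      rw [H.hDD]
      linear_combination (norm := module) (3 * κ * q) • hw
    hD := H.hD }

end

/-! ### The odd coordinates after a flip -/

section
variable {ι : Type u}

theorem IsOdd.mul_mul_mul_right {a b c : Grassmann ι} (hb : IsOdd b) (hc : IsOdd c) :
    a * b * (c * b) = 0 := by
  rw [mul_assoc, ← mul_assoc b, hb.anticomm hc, neg_mul, mul_assoc c, hb.mul_self]; simp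

theorem IsOdd.mul_mul_mul_mid {a b c : Grassmann ι} (hb : IsOdd b) :
    a * b * (b * c) = 0 := by
  rw [mul_assoc, ← mul_assoc b, hb.mul_self]; simp

theorem IsOdd.mul_mul_mul_left {a b c : Grassmann ι} (ha : IsOdd a) (hb : IsOdd b) :
    a * b * (a * c) = 0 := by
  rw [ha.anticomm hb, neg_mul, ha.mul_mul_mul_mid, neg_zero]

theorem IsOdd.mul_mul_mul_outer {a b c : Grassmann ι} (ha : IsOdd a) (hb : IsOdd b) (hc : IsOdd c) :
    a * b * (c * a) = 0 := by
  rw [ha.anticomm hb, neg_mul, ha.mul_mul_mul_right hc, neg_zero]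

/-- The new odd coordinates `μ` of a flip, in terms of `q = √χ` and `𝒟`. -/
def muPair (θ σ : OddPair ι) (q D : Pos ι) : OddPair ι :=
  ⟨(θ.fst + q * σ.fst) * (D⁻¹ : Pos ι), (θ.snd + q * σ.snd) * (D⁻¹ : Pos ι),
    (θ.fst_odd.add (q.isEven.mul_odd σ.fst_odd)).mul_even (D⁻¹).isEven,
    (θ.snd_odd.add (q.isEven.mul_odd σ.snd_odd)).mul_even (D⁻¹).isEven⟩

/-- The new odd coordinates `ν` of a flip, in terms of `q = √χ` and `𝒟`. -/
def nuPair (θ σ : OddPair ι) (q D : Pos ι) : OddPair ι :=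
  ⟨(σ.fst - q * θ.fst) * (D⁻¹ : Pos ι), (σ.snd - q * θ.snd) * (D⁻¹ : Pos ι),
    (σ.fst_odd.sub (q.isEven.mul_odd θ.fst_odd)).mul_even (D⁻¹).isEven,
    (σ.snd_odd.sub (q.isEven.mul_odd θ.snd_odd)).mul_even (D⁻¹).isEven⟩

/-- The relation `𝒟² = 1 + χ + (√χ / 2) (σ₁ θ₂ + σ₂ θ₁)` with `q = √χ`. -/
def FlipEq (θ σ : OddPair ι) (q D : Pos ι) : Prop :=
  (D * D : Grassmann ι) = 1 + q * q + (1 / 2 : ℝ) • (q * (σ.fst * θ.snd + σ.snd * θ.fst))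

/-- `σ₁ θ₂`. -/
def cross₁ (θ σ : OddPair ι) : EvenPart ι :=
  ⟨σ.fst * θ.snd, mem_evenPart.mpr (σ.fst_odd.mul θ.snd_odd)⟩

/-- `σ₂ θ₁`. -/
def cross₂ (θ σ : OddPair ι) : EvenPart ι :=
  ⟨σ.snd * θ.fst, mem_evenPart.mpr (σ.snd_odd.mul θ.fst_odd)⟩

/-- The constant `1 / 6`. -/
def sixth : EvenPart ι := algebraMap ℝ _ (1 / 6)

theorem sixth_spec : (6 : EvenPart ι) * sixth = 1 := by
  have : (6 : EvenPart ι) = algebraMap ℝ _ 6 := (map_ofNat (algebraMap ℝ (EvenPart ι)) 6).symm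
  rw [this, sixth, ← map_mul]; norm_num

theorem mul_sixth (x : EvenPart ι) : sixth * x = (1 / 6 : ℝ) • x := by
  rw [sixth, Algebra.smul_def]

theorem three_sixth (x : EvenPart ι) : 3 * sixth * x = (1 / 2 : ℝ) • x := by
  rw [mul_assoc, mul_sixth]
  have : (3 : EvenPart ι) = algebraMap ℝ _ 3 := (map_ofNat (algebraMap ℝ (EvenPart ι)) 3).symm
  rw [this, ← Algebra.smul_def, smul_smul]; norm_num

theorem two_sixth (x : EvenPart ι) : 2 * sixth * x = (1 / 3 : ℝ) • x := by
  rw [mul_assoc, mul_sixth]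
  have : (2 : EvenPart ι) = algebraMap ℝ _ 2 := (map_ofNat (algebraMap ℝ (EvenPart ι)) 2).symm
  rw [this, ← Algebra.smul_def, smul_smul]; norm_num

theorem mul_pos_mul_mul_pos (D : Pos ι) (x y : Grassmann ι) :
    x * (D : Grassmann ι) * (y * D) = x * y * (D * D) := by
  rw [mul_assoc, ← mul_assoc (D : Grassmann ι), ← D.comm y, mul_assoc y, ← mul_assoc]

theorem flipRel {θ σ : OddPair ι} {q D : Pos ι} (h : FlipEq θ σ q D) :
    FlipRel sixth q.even q⁻¹.even D.even D⁻¹.even θ.prod σ.prod (cross₁ θ σ) (cross₂ θ σ)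
      (muPair θ σ q D).prod (nuPair θ σ q D).prod where
  h6 := sixth_spec
  hq := Subtype.ext q.mul_inv_coe
  hD := Subtype.ext D.mul_inv_coe
  hDD := by
    rw [mul_assoc, three_sixth, pow_two]
    exact Subtype.ext h
  huu := Subtype.ext (θ.prod_mul_prod)
  hvv := Subtype.ext (σ.prod_mul_prod)
  huβ := Subtype.ext (θ.snd_odd.mul_mul_mul_right σ.fst_odd)
  huγ := Subtype.ext (θ.fst_odd.mul_mul_mul_outer θ.snd_odd σ.snd_odd)
  hvβ := Subtype.ext (σ.fst_odd.mul_mul_mul_left σ.snd_odd)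
  hvγ := Subtype.ext (σ.snd_odd.mul_mul_mul_mid)
  hββ := Subtype.ext (σ.fst_odd.mul_mul_mul_left θ.snd_odd)
  hγγ := Subtype.ext (σ.snd_odd.mul_mul_mul_left θ.fst_odd)
  hβγ := Subtype.ext (by
    change σ.fst * θ.snd * (σ.snd * θ.fst) = θ.fst * θ.snd * (σ.fst * σ.snd)
    rw [σ.snd_odd.anticomm θ.fst_odd, mul_neg, mul_assoc, ← mul_assoc θ.snd, θ.snd_mul_fst, neg_mul,
      mul_neg, neg_neg, ← mul_assoc, ← (θ.even_mul.commute σ.fst).eq, mul_assoc])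
  hm := Subtype.ext (by
    change (θ.fst + q * σ.fst) * (D⁻¹ : Pos ι) * ((θ.snd + q * σ.snd) * (D⁻¹ : Pos ι)) =
      (θ.fst * θ.snd + q * (σ.fst * θ.snd - σ.snd * θ.fst) + (q : Grassmann ι) ^ 2 *
        (σ.fst * σ.snd)) * ((D⁻¹ : Pos ι) * (D⁻¹ : Pos ι))
    rw [mul_pos_mul_mul_pos, add_mul, mul_add, mul_add,
      σ.snd_odd.anticomm θ.fst_odd, ← mul_assoc θ.fst,
      q.comm θ.fst, mul_assoc _ σ.fst (_ * _), ← mul_assoc σ.fst _ σ.snd, q.comm]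
    congr 1
    noncomm_ring)
  hn := Subtype.ext (by
    change (σ.fst - q * θ.fst) * (D⁻¹ : Pos ι) * ((σ.snd - q * θ.snd) * (D⁻¹ : Pos ι)) =
      (σ.fst * σ.snd - q * (σ.fst * θ.snd - σ.snd * θ.fst) + (q : Grassmann ι) ^ 2 *
        (θ.fst * θ.snd)) * ((D⁻¹ : Pos ι) * (D⁻¹ : Pos ι))
    rw [mul_pos_mul_mul_pos, sub_mul, mul_sub, mul_sub,
      σ.snd_odd.anticomm θ.fst_odd, ← mul_assoc σ.fst,
      q.comm σ.fst, mul_assoc _ θ.fst (_ * _), ← mul_assoc θ.fst _ θ.snd, q.comm]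
    congr 1
    noncomm_ring)

theorem oddRel_fst {θ σ : OddPair ι} {q D : Pos ι} (h : FlipEq θ σ q D) :
    OddModRel sixth q.even q⁻¹.even D.even D⁻¹.even θ.prod σ.prod (-1)
      (muPair θ σ q D).prod (nuPair θ σ q D).prod θ.fst σ.fst := by
  have h1 : σ.fst * θ.snd * θ.fst = -(θ.fst * θ.snd * σ.fst) := by
    rw [mul_assoc, θ.snd_mul_fst, mul_neg, (θ.even_mul.commute _).eq]
  have h2 : σ.snd * θ.fst * θ.fst = 0 := by rw [mul_assoc, θ.fst_mul_fst, mul_zero]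
  have h3 : σ.fst * θ.snd * σ.fst = 0 := by
    rw [mul_assoc, θ.snd_odd.anticomm σ.fst_odd, mul_neg, ← mul_assoc, σ.fst_mul_fst]; simp
  have h4 : σ.snd * θ.fst * σ.fst = σ.fst * σ.snd * θ.fst := by
    rw [mul_assoc, θ.fst_odd.anticomm σ.fst_odd, mul_neg, ← mul_assoc, σ.snd_mul_fst]; simp
  refine (flipRel h).toOddModRel ?_ ?_ ?_ ?_ ?_
  · exact θ.prod_mul_fst
  · exact σ.prod_mul_fst
  · change (σ.fst * θ.snd - σ.snd * θ.fst) * θ.fst = -(θ.fst * θ.snd * σ.fst)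
    rw [sub_mul, h1, h2, sub_zero]
  · change (σ.fst * θ.snd - σ.snd * θ.fst) * σ.fst = -(σ.fst * σ.snd * θ.fst)
    rw [sub_mul, h3, h4, zero_sub]
  · change (σ.fst * θ.snd + σ.snd * θ.fst) * θ.fst = (-1 * (θ.fst * θ.snd)) * σ.fst
    rw [add_mul, h1, h2]; simp

theorem oddRel_snd {θ σ : OddPair ι} {q D : Pos ι} (h : FlipEq θ σ q D) :
    OddModRel sixth q.even q⁻¹.even D.even D⁻¹.even θ.prod σ.prod 1
      (muPair θ σ q D).prod (nuPair θ σ q D).prod θ.snd σ.snd := by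
  have h1 : σ.fst * θ.snd * θ.snd = 0 := by rw [mul_assoc, θ.snd_mul_snd, mul_zero]
  have h2 : σ.snd * θ.fst * θ.snd = θ.fst * θ.snd * σ.snd := by
    rw [mul_assoc, (θ.even_mul.commute _).eq]
  have h3 : σ.fst * θ.snd * σ.snd = -(σ.fst * σ.snd * θ.snd) := by
    rw [mul_assoc, θ.snd_odd.anticomm σ.snd_odd, mul_neg, ← mul_assoc]
  have h4 : σ.snd * θ.fst * σ.snd = 0 := by
    rw [mul_assoc, θ.fst_odd.anticomm σ.snd_odd, mul_neg, ← mul_assoc, σ.snd_mul_snd]; simp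
  refine (flipRel h).toOddModRel ?_ ?_ ?_ ?_ ?_
  · exact θ.prod_mul_snd
  · exact σ.prod_mul_snd
  · change (σ.fst * θ.snd - σ.snd * θ.fst) * θ.snd = -(θ.fst * θ.snd * σ.snd)
    rw [sub_mul, h1, h2, zero_sub]
  · change (σ.fst * θ.snd - σ.snd * θ.fst) * σ.snd = -(σ.fst * σ.snd * θ.snd)
    rw [sub_mul, h3, h4, sub_zero]
  · change (σ.fst * θ.snd + σ.snd * θ.fst) * θ.snd = (1 * (θ.fst * θ.snd)) * σ.snd
    rw [add_mul, h1, h2]; simp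

end

end

section

variable {ι : Type u}

/-! ### Matrix identities of a flip -/

theorem EvenPart.comm (e : EvenPart ι) (x : Grassmann ι) : x * (e : Grassmann ι) = e * x :=
  ((mem_evenPart.mp e.2).commute x).eq.symm

theorem EvenPart.smul_eq (e : EvenPart ι) (x : Grassmann ι) : e • x = (e : Grassmann ι) * x := rfl

theorem diag_mul_smat_mul_diag (x₀ x₁ x₂ y₀ y₁ y₂ : EvenPart ι) (a p b q f r c s d : Grassmann ι) :
    smat (x₀ : Grassmann ι) 0 0 0 x₁ 0 0 0 x₂ * smat a p b q f r c s d *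
        smat (y₀ : Grassmann ι) 0 0 0 y₁ 0 0 0 y₂ =
      smat ((x₀ * y₀) • a) ((x₀ * y₁) • p) ((x₀ * y₂) • b)
        ((x₁ * y₀) • q) ((x₁ * y₁) • f) ((x₁ * y₂) • r)
        ((x₂ * y₀) • c) ((x₂ * y₁) • s) ((x₂ * y₂) • d) := by
  have key : ∀ (x y : EvenPart ι) (a : Grassmann ι), (y : Grassmann ι) * (a * x) = (x * y) • a := by
    intro x y a
    rw [EvenPart.comm, ← mul_assoc, EvenPart.smul_eq, mul_comm x y]; rfl
  simp only [smat_mul, mul_zero, zero_mul, add_zero, zero_add, key]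

theorem Qmat_even (θ : OddPair ι) : Qmat θ =
    smat (2 * sixth * θ.prod - 1 : EvenPart ι) θ.fst (1 + sixth * θ.prod : EvenPart ι)
      (-θ.snd) (1 + 2 * sixth * θ.prod : EvenPart ι) 0
      (-(1 + sixth * θ.prod) : EvenPart ι) 0 0 := by
  rw [two_sixth, mul_sixth]; rfl

theorem Qmat_sq_even (θ : OddPair ι) : Qmat θ * Qmat θ =
    smat 0 0 (sixth * θ.prod - 1 : EvenPart ι) 0 (1 - 2 * sixth * θ.prod : EvenPart ι) (-θ.snd)
      (1 - sixth * θ.prod : EvenPart ι) (-θ.fst) (-(1 + 2 * sixth * θ.prod) : EvenPart ι) := by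
  rw [Qmat_sq, two_sixth, mul_sixth]; rfl

theorem Qmat_mul_antidiag_mul_Qmat (θ σ : OddPair ι) (a f b β : EvenPart ι)
    (hβ : (β : Grassmann ι) = σ.fst * θ.snd) :
    Qmat σ * smat 0 0 (b : Grassmann ι) 0 f 0 a 0 0 * Qmat θ =
      smat (a * (1 + sixth * σ.prod) * (2 * sixth * θ.prod - 1) + f * β -
          b * (2 * sixth * σ.prod - 1) * (1 + sixth * θ.prod) : EvenPart ι)
        ((a * (1 + sixth * σ.prod)) • θ.fst + (f * (1 + 2 * sixth * θ.prod)) • σ.fst)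
        (a * (1 + sixth * σ.prod) * (1 + sixth * θ.prod) : EvenPart ι)
        ((-(f * (1 + 2 * sixth * σ.prod))) • θ.snd + (b * (1 + sixth * θ.prod)) • σ.snd)
        (f * (1 + 2 * sixth * σ.prod) * (1 + 2 * sixth * θ.prod) : EvenPart ι) 0
        (b * (1 + sixth * σ.prod) * (1 + sixth * θ.prod) : EvenPart ι) 0 0 := by
  rw [Qmat_even, Qmat_even]
  generalize sixth * σ.prod = v
  generalize sixth * θ.prod = u
  generalize 2 * sixth * σ.prod = v'
  generalize 2 * sixth * θ.prod = u'
  simp only [smat_mul, mul_zero, zero_mul, add_zero, zero_add]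
  have hβ' : -θ.snd * (f * σ.fst) = (f * β : EvenPart ι) := by
    rw [← EvenPart.comm, ← mul_assoc, EvenPart.comm, neg_mul, θ.snd_odd.anticomm σ.fst_odd, neg_neg,
      ← hβ]; rfl
  congr 1
  · rw [hβ']
    exact congrArg Subtype.val (show (u' - 1) * (a * (1 + v)) + f * β + -(1 + u) * (b * (v' - 1)) =
      a * (1 + v) * (u' - 1) + f * β - b * (v' - 1) * (1 + u) by ring)
  · rw [EvenPart.smul_eq, EvenPart.smul_eq, ← mul_assoc ((1 + u' : EvenPart ι) : Grassmann ι),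
      mul_comm f]
    congr 1
    exact (EvenPart.comm (a * (1 + v)) θ.fst)
  · exact congrArg Subtype.val (show (1 + u) * (a * (1 + v)) = a * (1 + v) * (1 + u) by ring)
  · rw [EvenPart.smul_eq, EvenPart.smul_eq]
    congr 1
    · rw [neg_mul]
      change -(θ.snd * ((f * (1 + v') : EvenPart ι) : Grassmann ι)) =
        -((f * (1 + v') : EvenPart ι) : Grassmann ι) * θ.snd
      rw [EvenPart.comm, neg_mul]
    · change -((1 + u : EvenPart ι) : Grassmann ι) * (b * -σ.snd) =
        (b * (1 + u) : EvenPart ι) * σ.snd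
      rw [mul_neg, mul_neg, neg_mul, neg_neg, ← mul_assoc, mul_comm b]; rfl
  · exact congrArg Subtype.val (show (1 + u') * (f * (1 + v')) = f * (1 + v') * (1 + u') by ring)
  · exact congrArg Subtype.val (show -(1 + u) * (b * -(1 + v)) = b * (1 + v) * (1 + u) by ring)

theorem Qmat_sq_mul_antidiag_mul_Qmat_sq (θ σ : OddPair ι) (a f b β : EvenPart ι)
    (hβ : (β : Grassmann ι) = σ.fst * θ.snd) :
    Qmat σ * Qmat σ * smat 0 0 (b : Grassmann ι) 0 f 0 a 0 0 * (Qmat θ * Qmat θ) =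
      smat 0 0 (a * (sixth * σ.prod - 1) * (sixth * θ.prod - 1) : EvenPart ι) 0
        (f * (1 - 2 * sixth * σ.prod) * (1 - 2 * sixth * θ.prod) : EvenPart ι)
        ((a * (1 - sixth * θ.prod)) • σ.snd - (f * (1 - 2 * sixth * σ.prod)) • θ.snd)
        (b * (1 - sixth * σ.prod) * (1 - sixth * θ.prod) : EvenPart ι)
        ((-(f * (1 - 2 * sixth * θ.prod))) • σ.fst - (b * (1 - sixth * σ.prod)) • θ.fst)
        (a * (1 + 2 * sixth * σ.prod) * (1 - sixth * θ.prod) - f * β -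
          b * (1 - sixth * σ.prod) * (1 + 2 * sixth * θ.prod) : EvenPart ι) := by
  rw [Qmat_sq_even, Qmat_sq_even]
  generalize sixth * σ.prod = v
  generalize sixth * θ.prod = u
  generalize 2 * sixth * σ.prod = v'
  generalize 2 * sixth * θ.prod = u'
  simp only [smat_mul, mul_zero, zero_mul, add_zero, zero_add]
  have hβ' : -θ.snd * (f * -σ.fst) = -(f * β : EvenPart ι) := by
    rw [← EvenPart.comm, ← mul_assoc, EvenPart.comm, neg_mul_neg, θ.snd_odd.anticomm σ.fst_odd,
      mul_neg, ← hβ]; rfl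
  congr 1
  · exact congrArg Subtype.val (show (u - 1) * (a * (v - 1)) = a * (v - 1) * (u - 1) by ring)
  · exact congrArg Subtype.val (show (1 - u') * (f * (1 - v')) = f * (1 - v') * (1 - u') by ring)
  · rw [EvenPart.smul_eq, EvenPart.smul_eq]
    refine Eq.trans ?_ (sub_eq_add_neg _ _).symm
    congr 1
    · change ((u - 1 : EvenPart ι) : Grassmann ι) * (a * -σ.snd) =
        (a * (1 - u) : EvenPart ι) * σ.snd
      rw [mul_neg, mul_neg, ← neg_mul, ← mul_assoc, show a * (1 - u) = -(u - 1) * a by ring]; rfl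
    · rw [neg_mul]
      exact congrArg _ (EvenPart.comm (f * (1 - v')) θ.snd)
  · exact congrArg Subtype.val (show (1 - u) * (b * (1 - v)) = b * (1 - v) * (1 - u) by ring)
  · rw [EvenPart.smul_eq, EvenPart.smul_eq]
    refine Eq.trans ?_ (sub_eq_add_neg _ _).symm
    congr 1
    · rw [mul_neg, mul_neg, ← neg_mul, ← mul_assoc,
        show -(f * (1 - u')) = -(1 - u') * f by ring]; rfl
    · rw [neg_mul]
      exact congrArg _ (EvenPart.comm (b * (1 - v)) θ.fst)
  · rw [hβ']
    exact congrArg Subtype.val (show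
      (u - 1) * (a * -(1 + v')) + -(f * β) + -(1 + u') * (b * (1 - v)) =
      a * (1 + v') * (1 - u) - f * β - b * (1 - v) * (1 + u') by ring)

@[simp] theorem Pos.even_mul (a b : Pos ι) : (a * b).even = a.even * b.even := rfl

@[simp] theorem Pos.even_mul_inv (a : Pos ι) : a.even * a⁻¹.even = 1 := Subtype.ext a.mul_inv_coe

theorem OddPair.cPos_even (θ : OddPair ι) : θ.cPos.even = 1 + sixth * θ.prod := by
  rw [mul_sixth]; rfl

theorem OddPair.prod_mul_self (θ : OddPair ι) : θ.prod * θ.prod = 0 := Subtype.ext θ.prod_mul_prod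

theorem OddPair.cPos_inv_even (θ : OddPair ι) : θ.cPos⁻¹.even = 1 - sixth * θ.prod := by
  have h : θ.cPos.even * (1 - sixth * θ.prod) = 1 := by
    rw [θ.cPos_even]
    linear_combination (-sixth ^ 2) * θ.prod_mul_self
  calc θ.cPos⁻¹.even = θ.cPos⁻¹.even * (θ.cPos.even * (1 - sixth * θ.prod)) := by rw [h, mul_one]
    _ = (θ.cPos.even * θ.cPos⁻¹.even) * (1 - sixth * θ.prod) := by ring
    _ = _ := by rw [Pos.even_mul_inv, one_mul]

theorem dU_mul_zU (a b : Pos ι) : (dU a : SMat ι) * (zU b : SMat ι) =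
    smat ((a.even * b.even : EvenPart ι) : Grassmann ι) 0 0 0
      ((b.even * b.even : EvenPart ι) : Grassmann ι) 0 0 0
      ((a⁻¹.even * b.even : EvenPart ι) : Grassmann ι) := by
  rw [dU_smat, zU_smat, smat_mul]
  simp only [mul_zero, zero_mul, add_zero, zero_add, mul_one]
  rw [a.comm, (a⁻¹).comm]
  rfl

theorem jU_mul_dU (a : Pos ι) : ((jU : (SMat ι)ˣ) : SMat ι) * (dU a : SMat ι) =
    smat 0 0 ((a⁻¹.even : EvenPart ι) : Grassmann ι) 0 ((1 : EvenPart ι) : Grassmann ι) 0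
      ((-a.even : EvenPart ι) : Grassmann ι) 0 0 := by
  rw [dU_smat, jU_coe, smat_mul]
  simp only [mul_zero, add_zero, zero_add, mul_one, mul_neg, neg_zero]
  rfl

theorem muPair_fst (θ σ : OddPair ι) (q D : Pos ι) :
    (muPair θ σ q D).fst = D⁻¹.even • (θ.fst + q.even • σ.fst) := (D⁻¹).comm _

theorem muPair_snd (θ σ : OddPair ι) (q D : Pos ι) :
    (muPair θ σ q D).snd = D⁻¹.even • (θ.snd + q.even • σ.snd) := (D⁻¹).comm _

theorem nuPair_fst (θ σ : OddPair ι) (q D : Pos ι) :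
    (nuPair θ σ q D).fst = D⁻¹.even • (σ.fst - q.even • θ.fst) := (D⁻¹).comm _

theorem nuPair_snd (θ σ : OddPair ι) (q D : Pos ι) :
    (nuPair θ σ q D).snd = D⁻¹.even • (σ.snd - q.even • θ.snd) := (D⁻¹).comm _

theorem smul_coe_congr {x k l : EvenPart ι} (h : x * k = l) :
    x • (k : Grassmann ι) = (l : Grassmann ι) := congrArg Subtype.val h

theorem dU_mul_zU_mul_nU (a b : Pos ι) :
    (dU a : SMat ι) * (zU b : SMat ι) * ((nU : (SMat ι)ˣ) : SMat ι) =
    smat ((-(a.even * b.even) : EvenPart ι) : Grassmann ι) 0 0 0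
      ((b.even * b.even : EvenPart ι) : Grassmann ι) 0 0 0
      ((-(a⁻¹.even * b.even) : EvenPart ι) : Grassmann ι) := by
  rw [dU_mul_zU, nU_coe, smat_mul]
  simp only [mul_zero, zero_mul, add_zero, zero_add, one_mul, neg_mul]
  rfl

theorem jU_mul_dU_mul_zU (a b : Pos ι) :
    ((jU : (SMat ι)ˣ) : SMat ι) * (dU a : SMat ι) * (zU b : SMat ι) =
    smat 0 0 ((a⁻¹.even * b.even : EvenPart ι) : Grassmann ι) 0
      ((b.even * b.even : EvenPart ι) : Grassmann ι) 0
      ((-(a.even * b.even) : EvenPart ι) : Grassmann ι) 0 0 := by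
  rw [mul_assoc, dU_mul_zU, jU_coe, smat_mul]
  simp only [mul_zero, add_zero, zero_add, mul_one, mul_neg, neg_zero]
  rfl

theorem OddPair.c_sq (θ : OddPair ι) :
    (1 + sixth * θ.prod) * (1 + sixth * θ.prod) = 1 + 2 * sixth * θ.prod := by
  linear_combination sixth ^ 2 * θ.prod_mul_self

theorem OddPair.c_inv_sq (θ : OddPair ι) :
    (1 - sixth * θ.prod) * (1 - sixth * θ.prod) = 1 - 2 * sixth * θ.prod := by
  linear_combination sixth ^ 2 * θ.prod_mul_self

/-- The sides `d` and `a` of the new triangle `ABD`, reached through the old diagonal: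
`Q_σ² J D_q Q_θ²` becomes `Q_μ²` after the changes of frames along `d` and `a`. -/
theorem flipMatrix_sideD {θ σ : OddPair ι} {q D : Pos ι} (h : FlipEq θ σ q D) :
    dU (D * q⁻¹) * zU ((nuPair θ σ q D).cPos * θ.cPos⁻¹) *
      (qU σ * qU σ * (jU * dU q) * (qU θ * qU θ)) * (dU D * zU θ.cPos) =
    qU (muPair θ σ q D) * qU (muPair θ σ q D) := by
  have H := flipRel h
  have H1 := oddRel_fst h
  have H2 := oddRel_snd h
  apply Units.ext
  simp only [Units.val_mul]
  rw [dU_mul_zU, dU_mul_zU, jU_mul_dU, qU_coe, qU_coe, qU_coe,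
    Qmat_sq_mul_antidiag_mul_Qmat_sq θ σ _ _ _ (cross₁ θ σ) rfl, diag_mul_smat_mul_diag,
    Qmat_sq_even]
  simp only [Pos.even_mul, OddPair.cPos_even, OddPair.cPos_inv_even, mul_inv, inv_inv, smul_zero,
    θ.c_sq]
  congr 1
  · apply smul_coe_congr
    linear_combination H.sideD_02
  · apply smul_coe_congr
    linear_combination H.sideD_11
  · rw [muPair_snd, ← H2.sideD_12]
    module
  · apply smul_coe_congr
    linear_combination H.sideD_20
  · rw [muPair_fst, ← H1.sideD_21]
    module
  · apply smul_coe_congr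
    linear_combination H.sideD_22

/-- The sides `c` and `b` of the new triangle `BCD`, reached through the old diagonal. -/
theorem flipMatrix_sideC {θ σ : OddPair ι} {q D : Pos ι} (h : FlipEq θ σ q D) :
    dU D⁻¹ * zU (θ.cPos * (muPair θ σ q D).cPos⁻¹) *
      (qU σ * (jU * dU q) * qU θ) * (dU (q * D⁻¹) * zU θ.cPos⁻¹ * nU) =
    qU (nuPair θ σ q D) := by
  have H := flipRel h
  have H1 := oddRel_fst h
  have H2 := oddRel_snd h
  apply Units.ext
  simp only [Units.val_mul]
  rw [dU_mul_zU, dU_mul_zU_mul_nU, jU_mul_dU, qU_coe, qU_coe, qU_coe,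
    Qmat_mul_antidiag_mul_Qmat θ σ _ _ _ (cross₁ θ σ) rfl, diag_mul_smat_mul_diag, Qmat_even]
  simp only [Pos.even_mul, OddPair.cPos_even, OddPair.cPos_inv_even, mul_inv, inv_inv, smul_zero,
    θ.c_inv_sq]
  congr 1
  · apply smul_coe_congr
    linear_combination H.sideC_00
  · rw [nuPair_fst, ← H1.sideC_01]
    module
  · apply smul_coe_congr
    linear_combination H.sideC_02
  · rw [nuPair_snd, ← H2.sideC_10]
    module
  · apply smul_coe_congr
    linear_combination H.sideC_11
  · apply smul_coe_congr
    linear_combination H.sideC_20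

/-- The sides `a` and `b` of the old triangle `ABC`, reached through the new diagonal. -/
theorem flipMatrix_sideB {θ σ : OddPair ι} {q D : Pos ι} (h : FlipEq θ σ q D) :
    dU (q * D⁻¹) * zU θ.cPos⁻¹ * nU *
      (qU (nuPair θ σ q D) * (jU * dU q⁻¹ * zU (θ.cPos * θ.cPos * σ.cPos⁻¹)) *
        qU (muPair θ σ q D)) * (dU D⁻¹ * zU θ.cPos⁻¹) =
    qU θ := by
  have H := flipRel h
  have H1 := oddRel_fst h
  have H2 := oddRel_snd h
  have hβ : (nuPair θ σ q D).fst * (muPair θ σ q D).snd =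
      (D⁻¹.even * D⁻¹.even * (cross₁ θ σ + q.even * (σ.prod - θ.prod) +
        q.even ^ 2 * cross₂ θ σ) : EvenPart ι) := by
    change (σ.fst - q * θ.fst) * (D⁻¹ : Pos ι) * ((θ.snd + q * σ.snd) * (D⁻¹ : Pos ι)) =
      (D⁻¹ : Pos ι) * (D⁻¹ : Pos ι) * (σ.fst * θ.snd + q * (σ.fst * σ.snd - θ.fst * θ.snd) +
        (q : Grassmann ι) ^ 2 * (σ.snd * θ.fst))
    rw [mul_pos_mul_mul_pos, ← Pos.coe_mul, Pos.comm, sub_mul, mul_add, mul_add,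
      σ.snd_odd.anticomm θ.fst_odd, ← mul_assoc σ.fst, q.comm σ.fst,
      mul_assoc _ θ.fst (_ * _), ← mul_assoc θ.fst _ σ.snd, q.comm]
    congr 1
    noncomm_ring
  apply Units.ext
  simp only [Units.val_mul]
  rw [dU_mul_zU_mul_nU, dU_mul_zU, jU_mul_dU_mul_zU, qU_coe, qU_coe, qU_coe,
    Qmat_mul_antidiag_mul_Qmat _ _ _ _ _ _ hβ.symm, diag_mul_smat_mul_diag, Qmat_even]
  simp only [Pos.even_mul, OddPair.cPos_even, OddPair.cPos_inv_even, mul_inv, inv_inv, smul_zero,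
    θ.c_inv_sq, θ.c_sq]
  congr 1
  · apply smul_coe_congr
    have h0 := H.sideB_00 (D⁻¹.even * D⁻¹.even * (cross₁ θ σ + q.even * (σ.prod - θ.prod) +
        q.even ^ 2 * cross₂ θ σ)) (by linear_combination (cross₁ θ σ + q.even * (σ.prod - θ.prod) +
        q.even ^ 2 * cross₂ θ σ) * (1 + D.even * D⁻¹.even) * H.hD)
        ((1 + 2 * sixth * θ.prod) * (1 - sixth * σ.prod)) rfl
    linear_combination h0
  · rw [nuPair_fst, muPair_fst]
    refine Eq.trans ?_ (H1.sideB_01 _ rfl)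
    module
  · apply smul_coe_congr
    linear_combination H.sideB_02 _ rfl
  · rw [nuPair_snd, muPair_snd]
    refine Eq.trans ?_ (H2.sideB_10 _ rfl)
    module
  · apply smul_coe_congr
    linear_combination H.sideB_11 _ rfl
  · apply smul_coe_congr
    linear_combination H.sideB_20 _ rfl

end

section

variable {ι : Type u}

/-! ### Scalars, parity and the invariant pairing -/

theorem smul_mul_smat (t : Grassmann ι) (M N : SMat ι) : (op t • M) * N = op t • (M * N) :=
  Matrix.smul_mul _ _ _

theorem mul_smul_smat {t : Grassmann ι} (ht : IsEven t) (M N : SMat ι) :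
    M * (op t • N) = op t • (M * N) := by
  ext i j
  simp only [Matrix.mul_apply, Matrix.smul_apply, Finset.mul_sum, smul_eq_mul]
  refine Finset.sum_congr rfl fun k _ => unop_injective ?_
  simp only [unop_mul, unop_op]
  rw [mul_assoc, mul_assoc, (ht.commute _).eq]

theorem Psi_smul (t : Grassmann ι) (M : SMat ι) : Psi (op t • M) = op t • Psi M := by
  ext i j
  fin_cases i <;> fin_cases j <;> simp [Psi]

theorem involute_of_isEven {x : Grassmann ι} (hx : IsEven x) : CliffordAlgebra.involute x = x :=
  CliffordAlgebra.involute_eq_of_mem_even hx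

theorem involute_of_isOdd {x : Grassmann ι} (hx : IsOdd x) : CliffordAlgebra.involute x = -x :=
  CliffordAlgebra.involute_eq_of_mem_odd hx

theorem exists_even_add_odd (x : Grassmann ι) :
    ∃ a b : Grassmann ι, IsEven a ∧ IsOdd b ∧ x = a + b := by
  have h : x ∈ CliffordAlgebra.evenOdd (0 : QuadraticForm ℝ (ι →₀ ℝ)) 0 ⊔
      CliffordAlgebra.evenOdd (0 : QuadraticForm ℝ (ι →₀ ℝ)) 1 := by
    rw [(CliffordAlgebra.evenOdd_isCompl (0 : QuadraticForm ℝ (ι →₀ ℝ))).sup_eq_top]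
    trivial
  obtain ⟨a, ha, b, hb, h⟩ := Submodule.mem_sup.mp h
  exact ⟨a, b, ha, hb, h.symm⟩

theorem isEven_iff_involute {x : Grassmann ι} : IsEven x ↔ CliffordAlgebra.involute x = x := by
  refine ⟨involute_of_isEven, fun h => ?_⟩
  obtain ⟨a, b, ha, hb, rfl⟩ := exists_even_add_odd x
  rw [map_add, involute_of_isEven ha, involute_of_isOdd hb] at h
  have h2 : (2 : ℝ) • b = 0 := by
    rw [two_smul, ← eq_neg_iff_add_eq_zero]
    exact (add_left_cancel h).symm
  rw [(smul_eq_zero.mp h2).resolve_left two_ne_zero, add_zero]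
  exact ha

theorem isOdd_iff_involute {x : Grassmann ι} : IsOdd x ↔ CliffordAlgebra.involute x = -x := by
  refine ⟨involute_of_isOdd, fun h => ?_⟩
  obtain ⟨a, b, ha, hb, rfl⟩ := exists_even_add_odd x
  rw [map_add, involute_of_isEven ha, involute_of_isOdd hb, neg_add] at h
  have h2 : (2 : ℝ) • a = 0 := by
    rw [two_smul, ← eq_neg_iff_add_eq_zero]
    exact add_right_cancel h
  rw [(smul_eq_zero.mp h2).resolve_left two_ne_zero, zero_add]
  exact hb

/-- The parity automorphism applied to all entries of a supermatrix. -/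
def parity : SMat ι →+* SMat ι :=
  (RingHom.op (CliffordAlgebra.involute (Q := (0 : QuadraticForm ℝ (ι →₀ ℝ)))).toRingHom).mapMatrix

/-- A supermatrix is even iff the parity automorphism acts on it as conjugation by
`diag (-1, 1, -1)`. -/
theorem isEvenMat_iff_parity {M : SMat ι} :
    IsEvenMat M ↔ parity M = (nU : (SMat ι)ˣ) * M * (nU : (SMat ι)ˣ) := by
  have key : ∀ i j, (parity M) i j = op (CliffordAlgebra.involute (entry M i j)) := fun i j => rfl
  have h2 : ∀ i j, ((nU : (SMat ι)ˣ) * M * (nU : (SMat ι)ˣ) : SMat ι) i j =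
      op (if (i = 1 ↔ j = 1) then entry M i j else -entry M i j) := by
    intro i j
    have h3 : ((nU : (SMat ι)ˣ) * M * (nU : (SMat ι)ˣ) : SMat ι) =
        smat (entry M 0 0) (-entry M 0 1) (entry M 0 2) (-entry M 1 0) (entry M 1 1)
          (-entry M 1 2) (entry M 2 0) (-entry M 2 1) (entry M 2 2) := by
      conv_lhs => rw [← smat_entries M, nU_coe, smat_mul, smat_mul]
      simp
    rw [h3]
    fin_cases i <;> fin_cases j <;> rfl
  rw [← Matrix.ext_iff]
  simp only [key, h2, op_inj]
  refine forall_congr' fun i => forall_congr' fun j => ?_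
  split_ifs
  · exact isEven_iff_involute
  · exact isOdd_iff_involute

theorem nU_mul_nU : (nU : (SMat ι)ˣ) * nU = 1 := by
  apply Units.ext
  rw [Units.val_mul, nU_coe, smat_mul, Units.val_one, smat_one]
  simp

theorem IsEvenMat.mul {M N : SMat ι} (hM : IsEvenMat M) (hN : IsEvenMat N) : IsEvenMat (M * N) := by
  rw [isEvenMat_iff_parity] at *
  have h : ((nU : (SMat ι)ˣ) : SMat ι) * ((nU : (SMat ι)ˣ) : SMat ι) = 1 :=
    congrArg Units.val nU_mul_nU
  rw [map_mul, hM, hN]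
  calc _ = (nU : (SMat ι)ˣ) * M * (((nU : (SMat ι)ˣ) : SMat ι) * ((nU : (SMat ι)ˣ) : SMat ι)) * N *
        (nU : (SMat ι)ˣ) := by simp only [mul_assoc]
    _ = _ := by rw [h, mul_one]; simp only [mul_assoc]

theorem IsEvenMat.inv {u : (SMat ι)ˣ} (hu : IsEvenMat (u : SMat ι)) :
    IsEvenMat ((u⁻¹ : (SMat ι)ˣ) : SMat ι) := by
  rw [isEvenMat_iff_parity] at *
  have h1 : Units.map (parity (ι := ι)).toMonoidHom u = nU * u * nU := Units.ext hu
  have h2 : Units.map (parity (ι := ι)).toMonoidHom u⁻¹ = nU * u⁻¹ * nU := by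
    have hn : (nU : (SMat ι)ˣ)⁻¹ = nU := inv_eq_of_mul_eq_one_left nU_mul_nU
    rw [map_inv, h1, mul_inv_rev, mul_inv_rev, hn, mul_assoc]
  exact congrArg Units.val h2

theorem str_smat (a p b q f r c s d : Grassmann ι) : str (smat a p b q f r c s d) = a + d - f := rfl

/-- The supertrace is cyclic on even supermatrices: the sign from interchanging two odd entries
cancels the sign of the odd diagonal entry. -/
theorem str_mul_comm {X Y : SMat ι} (hX : IsEvenMat X) (hY : IsEvenMat Y) :
    str (X * Y) = str (Y * X) := by
  have ev : ∀ {Z W : SMat ι}, IsEvenMat Z → ∀ i j k l : Fin 3, (i = 1 ↔ j = 1) →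
      entry Z i j * entry W k l = entry W k l * entry Z i j := by
    intro Z W hZ i j k l h
    have := hZ i j
    rw [if_pos h] at this
    exact (this.commute _).eq
  have od : ∀ i j k l : Fin 3, ¬(i = 1 ↔ j = 1) → ¬(k = 1 ↔ l = 1) →
      entry X i j * entry Y k l = -(entry Y k l * entry X i j) := by
    intro i j k l h h'
    have h1 := hX i j
    have h2 := hY k l
    rw [if_neg h] at h1
    rw [if_neg h'] at h2
    exact h1.anticomm h2
  have e1 := ev (W := Y) hX 0 0 0 0 (by decide)
  have e2 := ev (W := Y) hX 2 0 0 2 (by decide)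
  have e3 := ev (W := Y) hX 0 2 2 0 (by decide)
  have e4 := ev (W := Y) hX 2 2 2 2 (by decide)
  have e5 := ev (W := Y) hX 1 1 1 1 (by decide)
  have o1 := od 0 1 1 0 (by decide) (by decide)
  have o2 := od 1 0 0 1 (by decide) (by decide)
  have o3 := od 2 1 1 2 (by decide) (by decide)
  have o4 := od 1 2 2 1 (by decide) (by decide)
  rw [← smat_entries X, ← smat_entries Y, smat_mul, smat_mul, str_smat, str_smat, e1, e2, e3, e4,
    e5, o1, o2, o3, o4]
  abel

theorem pairing_conj {u : (SMat ι)ˣ} (hu : IsEvenMat (u : SMat ι)) {X Y : SMat ι}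
    (hX : IsEvenMat X) (hY : IsEvenMat Y) : pairing (conj u X) (conj u Y) = pairing X Y := by
  have h : conj u X * conj u Y = u * (X * Y) * (u⁻¹ : (SMat ι)ˣ) := by
    rw [conj_apply, conj_apply]
    simp only [mul_assoc, Units.inv_mul_cancel_left]
  rw [pairing, pairing, h, str_mul_comm (hu.mul (hX.mul hY)) hu.inv, Units.inv_mul_cancel_left]

theorem pairing_Psi (X Y : SMat ι) : pairing (Psi X) (Psi Y) = pairing X Y := by
  rw [pairing, pairing, ← smat_entries X, ← smat_entries Y, Psi_smat, Psi_smat, smat_mul, smat_mul,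
    str_smat, str_smat]
  congr 1
  simp only [neg_mul, mul_neg, neg_neg]
  abel

theorem isEvenMat_smat {a p b q f r c s d : Grassmann ι} (ha : IsEven a) (hp : IsOdd p)
    (hb : IsEven b) (hq : IsOdd q) (hf : IsEven f) (hr : IsOdd r) (hc : IsEven c) (hs : IsOdd s)
    (hd : IsEven d) : IsEvenMat (smat a p b q f r c s d) := by
  intro i j
  fin_cases i <;> fin_cases j
  exacts [ha, hp, hb, hq, hf, hr, hc, hs, hd]

theorem IsEvenMat.isEven {M : SMat ι} (hM : IsEvenMat M) (i j : Fin 3) (h : i = 1 ↔ j = 1) :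
    IsEven (entry M i j) := by
  have := hM i j
  rwa [if_pos h] at this

theorem IsEvenMat.isOdd {M : SMat ι} (hM : IsEvenMat M) (i j : Fin 3) (h : ¬(i = 1 ↔ j = 1)) :
    IsOdd (entry M i j) := by
  have := hM i j
  rwa [if_neg h] at this

theorem IsEvenMat.Psi {M : SMat ι} (hM : IsEvenMat M) : IsEvenMat (Psi M) := by
  rw [← smat_entries M, Psi_smat]
  exact isEvenMat_smat (hM.isEven 2 2 (by decide)).neg (hM.isOdd 1 2 (by decide))
    (hM.isEven 0 2 (by decide)) (hM.isOdd 2 1 (by decide)).neg (hM.isEven 1 1 (by decide)).neg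
    (hM.isOdd 0 1 (by decide)) (hM.isEven 2 0 (by decide)) (hM.isOdd 1 0 (by decide)).neg
    (hM.isEven 0 0 (by decide)).neg

theorem Psi_Psi (M : SMat ι) : Psi (Psi M) = M := by
  rw [← smat_entries M, Psi_smat, Psi_smat]
  simp only [neg_neg]

/-- A bijection given by conjugation is conjugation by an invertible supermatrix. -/
theorem isUnit_of_ad {φ : Equiv.Perm (SMat ι)} {M : SMat ι} (h : ∀ X, φ X = ad M X) :
    ∃ u : (SMat ι)ˣ, (u : SMat ι) = M ∧ φ = conj u := by
  by_cases hM : IsUnit M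
  · obtain ⟨u, rfl⟩ := hM
    exact ⟨u, rfl, Equiv.ext fun X => by rw [h, ad_coe]⟩
  · exfalso
    have h0 : ∀ X, φ X = 0 := fun X => by rw [h, ad, Ring.inverse_non_unit _ hM, mul_zero]
    have : (0 : SMat ι) = 1 := φ.injective (by rw [h0, h0])
    exact zero_ne_one (α := Grassmann ι) (congrArg (fun N => entry N 0 0) this)

/-- The properties of the transformations of Minkowski superspace which are used: they preserve
even supermatrices, are linear over even scalars, and preserve the pairing. -/
theorem SLtilde_spec {φ : Equiv.Perm (SMat ι)} (hφ : φ ∈ SLtilde ι) :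
    (∀ X, IsEvenMat (φ X) ↔ IsEvenMat X) ∧
    (∀ X Y, IsEvenMat X → IsEvenMat Y → pairing (φ X) (φ Y) = pairing X Y) ∧
    (∀ t : Grassmann ι, IsEven t → ∀ X, φ (op t • X) = op t • φ X) := by
  induction hφ using Subgroup.closure_induction with
  | mem φ h =>
    rcases h with ⟨M, hM, h⟩ | h
    · obtain ⟨u, rfl, rfl⟩ := isUnit_of_ad h
      have hu : IsEvenMat (u : SMat ι) := hM.1
      refine ⟨fun X => ⟨fun hX => ?_, fun hX => (hu.mul hX).mul hu.inv⟩,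
        fun X Y hX hY => pairing_conj hu hX hY, fun t ht X => ?_⟩
      · have := (hu.inv.mul hX).mul hu
        rw [conj_apply] at this
        simpa [mul_assoc] using this
      · rw [conj_apply, conj_apply, mul_smul_smat ht, smul_mul_smat]
    · refine ⟨fun X => ?_, fun X Y _ _ => ?_, fun t _ X => ?_⟩
      · rw [h]
        exact ⟨fun hX => Psi_Psi X ▸ hX.Psi, fun hX => hX.Psi⟩
      · rw [h, h, pairing_Psi]
      · rw [h, h, Psi_smul]
  | one => simp
  | mul φ ψ _ _ h1 h2 =>
    refine ⟨fun X => (h1.1 _).trans (h2.1 _), fun X Y hX hY => ?_, fun t ht X => ?_⟩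
    · exact (h1.2.1 _ _ ((h2.1 X).mpr hX) ((h2.1 Y).mpr hY)).trans (h2.2.1 X Y hX hY)
    · rw [Equiv.Perm.mul_apply, Equiv.Perm.mul_apply, h2.2.2 t ht, h1.2.2 t ht]
  | inv φ _ h =>
    have hs : ∀ X, φ (φ⁻¹ X) = X := φ.apply_symm_apply
    have hE : ∀ X, IsEvenMat (φ⁻¹ X) ↔ IsEvenMat X := fun X => by
      rw [← h.1 (φ⁻¹ X), hs]
    refine ⟨hE, fun X Y hX hY => ?_, fun t ht X => ?_⟩
    · rw [← h.2.1 _ _ ((hE X).mpr hX) ((hE Y).mpr hY), hs, hs]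
    · rw [Equiv.Perm.inv_eq_iff_eq, h.2.2 t ht, hs]

end

section

variable {ι : Type u}

/-! ### The elementary transformations as elements of the group -/

theorem conj_mem {u : (SMat ι)ˣ} (hu : (u : SMat ι) ∈ SL0 ι) : conj u ∈ SLtilde ι :=
  Subgroup.subset_closure (Or.inl ⟨u, hu, fun X => (ad_coe u X).symm⟩)

theorem smat_mem_SL0 {a p b q r c s d : Grassmann ι} {f : Pos ι} (ha : IsEven a) (hp : IsOdd p)
    (hb : IsEven b) (hq : IsOdd q) (hr : IsOdd r) (hc : IsEven c) (hs : IsOdd s)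
    (hd : IsEven d) (h : (a + p * (f⁻¹ : Pos ι) * q) * (d + s * (f⁻¹ : Pos ι) * r) -
      (b + p * (f⁻¹ : Pos ι) * r) * (c + s * (f⁻¹ : Pos ι) * q) = f) :
    smat a p b q f r c s d ∈ SL0 ι := by
  refine ⟨isEvenMat_smat ha hp hb hq f.isEven hr hc hs hd, f.2, ?_⟩
  change (f⁻¹ : Pos ι) * ((a + p * (f⁻¹ : Pos ι) * q) * (d + s * (f⁻¹ : Pos ι) * r) -
      (b + p * (f⁻¹ : Pos ι) * r) * (c + s * (f⁻¹ : Pos ι) * q)) = (1 : Grassmann ι)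
  rw [h, Pos.inv_mul_coe]

theorem zU_mem (a : Pos ι) : conj (zU a) ∈ SLtilde ι := by
  apply conj_mem
  rw [zU_smat, ← Pos.coe_mul]
  apply smat_mem_SL0 a.isEven IsOdd.zero IsEven.zero IsOdd.zero IsOdd.zero IsEven.zero IsOdd.zero
    a.isEven
  simp

theorem dU_mem (a : Pos ι) : conj (dU a) ∈ SLtilde ι := by
  apply conj_mem
  rw [dU_smat, ← Pos.coe_one]
  apply smat_mem_SL0 a.isEven IsOdd.zero IsEven.zero IsOdd.zero IsOdd.zero IsEven.zero IsOdd.zero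
    (a⁻¹).isEven
  simp

theorem nU_mem : conj (nU : (SMat ι)ˣ) ∈ SLtilde ι := by
  apply conj_mem
  rw [nU_coe, ← Pos.coe_one]
  apply smat_mem_SL0 (Pos.isEven 1).neg IsOdd.zero IsEven.zero IsOdd.zero IsOdd.zero IsEven.zero
    IsOdd.zero (Pos.isEven 1).neg
  simp

theorem jU_mem : conj (jU : (SMat ι)ˣ) ∈ SLtilde ι := by
  apply conj_mem
  rw [jU_coe, ← Pos.coe_one]
  apply smat_mem_SL0 IsEven.zero IsOdd.zero (Pos.isEven 1) IsOdd.zero IsOdd.zero (Pos.isEven 1).neg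
    IsOdd.zero IsEven.zero
  simp

theorem qU_mem (θ : OddPair ι) : conj (qU θ) ∈ SLtilde ι := by
  apply conj_mem
  have hf : ((θ.cPos * θ.cPos : Pos ι) : Grassmann ι) = 1 + (1 / 3 : ℝ) • (θ.fst * θ.snd) := by
    have := congrArg Subtype.val θ.c_sq
    rw [← θ.cPos_even, two_sixth] at this
    exact this
  rw [qU_coe, Qmat, ← hf]
  apply smat_mem_SL0 ((θ.even_mul.smul _).sub IsEven.one) θ.fst_odd θ.cPos.isEven θ.snd_odd.neg
    IsOdd.zero θ.cPos.isEven.neg IsOdd.zero IsEven.zero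
  simp

/-- The transformation `Ψ`. -/
def psiPerm : Equiv.Perm (SMat ι) := ⟨Psi, Psi, Psi_Psi, Psi_Psi⟩

theorem psiPerm_mem : (psiPerm : Equiv.Perm (SMat ι)) ∈ SLtilde ι :=
  Subgroup.subset_closure (Or.inr fun _ => rfl)

/-- Conjugation by `Z_a`. -/
def zG : Pos ι →* SLtilde ι := (conj.comp zU).codRestrict _ zU_mem

/-- Conjugation by `D_a`. -/
def dG : Pos ι →* SLtilde ι := (conj.comp dU).codRestrict _ dU_mem

/-- Conjugation by `Z_{-1}`. -/
def nG : SLtilde ι := ⟨conj nU, nU_mem⟩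

/-- Conjugation by `J`. -/
def jG : SLtilde ι := ⟨conj jU, jU_mem⟩

/-- Conjugation by `Q_θ`. -/
def qG (θ : OddPair ι) : SLtilde ι := ⟨conj (qU θ), qU_mem θ⟩

/-- The involution `Ψ`. -/
def psiG : SLtilde ι := ⟨psiPerm, psiPerm_mem⟩

section Relations

theorem dgenU_comm (x y : Pos ι × Pos ι) : dgenU x * dgenU y = dgenU y * dgenU x := by
  rw [← map_mul, mul_comm, map_mul]

theorem zG_mul_dG (a b : Pos ι) : zG a * dG b = dG b * zG a :=
  Subtype.ext (by
    change conj (zU a) * conj (dU b) = conj (dU b) * conj (zU a)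
    rw [← map_mul, ← map_mul]
    exact congrArg conj (dgenU_comm _ _))

theorem jU_mul_zU (a : Pos ι) : jU * zU a = zU a * jU :=
  Units.ext (by rw [Units.val_mul, Units.val_mul, jU_coe, zU_smat, smat_mul, smat_mul]; simp)

theorem jG_mul_zG (a : Pos ι) : jG * zG a = zG a * jG :=
  Subtype.ext (by
    change conj jU * conj (zU a) = conj (zU a) * conj jU
    rw [← map_mul, ← map_mul, jU_mul_zU])

theorem jU_mul_dU_comm (a : Pos ι) : jU * dU a = dU a⁻¹ * jU :=
  Units.ext (by
    rw [Units.val_mul, Units.val_mul, jU_coe, dU_smat, dU_smat, smat_mul, smat_mul]; simp)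

theorem jG_mul_dG (a : Pos ι) : jG * dG a = dG a⁻¹ * jG :=
  Subtype.ext (by
    change conj jU * conj (dU a) = conj (dU a⁻¹) * conj jU
    rw [← map_mul, ← map_mul, jU_mul_dU_comm])

theorem jG_mul_jG : (jG : SLtilde ι) * jG = nG :=
  Subtype.ext (by
    change conj jU * conj jU = conj nU
    rw [← map_mul]
    congr 1
    apply Units.ext
    rw [Units.val_mul, jU_coe, nU_coe, smat_mul]; simp)

theorem nG_mul_nG : (nG : SLtilde ι) * nG = 1 :=
  Subtype.ext (by
    change conj nU * conj nU = 1
    rw [← map_mul, nU_mul_nU, map_one])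

theorem nU_mul_zU (a : Pos ι) : nU * zU a = zU a * nU :=
  Units.ext (by rw [Units.val_mul, Units.val_mul, nU_coe, zU_smat, smat_mul, smat_mul]; simp)

theorem nG_mul_zG (a : Pos ι) : nG * zG a = zG a * nG :=
  Subtype.ext (by
    change conj nU * conj (zU a) = conj (zU a) * conj nU
    rw [← map_mul, ← map_mul, nU_mul_zU])

theorem nU_mul_dU (a : Pos ι) : nU * dU a = dU a * nU :=
  Units.ext (by rw [Units.val_mul, Units.val_mul, nU_coe, dU_smat, smat_mul, smat_mul]; simp)

theorem nG_mul_dG (a : Pos ι) : nG * dG a = dG a * nG :=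
  Subtype.ext (by
    change conj nU * conj (dU a) = conj (dU a) * conj nU
    rw [← map_mul, ← map_mul, nU_mul_dU])

theorem nG_mul_jG : (nG : SLtilde ι) * jG = jG * nG := by
  rw [← jG_mul_jG, mul_assoc]

theorem qG_cube (θ : OddPair ι) : qG θ * (qG θ * qG θ) = 1 :=
  Subtype.ext (by
    change conj (qU θ) * (conj (qU θ) * conj (qU θ)) = 1
    rw [← map_mul, ← map_mul, qU_cube, map_one])

/-- Conjugation by `Z_a` rescales the odd parameters of `Q`. -/
theorem qU_mul_zU (θ : OddPair ι) (a : Pos ι) : qU θ * zU a = zU a * qU (θ.scale a) :=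
  Units.ext (by
    rw [Units.val_mul, Units.val_mul, qU_coe, qU_coe, zU_smat, Qmat, Qmat, smat_mul, smat_mul,
      OddPair.cPos_scale]
    simp only [OddPair.scale, OddPair.scale_prod]
    simp only [mul_zero, zero_mul, add_zero, zero_add, mul_neg, neg_mul, neg_zero]
    congr 1
    · exact (a.comm _).symm
    · rw [a.comm, mul_assoc]; exact (a.comm _).symm
    · exact (a.comm _).symm
    · rw [mul_assoc, ← mul_assoc θ.snd, a.comm, a.comm, a.inv_mul_cancel_left_coe]
    · exact ((a * a).comm _).symm
    · rw [a.comm])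

theorem qG_mul_zG (θ : OddPair ι) (a : Pos ι) : qG θ * zG a = zG a * qG (θ.scale a) :=
  Subtype.ext (by
    change conj (qU θ) * conj (zU a) = conj (zU a) * conj (qU (θ.scale a))
    rw [← map_mul, ← map_mul, qU_mul_zU])

theorem psiG_mul_psiG : (psiG : SLtilde ι) * psiG = 1 :=
  Subtype.ext (Equiv.ext Psi_Psi)

theorem conj_zU_smat (a p b q f r c s d : Grassmann ι) (A : Pos ι) :
    conj (zU A) (smat a p b q f r c s d) = smat a ((A⁻¹ : Pos ι) * p) b (A * q) f (A * r) c
      ((A⁻¹ : Pos ι) * s) d := by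
  apply conj_eq
  rw [zU_smat, smat_mul, smat_mul]
  simp only [mul_zero, zero_mul, add_zero, zero_add]
  congr 1
  · rw [A.comm]
  · rw [mul_assoc, A.mul_inv_cancel_left_coe, A.comm]
  · rw [A.comm]
  · rw [← mul_assoc, A.comm, A.comm]
  · rw [← mul_assoc, A.comm, A.comm, mul_assoc]
  · rw [← mul_assoc, A.comm, A.comm]
  · rw [A.comm]
  · rw [mul_assoc, A.mul_inv_cancel_left_coe, A.comm]
  · rw [A.comm]

theorem conj_dU_smat (a p b q f r c s d) (A : Pos ι) :
    conj (dU A) (smat a p b q f r c s d) = smat a (A * p) (A * A * b) ((A⁻¹ : Pos ι) * q) f (A * r)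
      ((A⁻¹ : Pos ι) * (A⁻¹ : Pos ι) * c) ((A⁻¹ : Pos ι) * s) d := by
  apply conj_eq
  rw [dU_smat, smat_mul, smat_mul]
  simp only [mul_zero, zero_mul, add_zero, zero_add, mul_one, one_mul]
  congr 1
  · rw [A.comm]
  · rw [A.comm]
  · rw [mul_assoc, A.inv_mul_cancel_left_coe, A.comm]
  · rw [A.mul_inv_cancel_left_coe]
  · rw [A.inv_mul_cancel_left_coe]
  · rw [mul_assoc, A.mul_inv_cancel_left_coe, A⁻¹.comm]
  · rw [A⁻¹.comm]
  · rw [A⁻¹.comm]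

theorem conj_nU_smat (a p b q f r c s d : Grassmann ι) :
    conj nU (smat a p b q f r c s d) = smat a (-p) b (-q) f (-r) c (-s) d := by
  apply conj_eq
  rw [nU_coe, smat_mul, smat_mul]
  simp

theorem conj_jU_smat (a p b q f r c s d : Grassmann ι) :
    conj jU (smat a p b q f r c s d) = smat d s (-c) r f (-q) (-b) (-p) a := by
  apply conj_eq
  rw [jU_coe, smat_mul, smat_mul]
  simp

theorem psiG_mul_zG (a : Pos ι) : psiG * zG a = zG a⁻¹ * psiG := by
  refine Subtype.ext (Equiv.ext fun X => ?_)
  change Psi (conj (zU a) X) = conj (zU a⁻¹) (Psi X)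
  rw [← smat_entries X, conj_zU_smat, Psi_smat, Psi_smat, conj_zU_smat, inv_inv]
  simp

theorem psiG_mul_dG (a : Pos ι) : psiG * dG a = dG a * psiG := by
  refine Subtype.ext (Equiv.ext fun X => ?_)
  change Psi (conj (dU a) X) = conj (dU a) (Psi X)
  rw [← smat_entries X, conj_dU_smat, Psi_smat, Psi_smat, conj_dU_smat]
  simp

theorem psiG_mul_nG : (psiG : SLtilde ι) * nG = nG * psiG := by
  refine Subtype.ext (Equiv.ext fun X => ?_)
  change Psi (conj nU X) = conj nU (Psi X)
  rw [← smat_entries X, conj_nU_smat, Psi_smat, Psi_smat, conj_nU_smat]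

theorem psiG_mul_jG : (psiG : SLtilde ι) * jG = jG * psiG := by
  refine Subtype.ext (Equiv.ext fun X => ?_)
  change Psi (conj jU X) = conj jU (Psi X)
  rw [← smat_entries X, conj_jU_smat, Psi_smat, Psi_smat, conj_jU_smat]
  simp

end Relations

end

section

variable {ι : Type u}

/-! ### The vertices of the standard triangle -/

/-- The point `(0, 1, 0, 0 | 0, 0, 0, 0)`. -/
def ptA : SMat ι := vec 0 1 0 0 0 0 0 0

/-- The point `(1, 1, 1, θ₁ θ₂ / 2 | θ₁, θ₂, -θ₂, θ₁)`. -/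
def ptB (θ : OddPair ι) : SMat ι :=
  vec 1 1 1 ((1 / 2 : ℝ) • (θ.fst * θ.snd)) θ.fst θ.snd (-θ.snd) θ.fst

/-- The point `(1, 0, 0, 0 | 0, 0, 0, 0)`. -/
def ptC : SMat ι := vec 1 0 0 0 0 0 0 0

theorem ptA_smat : (ptA : SMat ι) = smat 0 0 0 0 0 0 (-1) 0 0 := by
  simp [ptA, vec]

theorem ptC_smat : (ptC : SMat ι) = smat 0 0 1 0 0 0 0 0 0 := by
  simp [ptC, vec]

theorem ptB_smat (θ : OddPair ι) : ptB θ =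
    smat ((1 / 2 : ℝ) • (θ.fst * θ.snd) - 1) θ.fst 1 (-θ.snd) (θ.fst * θ.snd) θ.snd (-1) θ.fst
      ((1 / 2 : ℝ) • (θ.fst * θ.snd) + 1) := by
  rw [ptB, vec]
  congr 1
  rw [two_mul, ← add_smul]; norm_num

theorem smul_coe (g : SLtilde ι) (X : SMat ι) : g • X = (g : Equiv.Perm (SMat ι)) X := rfl

theorem qG_smul_ptA (θ : OddPair ι) : qG θ • ptA = (ptC : SMat ι) := by
  refine conj_eq ?_
  rw [qU_coe, Qmat, ptA_smat, ptC_smat, smat_mul, smat_mul]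
  simp

theorem qG_smul_ptB (θ : OddPair ι) : qG θ • ptB θ = (ptA : SMat ι) := by
  refine conj_eq ?_
  rw [qU_coe, Qmat, ptA_smat, ptB_smat, smat_mul, smat_mul, OddPair.cPos_coe]
  congr 1 <;> simp only [mul_add, add_mul, sub_mul, mul_sub, mul_one, one_mul, mul_zero,
    add_zero, zero_add, smul_mul_assoc, mul_smul_comm, θ.prod_mul_prod, θ.fst_mul_prod,
    θ.snd_mul_prod, θ.prod_mul_fst, θ.prod_mul_snd, θ.snd_mul_fst,
    smul_zero, neg_mul, mul_neg] <;> module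

theorem zG_smul_ptA (a : Pos ι) : zG a • ptA = (ptA : SMat ι) := by
  rw [ptA_smat]
  exact (conj_zU_smat _ _ _ _ _ _ _ _ _ a).trans (by simp)

theorem zG_smul_ptC (a : Pos ι) : zG a • ptC = (ptC : SMat ι) := by
  rw [ptC_smat]
  exact (conj_zU_smat _ _ _ _ _ _ _ _ _ a).trans (by simp)

theorem zG_smul_ptB (a : Pos ι) (θ : OddPair ι) :
    zG a • ptB θ = (ptB (θ.scale a⁻¹) : SMat ι) := by
  rw [ptB_smat, ptB_smat]
  refine (conj_zU_smat _ _ _ _ _ _ _ _ _ a).trans ?_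
  have h := OddPair.scale_prod a⁻¹ θ
  simp only [OddPair.scale, inv_inv, mul_neg] at h ⊢
  rw [h]

theorem nG_smul_ptA : (nG : SLtilde ι) • ptA = (ptA : SMat ι) := by
  rw [ptA_smat]
  exact (conj_nU_smat _ _ _ _ _ _ _ _ _).trans (by simp)

theorem nG_smul_ptC : (nG : SLtilde ι) • ptC = (ptC : SMat ι) := by
  rw [ptC_smat]
  exact (conj_nU_smat _ _ _ _ _ _ _ _ _).trans (by simp)

theorem nG_smul_ptB (θ : OddPair ι) : (nG : SLtilde ι) • ptB θ = (ptB θ.neg : SMat ι) := by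
  rw [ptB_smat, ptB_smat]
  exact (conj_nU_smat _ _ _ _ _ _ _ _ _).trans (by simp [OddPair.neg])

theorem psiG_smul_ptA : (psiG : SLtilde ι) • ptA = (ptA : SMat ι) := by
  rw [ptA_smat]
  exact (Psi_smat _ _ _ _ _ _ _ _ _).trans (by simp)

theorem psiG_smul_ptC : (psiG : SLtilde ι) • ptC = (ptC : SMat ι) := by
  rw [ptC_smat]
  exact (Psi_smat _ _ _ _ _ _ _ _ _).trans (by simp)

theorem psiG_smul_ptB (θ : OddPair ι) : (psiG : SLtilde ι) • ptB θ = (ptB θ.swap : SMat ι) := by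
  rw [ptB_smat, ptB_smat]
  refine (Psi_smat _ _ _ _ _ _ _ _ _).trans ?_
  simp only [OddPair.swap, θ.snd_mul_fst]
  congr 1 <;> module

theorem jG_smul_ptC : (jG : SLtilde ι) • ptC = (ptA : SMat ι) := by
  rw [ptA_smat, ptC_smat]
  exact (conj_jU_smat _ _ _ _ _ _ _ _ _).trans (by simp)

theorem dG_smul_ptC (a : Pos ι) :
    dG a • ptC = op ((a * a : Pos ι) : Grassmann ι) • (ptC : SMat ι) := by
  rw [ptC_smat, smat_smul]
  exact (conj_dU_smat _ _ _ _ _ _ _ _ _ a).trans (by simp)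

theorem smul_op_smul (g : SLtilde ι) (t : Pos ι) (X : SMat ι) :
    g • op (t : Grassmann ι) • X = op (t : Grassmann ι) • g • X :=
  (SLtilde_spec g.2).2.2 t t.isEven X

theorem pairing_smul (g : SLtilde ι) {X Y : SMat ι} (hX : IsEvenMat X) (hY : IsEvenMat Y) :
    pairing (g • X) (g • Y) = pairing X Y :=
  (SLtilde_spec g.2).2.1 X Y hX hY

theorem isEvenMat_ptC : IsEvenMat (ptC : SMat ι) := by
  rw [ptC_smat]
  exact isEvenMat_smat IsEven.zero IsOdd.zero IsEven.one IsOdd.zero IsEven.zero IsOdd.zero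
    IsEven.zero IsOdd.zero IsEven.zero

theorem isEvenMat_of_mem_lightCone {X : SMat ι} (hX : X ∈ LightCone ι) : IsEvenMat X := by
  obtain ⟨φ, hφ, rfl⟩ := hX
  exact ((SLtilde_spec hφ).1 _).mpr isEvenMat_ptC

theorem smul_mem_lightCone (g : SLtilde ι) {X : SMat ι} (hX : X ∈ LightCone ι) :
    g • X ∈ LightCone ι := by
  obtain ⟨φ, hφ, rfl⟩ := hX
  exact ⟨g * φ, mul_mem g.2 hφ, rfl⟩

theorem op_smul_ptC_mem_lightCone (s : Pos ι) :
    op (s : Grassmann ι) • (ptC : SMat ι) ∈ LightCone ι := by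
  refine ⟨dG s.sqrt, (dG s.sqrt).2, ?_⟩
  have := dG_smul_ptC s.sqrt
  rw [s.sqrt_mul_sqrt] at this
  exact this.symm

theorem op_smul_op_smul (s t : Pos ι) (X : SMat ι) :
    op (s : Grassmann ι) • op (t : Grassmann ι) • X = op ((s * t : Pos ι) : Grassmann ι) • X := by
  rw [smul_smul, ← op_mul, Pos.coe_mul, s.comm]

theorem pairing_ptA_ptC (r s : Pos ι) :
    pairing (op (r : Grassmann ι) • ptA) (op (s : Grassmann ι) • ptC) =
      (1 / 2 : ℝ) • ((r * s : Pos ι) : Grassmann ι) := by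
  rw [pairing, ptA_smat, ptC_smat, smat_smul, smat_smul, smat_mul, str_smat]
  simp [s.comm]

end

section

/-! ### Frames of a lift -/

variable {ι : Type u} {H : Type v}

namespace Coord

variable {T : Triangulation H} {ωσ ωι : EdgeOrientation T} (c : Coord ι T ωσ ωι)

/-- The `λ`-lengths, as positive even elements. -/
def lamPos (x : H) : Pos ι := ⟨c.lam x, c.lam_pos x⟩

/-- The ratios, as positive even elements. -/
def ratioPos (x : H) : Pos ι := ⟨c.ratio x, c.ratio_pos x⟩

/-- The ordered pair of odd coordinates of the triangle with side `x`. -/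
def oddPair (x : H) : OddPair ι := ⟨c.odd₁ x, c.odd₂ x, c.odd₁_isOdd x, c.odd₂_isOdd x⟩

/-- The cross-ratio, as a positive even element. -/
def crossPos (x : H) : Pos ι :=
  (c.lamPos (T.rot x) * c.lamPos (T.rot (T.opp x))) *
    (c.lamPos (T.rot (T.rot x)) * c.lamPos (T.rot (T.rot (T.opp x))))⁻¹

/-- The multiple of `(1, 0, 0, 0 | 0, 0, 0, 0)` to which the starting point of the side `x` is moved
when the triangle of `x` is brought to standard position. -/
def vertexScale (x : H) : Pos ι :=
  Pos.two.sqrt * c.lamPos x * c.lamPos (T.rot (T.rot x)) * (c.lamPos (T.rot x))⁻¹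

theorem lamPos_opp (x : H) : c.lamPos (T.opp x) = c.lamPos x := Pos.ext (c.lam_opp x)

theorem oddPair_rot (x : H) : c.oddPair (T.rot x) = c.oddPair x :=
  OddPair.ext (c.odd₁_rot x) (c.odd₂_rot x)

theorem ratioPos_opp_of_eq {x : H} (h : ωσ.toward x = ωι.toward x) :
    c.ratioPos (T.opp x) = (c.ratioPos x)⁻¹ :=
  Pos.ext ((c.ratio_opp x).trans (if_pos h))

theorem ratioPos_opp_of_ne {x : H} (h : ωσ.toward x ≠ ωι.toward x) :
    c.ratioPos (T.opp x) = c.ratioPos x :=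
  Pos.ext ((c.ratio_opp x).trans (if_neg h))

theorem crossPos_opp (x : H) : c.crossPos (T.opp x) = c.crossPos x := by
  rw [crossPos, crossPos, T.opp_opp, mul_comm (c.lamPos (T.rot (T.opp x))),
    mul_comm (c.lamPos (T.rot (T.rot (T.opp x))))]

theorem vertexScale_mul_rot (x : H) :
    c.vertexScale x * c.vertexScale (T.rot x) = Pos.two * (c.lamPos x * c.lamPos x) := by
  rw [← (Pos.two : Pos ι).sqrt_mul_sqrt, vertexScale, vertexScale, T.rot_rot_rot]
  generalize c.lamPos x = a
  generalize c.lamPos (T.rot x) = b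
  generalize c.lamPos (T.rot (T.rot x)) = d
  generalize (Pos.two : Pos ι).sqrt = t
  calc t * a * d * b⁻¹ * (t * b * a * d⁻¹) = t * t * (a * a) * (b⁻¹ * b) * (d * d⁻¹) := by
        simp only [mul_comm, mul_left_comm, mul_assoc]
    _ = _ := by rw [inv_mul_cancel, mul_inv_cancel, mul_one, mul_one]

theorem vertexScale_rot_opp (x : H) :
    c.vertexScale (T.rot (T.opp x)) = c.crossPos x * c.vertexScale x := by
  rw [vertexScale, vertexScale, crossPos, T.rot_rot_rot, lamPos_opp]
  generalize c.lamPos x = a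
  generalize c.lamPos (T.rot x) = b
  generalize c.lamPos (T.rot (T.rot x)) = d
  generalize c.lamPos (T.rot (T.opp x)) = f
  generalize c.lamPos (T.rot (T.rot (T.opp x))) = g
  generalize (Pos.two : Pos ι).sqrt = t
  calc t * f * a * g⁻¹ = t * f * a * g⁻¹ * (b * b⁻¹) * (d * d⁻¹) := by
        rw [mul_inv_cancel, mul_inv_cancel, mul_one, mul_one]
    _ = _ := by
        rw [mul_inv]
        simp only [mul_comm, mul_left_comm, mul_assoc]

/-- The sign change and the involution which follow `Υ` when the side `x` is crossed. -/
def crossSign (x : H) : SLtilde ι :=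
  (if ωσ.toward x = true then 1 else nG) * (if ωσ.toward x = ωι.toward x then 1 else psiG)

/-- The transformation between the normalised frames at the two sides of the edge `x`. -/
def crossElt (x : H) : SLtilde ι :=
  crossSign (ωσ := ωσ) (ωι := ωι) x * (jG * dG (c.crossPos x).sqrt) * (zG (c.ratioPos x))⁻¹

end Coord

section

variable {T : Triangulation H} {ωσ ωι : EdgeOrientation T} (c : Coord ι T ωσ ωι)

namespace Coord

theorem crossSign_smul_ptA (x : H) :
    (crossSign (ωσ := ωσ) (ωι := ωι) x : SLtilde ι) • (ptA : SMat ι) = ptA := by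
  rw [crossSign, mul_smul]
  split_ifs <;> simp only [one_smul, nG_smul_ptA, psiG_smul_ptA]

theorem crossSign_smul_ptC (x : H) :
    (crossSign (ωσ := ωσ) (ωι := ωι) x : SLtilde ι) • (ptC : SMat ι) = ptC := by
  rw [crossSign, mul_smul]
  split_ifs <;> simp only [one_smul, nG_smul_ptC, psiG_smul_ptC]

theorem zG_mul_crossSign (x : H) : zG (c.ratioPos (T.opp x)) * crossSign (ωσ := ωσ) (ωι := ωι) x =
    crossSign (ωσ := ωσ) (ωι := ωι) x * (zG (c.ratioPos x))⁻¹ := by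
  have h1 : zG (c.ratioPos (T.opp x)) *
      (if ωσ.toward x = ωι.toward x then 1 else psiG) =
      (if ωσ.toward x = ωι.toward x then 1 else psiG) * (zG (c.ratioPos x))⁻¹ := by
    split_ifs with h
    · rw [c.ratioPos_opp_of_eq h, mul_one, one_mul, map_inv]
    · rw [c.ratioPos_opp_of_ne h, ← map_inv, psiG_mul_zG, inv_inv]
  have h2 : zG (c.ratioPos (T.opp x)) * (if ωσ.toward x = true then 1 else nG) =
      (if ωσ.toward x = true then 1 else nG) * zG (c.ratioPos (T.opp x)) := by
    split_ifs
    · rw [mul_one, one_mul]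
    · rw [nG_mul_zG]
  rw [crossSign, ← mul_assoc, h2, mul_assoc, h1, mul_assoc]

theorem jG_dG_mul_zG (q a : Pos ι) : jG * dG q * zG a = zG a * (jG * dG q) := by
  rw [mul_assoc, ← zG_mul_dG, ← mul_assoc, jG_mul_zG, mul_assoc]

theorem zG_mul_crossSign_mul (x : H) :
    zG (c.ratioPos (T.opp x)) *
      (crossSign (ωσ := ωσ) (ωι := ωι) x * (jG * dG (c.crossPos x).sqrt)) = c.crossElt x := by
  rw [← mul_assoc, zG_mul_crossSign, crossElt, mul_assoc, mul_assoc, ← map_inv, jG_dG_mul_zG]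

theorem crossSign_mul_jG_mul_dG (x : H) (q : Pos ι) :
    crossSign (ωσ := ωσ) (ωι := ωι) x * (jG * dG q) =
      jG * dG q * crossSign (ωσ := ωσ) (ωι := ωι) x := by
  have h1 : (if ωσ.toward x = ωι.toward x then 1 else psiG) * (jG * dG q) =
      jG * dG q * (if ωσ.toward x = ωι.toward x then 1 else psiG) := by
    split_ifs
    · rw [mul_one, one_mul]
    · rw [← mul_assoc, psiG_mul_jG, mul_assoc, psiG_mul_dG, mul_assoc]
  have h2 : (if ωσ.toward x = true then 1 else nG) * (jG * dG q) =
      jG * dG q * (if ωσ.toward x = true then 1 else nG) := by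
    split_ifs
    · rw [mul_one, one_mul]
    · rw [← mul_assoc, nG_mul_jG, mul_assoc, nG_mul_dG, mul_assoc]
  rw [crossSign, mul_assoc, h1, ← mul_assoc, h2, mul_assoc]

theorem crossSign_opp_mul (x : H) : crossSign (ωσ := ωσ) (ωι := ωι) (T.opp x) *
    crossSign (ωσ := ωσ) (ωι := ωι) x = (nG : SLtilde ι) := by
  have e : (ωσ.toward (T.opp x) = ωι.toward (T.opp x)) = (ωσ.toward x = ωι.toward x) := by
    rw [ωσ.toward_opp, ωι.toward_opp]; simp
  have h1 : (if ωσ.toward x = ωι.toward x then 1 else psiG) *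
      (if ωσ.toward x = ωι.toward x then 1 else psiG) = (1 : SLtilde ι) := by
    split_ifs
    · exact one_mul 1
    · exact psiG_mul_psiG
  have h2 : (if ωσ.toward x = ωι.toward x then 1 else psiG) * nG =
      nG * (if ωσ.toward x = ωι.toward x then 1 else (psiG : SLtilde ι)) := by
    split_ifs
    · rw [one_mul, mul_one]
    · exact psiG_mul_nG
  simp only [crossSign, e]
  rw [ωσ.toward_opp]
  generalize (if ωσ.toward x = ωι.toward x then 1 else (psiG : SLtilde ι)) = p at h1 h2
  cases ωσ.toward x
  · simp only [Bool.not_false, if_true, Bool.false_eq_true, if_false]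
    rw [one_mul, ← mul_assoc, h2, mul_assoc, h1, mul_one]
  · simp only [Bool.not_true, if_true, Bool.false_eq_true, if_false]
    rw [one_mul, mul_assoc, h1, mul_one]

theorem jG_mul_dG_mul_jG_mul_dG (q : Pos ι) : jG * dG q * (jG * dG q) = (nG : SLtilde ι) := by
  rw [jG_mul_dG, mul_assoc, ← jG_mul_dG, ← mul_assoc jG jG, jG_mul_jG, nG_mul_dG, ← mul_assoc,
    ← map_mul, inv_mul_cancel, map_one, one_mul]

/-- Crossing an edge and coming back is the identity: `J² = Z_{-1}`, and the edge points toward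
exactly one of its two sides, which contributes a second factor `Z_{-1}`. -/
theorem crossElt_opp_mul (x : H) : c.crossElt (T.opp x) * c.crossElt x = 1 := by
  have h := jG_mul_dG_mul_jG_mul_dG (c.crossPos x).sqrt
  have hs := crossSign_mul_jG_mul_dG (ι := ι) (ωσ := ωσ) (ωι := ωι) (T.opp x) (c.crossPos x).sqrt
  have ho := crossSign_opp_mul (ι := ι) (ωσ := ωσ) (ωι := ωι) x
  rw [← zG_mul_crossSign_mul, crossElt, c.crossPos_opp, T.opp_opp, hs]
  generalize jG * dG (c.crossPos x).sqrt = u at h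
  generalize crossSign (ωσ := ωσ) (ωι := ωι) (T.opp x) = k at ho
  calc _ = zG (c.ratioPos x) * (u * (k * crossSign x) * u) * (zG (c.ratioPos x))⁻¹ := by
        simp only [mul_assoc]
        rfl
    _ = 1 := by
        rw [ho, ← h, ← mul_assoc u u u, mul_assoc (u * u), h, nG_mul_nG, mul_one, mul_inv_cancel]

theorem crossElt_smul_ptC (x : H) :
    c.crossElt x • (ptC : SMat ι) = op (c.crossPos x : Grassmann ι) • ptA := by
  rw [crossElt, mul_smul, mul_smul, mul_smul, ← map_inv, zG_smul_ptC, dG_smul_ptC,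
    Pos.sqrt_mul_sqrt, smul_op_smul, smul_op_smul, jG_smul_ptC, crossSign_smul_ptA]

/-- A family of elements of the group, one for every side of a triangulation, which are related by
the transformations prescribed by the coordinates. -/
structure IsFrame {K : Type} (U : Triangulation K) (π : K → H) (G : K → SLtilde ι) : Prop where
  rot : ∀ x, G (U.rot x) = qG (c.oddPair (π x)) * G x
  opp : ∀ x, G (U.opp x) = c.crossElt (π x) * G x

/-- The frame `G` moves the vertex `P` at which the side `x` starts to its normal position. -/
def IsPlaced (x : H) (G : SLtilde ι) (P : SMat ι) : Prop :=
  G • P = op (c.vertexScale x : Grassmann ι) • ptC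

variable {c}

theorem isPlaced_rot_opp_iff {x : H} {G : SLtilde ι} {P : SMat ι} :
    c.IsPlaced (T.rot (T.opp x)) (qG (c.oddPair (T.opp x)) * (c.crossElt x * G)) P ↔
      c.IsPlaced x G P := by
  have h : qG (c.oddPair (T.opp x)) • c.crossElt x • op (c.vertexScale x : Grassmann ι) •
      (ptC : SMat ι) = op (c.vertexScale (T.rot (T.opp x)) : Grassmann ι) • ptC := by
    rw [smul_op_smul, crossElt_smul_ptC, smul_op_smul, smul_op_smul, qG_smul_ptA,
      op_smul_op_smul, mul_comm, vertexScale_rot_opp]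
  rw [IsPlaced, IsPlaced, ← h, mul_smul, mul_smul, smul_left_cancel_iff, smul_left_cancel_iff]

/-- The vertices of the triangle of `x`, in the frame of `x`. -/
theorem IsFrame.smul_rot {K : Type} {U : Triangulation K} {π : K → H} {G : K → SLtilde ι}
    (hG : c.IsFrame U π G) (x : K) {P : SMat ι} {s : Pos ι}
    (hP : G (U.rot x) • P = op (s : Grassmann ι) • ptC) :
    G x • P = op (s : Grassmann ι) • ptA := by
  rw [hG.rot, mul_smul, ← qG_smul_ptA (c.oddPair (π x)), ← smul_op_smul,
    smul_left_cancel_iff] at hP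
  exact hP

theorem IsFrame.smul_rot_rot {K : Type} {U : Triangulation K} {π : K → H} {G : K → SLtilde ι}
    (hG : c.IsFrame U π G) (x : K) {P : SMat ι} {s : Pos ι}
    (hP : G (U.rot (U.rot x)) • P = op (s : Grassmann ι) • ptC) :
    G x • P = op (s : Grassmann ι) • ptB (c.oddPair (π x)) := by
  have h := hG.smul_rot _ hP
  rw [hG.rot, mul_smul, ← qG_smul_ptB (c.oddPair (π x)), ← smul_op_smul,
    smul_left_cancel_iff] at h
  exact h

end Coord
end

end

section

variable {ι : Type u} {H : Type v}

namespace Coord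

/-! ### Lifts and frames -/

variable {T : Triangulation H} {ωσ ωι : EdgeOrientation T} (c : Coord ι T ωσ ωι)

theorem ad_Pgen (θ : OddPair ι) (h k : Pos ι) (X : SMat ι) :
    ad (Pgen θ.fst θ.snd h k) X = ((zG k)⁻¹ * qG θ * zG h) • X := by
  have e : Pgen θ.fst θ.snd (h : Grassmann ι) k =
      ((zU k⁻¹ * qU θ * zU h : (SMat ι)ˣ) : SMat ι) := by
    have h1 : Zmat (cc θ.fst θ.snd) * Zmat ((k⁻¹ : Pos ι) : Grassmann ι) =
        Zmat ((k⁻¹ : Pos ι) : Grassmann ι) * Zmat (cc θ.fst θ.snd) := by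
      have := congrArg Units.val (dgenU_comm (ι := ι) (θ.cPos, θ.cPos) (k⁻¹, k⁻¹))
      exact this
    rw [Pgen, ← Pos.coe_inv, h1, mul_assoc (Zmat _) (Zmat _), Zmat_mul_Pprime]
    rfl
  rw [e, ad_coe, map_mul, map_mul, map_inv]
  rfl

theorem ad_Upsilon (x : H) (X : SMat ι) :
    ad (Upsilon (c.crossRatio x) (c.ratio x)) X =
      (jG * dG (c.crossPos x).sqrt * zG (c.ratioPos x)) • X := by
  have e : Upsilon (c.crossRatio x) (c.ratio x) =
      ((jU * dU (c.crossPos x).sqrt * zU (c.ratioPos x) : (SMat ι)ˣ) : SMat ι) := rfl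
  rw [e, ad_coe, map_mul, map_mul]
  rfl

theorem crossing_eq (x : H) (X : SMat ι) : c.crossing x X =
    (crossSign (ωσ := ωσ) (ωι := ωι) x *
      (jG * dG (c.crossPos x).sqrt * zG (c.ratioPos x))) • X := by
  have hn : ∀ Y : SMat ι, ad (Zmat (-1)) Y = (nG : SLtilde ι) • Y := fun Y => ad_coe nU Y
  have hp : ∀ Y : SMat ι, Psi Y = (psiG : SLtilde ι) • Y := fun Y => rfl
  simp only [crossing, ad_Upsilon, hn, hp, crossSign, mul_smul]
  split_ifs <;> simp only [one_smul]

/-- The odd coordinates across the side `x` as a pair, see `across₁`. -/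
def acrossPair (x : H) : OddPair ι :=
  let p := if ωσ.toward x = ωι.toward x then c.oddPair (T.opp x) else (c.oddPair (T.opp x)).swap
  if ωσ.toward x = true then p else p.neg

theorem acrossPair_scale_fst (x : H) :
    ((c.acrossPair x).scale (c.ratioPos x)⁻¹).fst = (c.ratio x)⁻¹ʳ * c.across₁ x := by
  simp only [acrossPair, across₁, OddPair.scale, OddPair.neg, OddPair.swap]
  split_ifs <;> simp [oddPair] <;> rfl

theorem acrossPair_scale_snd (x : H) :
    ((c.acrossPair x).scale (c.ratioPos x)⁻¹).snd = c.ratio x * c.across₂ x := by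
  simp only [acrossPair, across₂, OddPair.scale, OddPair.neg, OddPair.swap, inv_inv]
  split_ifs <;> simp [oddPair, ratioPos]

theorem crossSign_smul_ptB (x : H) :
    (crossSign (ωσ := ωσ) (ωι := ωι) x : SLtilde ι) •
        ptB ((c.acrossPair x).scale (c.ratioPos x)⁻¹) =
      ptB ((c.oddPair (T.opp x)).scale (c.ratioPos (T.opp x))) := by
  have hn : ∀ θ : OddPair ι, (nG : SLtilde ι) • ptB θ.neg = ptB θ := fun θ => by
    rw [nG_smul_ptB]; simp [OddPair.neg]
  have hp : ∀ θ : OddPair ι, (psiG : SLtilde ι) • ptB θ.swap = ptB θ := fun θ => by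
    rw [psiG_smul_ptB]; rfl
  have hc : ∀ (θ : OddPair ι) a, θ.neg.scale a = (θ.scale a).neg := fun θ a => by
    simp [OddPair.neg, OddPair.scale]
  have hs : ∀ (θ : OddPair ι) a, θ.swap.scale a⁻¹ = (θ.scale a).swap := fun θ a => by
    simp [OddPair.swap, OddPair.scale]
  have hm : ∀ X : SMat ι, (nG : SLtilde ι) • (psiG : SLtilde ι) •
      X = (psiG : SLtilde ι) • (nG : SLtilde ι) • X := fun X => by
    rw [← mul_smul, ← mul_smul, psiG_mul_nG]
  simp only [crossSign, acrossPair]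
  by_cases h : ωσ.toward x = ωι.toward x
  · rw [c.ratioPos_opp_of_eq h, if_pos h, if_pos h, mul_one]
    split_ifs
    · rw [one_smul]
    · rw [hc, hn]
  · rw [c.ratioPos_opp_of_ne h, if_neg h, if_neg h, mul_smul]
    split_ifs
    · rw [one_smul, hs, hp]
    · rw [hc, hs, hm, hn, hp]

/-- The condition on `ℓ` to be a lift, in terms of the normalised frames `Z_h g`. -/
def IsFramed {K : Type} (U : Triangulation K) (π : K → H) (ℓ : U.IdealPoint → LightCone ι) : Prop :=
  ∃ G : K → SLtilde ι, c.IsFrame U π G ∧ ∀ x, c.IsPlaced (π x) (G x) (ℓ (U.start x))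

variable {c} {K : Type} {U : Triangulation K} {π : K → H} {ℓ : U.IdealPoint → LightCone ι}

/-- The frames of a lift place its vertices up to positive factors, and the `λ`-lengths determine
these factors. -/
theorem IsLift.isFramed (hrot : ∀ x, π (U.rot x) = T.rot (π x))
    (hopp : ∀ x, π (U.opp x) = T.opp (π x)) (hℓ : IsLift U π c ℓ) : c.IsFramed U π ℓ := by
  obtain ⟨g, hg⟩ := hℓ
  have hF : c.IsFrame U π (fun x => zG (c.ratioPos (π x)) * g x) := by
    constructor
    · intro x
      have h : g (U.rot x) = (zG (c.ratioPos (T.rot (π x))))⁻¹ * qG (c.oddPair (π x)) *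
          zG (c.ratioPos (π x)) * g x :=
        Subtype.ext (Equiv.ext fun X => ((hg x).2.2.1 X).trans
          (ad_Pgen (c.oddPair (π x)) (c.ratioPos (π x)) (c.ratioPos (T.rot (π x))) _))
      simp only [hrot, h]
      group
    · intro x
      have h : g (U.opp x) = crossSign (ωσ := ωσ) (ωι := ωι) (π x) *
          (jG * dG (c.crossPos (π x)).sqrt * zG (c.ratioPos (π x))) * g x :=
        Subtype.ext (Equiv.ext fun X => ((hg x).2.2.2 X).trans (c.crossing_eq _ _))
      simp only [hopp, h, ← zG_mul_crossSign_mul, mul_assoc]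
  refine ⟨_, hF, ?_⟩
  -- the frame places the vertices up to positive factors
  have hs : ∀ x, ∃ s : Pos ι, (zG (c.ratioPos (π x)) * g x) • (ℓ (U.start x) : SMat ι) =
      op (s : Grassmann ι) • ptC := by
    intro x
    obtain ⟨r, s, t, -, hs, -, -, -, h⟩ := (hg x).2.1.1
    obtain ⟨s, rfl⟩ : ∃ s' : Pos ι, s = s' := ⟨⟨s, hs⟩, rfl⟩
    refine ⟨s, ?_⟩
    rw [mul_smul, smul_coe (g x), h]
    exact (smul_op_smul _ s ptC).trans (by rw [zG_smul_ptC])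
  choose s hs using hs
  have hp : ∀ x, s (U.rot x) * s x = Pos.two * (c.lamPos (π x) * c.lamPos (π x)) := by
    intro x
    have h1 := hF.smul_rot x (hs (U.rot x))
    have h2 := (hg x).1
    rw [← pairing_smul (zG (c.ratioPos (π x)) * g x)
      (isEvenMat_of_mem_lightCone (ℓ (U.start (U.rot x))).2)
      (isEvenMat_of_mem_lightCone (ℓ (U.start x)).2), h1, hs, pairing_ptA_ptC] at h2
    apply Pos.ext
    have h3 : ((s (U.rot x) * s x : Pos ι) : Grassmann ι) = (2 : ℝ) • c.lam (π x) ^ 2 := by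
      rw [← h2, smul_smul]; norm_num
    rw [h3, Pos.coe_mul, Algebra.smul_def, pow_two]
    rfl
  intro x
  -- `s x ^ 2` is determined by the three products of pairs
  have hx : s x = c.vertexScale (π x) := by
    apply Pos.eq_of_mul_self_eq
    have h1 := hp x
    have h2 := hp (U.rot x)
    have h3 := hp (U.rot (U.rot x))
    rw [U.rot_rot_rot] at h3
    rw [hrot] at h2
    rw [hrot, hrot] at h3
    rw [vertexScale]
    have e : s x * s x = (s (U.rot x) * s x) * (s x * s (U.rot (U.rot x))) *
        (s (U.rot (U.rot x)) * s (U.rot x))⁻¹ := by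
      rw [eq_mul_inv_iff_mul_eq]
      simp only [mul_comm, mul_left_comm, mul_assoc]
    rw [e, h1, h2, h3]
    conv_lhs => rw [← (Pos.two : Pos ι).sqrt_mul_sqrt]
    generalize c.lamPos (π x) = a
    generalize c.lamPos (T.rot (π x)) = b
    generalize c.lamPos (T.rot (T.rot (π x))) = d
    generalize (Pos.two : Pos ι).sqrt = t
    rw [mul_inv_eq_iff_eq_mul]
    calc t * t * (a * a) * (t * t * (d * d)) =
        t * t * (a * a) * (t * t * (d * d)) * (b⁻¹ * b) * (b⁻¹ * b) := by
          rw [inv_mul_cancel, mul_one, mul_one]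
      _ = _ := by simp only [mul_comm, mul_left_comm, mul_assoc]
  rw [IsPlaced, hs, hx]

/-- Conversely, all three vertices of a triangle are placed by its frames, as `Q_θ` rotates the
standard triangle. -/
theorem IsFramed.isLift (hrot : ∀ x, π (U.rot x) = T.rot (π x))
    (hopp : ∀ x, π (U.opp x) = T.opp (π x)) (hℓ : c.IsFramed U π ℓ) : IsLift U π c ℓ := by
  obtain ⟨G, hF, hG⟩ := hℓ
  have hA : ∀ x, G x • (ℓ (U.start (U.rot x)) : SMat ι) =
      op (c.vertexScale (T.rot (π x)) : Grassmann ι) • ptA := fun x =>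
    hF.smul_rot x (by rw [← hrot]; exact hG (U.rot x))
  have hB : ∀ x, G x • (ℓ (U.start (U.rot (U.rot x))) : SMat ι) =
      op (c.vertexScale (T.rot (T.rot (π x))) : Grassmann ι) • ptB (c.oddPair (π x)) := fun x =>
    hF.smul_rot_rot x (by rw [← hrot, ← hrot]; exact hG (U.rot (U.rot x)))
  have hg : ∀ x, (zG (c.ratioPos (π (U.opp x))))⁻¹ * G (U.opp x) =
      crossSign (ωσ := ωσ) (ωι := ωι) (π x) * (jG * dG (c.crossPos (π x)).sqrt *
        zG (c.ratioPos (π x))) * ((zG (c.ratioPos (π x)))⁻¹ * G x) := by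
    intro x
    rw [hF.opp, hopp, ← zG_mul_crossSign_mul]
    group
  have hr : ∀ x, (zG (c.ratioPos (π (U.rot x))))⁻¹ * G (U.rot x) =
      (zG (c.ratioPos (T.rot (π x))))⁻¹ * qG (c.oddPair (π x)) * zG (c.ratioPos (π x)) *
        ((zG (c.ratioPos (π x)))⁻¹ * G x) := by
    intro x
    rw [hF.rot, hrot]
    group
  have hz : ∀ a : Pos ι, (zG a)⁻¹ = zG a⁻¹ := fun a => (map_inv zG a).symm
  -- the vertices of the triangle of `x` in the frame `g x`
  have gA : ∀ x, ((zG (c.ratioPos (π x)))⁻¹ * G x) • (ℓ (U.start (U.rot x)) : SMat ι) =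
      op (c.vertexScale (T.rot (π x)) : Grassmann ι) • ptA := fun x => by
    rw [mul_smul, hA, hz, smul_op_smul, zG_smul_ptA]
  have gB : ∀ x, ((zG (c.ratioPos (π x)))⁻¹ * G x) • (ℓ (U.start (U.rot (U.rot x))) : SMat ι) =
      op (c.vertexScale (T.rot (T.rot (π x))) : Grassmann ι) •
        ptB ((c.oddPair (π x)).scale (c.ratioPos (π x))) := fun x => by
    rw [mul_smul, hB, hz, smul_op_smul, zG_smul_ptB, inv_inv]
  have gC : ∀ x, ((zG (c.ratioPos (π x)))⁻¹ * G x) • (ℓ (U.start x) : SMat ι) =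
      op (c.vertexScale (π x) : Grassmann ι) • ptC := fun x => by
    rw [mul_smul, hG x, hz, smul_op_smul, zG_smul_ptC]
  refine ⟨fun x => (zG (c.ratioPos (π x)))⁻¹ * G x, fun x => ⟨?_, ⟨?_, ?_⟩, fun X => ?_,
    fun X => ?_⟩⟩
  · rw [← pairing_smul (G x) (isEvenMat_of_mem_lightCone (ℓ (U.start (U.rot x))).2)
      (isEvenMat_of_mem_lightCone (ℓ (U.start x)).2), hA, hG x, pairing_ptA_ptC, mul_comm,
      vertexScale_mul_rot, Pos.coe_mul, Pos.coe_mul, pow_two]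
    change (1 / 2 : ℝ) • (algebraMap ℝ _ 2 * (c.lam (π x) * c.lam (π x))) = _
    rw [← Algebra.smul_def, smul_smul]
    norm_num
  · exact ⟨_, _, _, (c.vertexScale (T.rot (π x))).2, (c.vertexScale (π x)).2,
      (c.vertexScale (T.rot (T.rot (π x)))).2, gA x, gB x, gC x⟩
  · -- `Υ g x` differs from `g (opp x)` by the sign change and the involution only
    have hU : ∀ X : SMat ι, ad (Upsilon (c.crossRatio (π x)) (c.ratio (π x)))
        (((zG (c.ratioPos (π x)))⁻¹ * G x) • X) =
        (crossSign (ωσ := ωσ) (ωι := ωι) (π x) : SLtilde ι)⁻¹ •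
          ((zG (c.ratioPos (π (U.opp x))))⁻¹ * G (U.opp x)) • X := by
      intro X
      rw [ad_Upsilon, hg, eq_inv_smul_iff, smul_smul, smul_smul, mul_assoc]
    have kA : (crossSign (ωσ := ωσ) (ωι := ωι) (π x) : SLtilde ι)⁻¹ • ptA = (ptA : SMat ι) := by
      rw [inv_smul_eq_iff, crossSign_smul_ptA]
    have kC : (crossSign (ωσ := ωσ) (ωι := ωι) (π x) : SLtilde ι)⁻¹ • ptC = (ptC : SMat ι) := by
      rw [inv_smul_eq_iff, crossSign_smul_ptC]
    have e1 : U.start x = U.start (U.rot (U.opp x)) := (U.start_rot_opp x).symm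
    have e2 : U.start (U.rot x) = U.start (U.opp x) := by
      rw [← U.start_rot_opp (U.opp x), U.opp_opp]
    refine ⟨_, _, _, (c.vertexScale (T.rot (π (U.opp x)))).2, (c.vertexScale (π (U.opp x))).2,
      (c.vertexScale (T.rot (T.rot (π (U.opp x))))).2, ?_, ?_, ?_⟩
    · rw [e1]
      exact (hU _).trans (by rw [gA, smul_op_smul, kA]; rfl)
    · refine (hU _).trans ?_
      rw [gB, smul_op_smul]
      congr 1
      rw [inv_smul_eq_iff, hopp, ← c.crossSign_smul_ptB, ptB, c.acrossPair_scale_fst,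
        c.acrossPair_scale_snd]
    · rw [e2]
      exact (hU _).trans (by rw [gC, smul_op_smul, kC]; rfl)
  · exact (congrArg (· • X) (hr x)).trans ((mul_smul _ _ _).trans
      (ad_Pgen (c.oddPair (π x)) (c.ratioPos (π x)) (c.ratioPos (T.rot (π x))) _).symm)
  · exact (congrArg (· • X) (hg x)).trans ((mul_smul _ _ _).trans (c.crossing_eq _ _).symm)

/-- The vertices of a lift are determined by the normalised frames, with the scalars fixed by the
`λ`-lengths. -/
theorem isLift_iff_isFramed (hrot : ∀ x, π (U.rot x) = T.rot (π x))
    (hopp : ∀ x, π (U.opp x) = T.opp (π x)) : IsLift U π c ℓ ↔ c.IsFramed U π ℓ :=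
  ⟨IsLift.isFramed hrot hopp, IsFramed.isLift hrot hopp⟩

end Coord

end

section

variable {ι : Type u} {H : Type v}

/-! ### Existence of lifts -/

namespace Triangulation

variable (T : Triangulation H) (x₀ : H)

theorem proj_rot (w : Paths) : T.proj x₀ ((T.universalCover x₀).rot w) = T.rot (T.proj x₀ w) := by
  simp [proj, universalCover, follow, movePerm, rotPerm]

theorem proj_opp (w : Paths) : T.proj x₀ ((T.universalCover x₀).opp w) = T.opp (T.proj x₀ w) := by
  simp [proj, universalCover, follow, movePerm, oppPerm]

end Triangulation

namespace Coord

variable {T : Triangulation H} {ωσ ωι : EdgeOrientation T} (c : Coord ι T ωσ ωι)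

/-- The two moves on pairs consisting of a side and a frame. -/
def framePerm : Move → Equiv.Perm (H × SLtilde ι)
  | .rot => ⟨fun p => (T.rot p.1, qG (c.oddPair p.1) * p.2),
      fun p => (T.rot (T.rot p.1), (qG (c.oddPair p.1))⁻¹ * p.2),
      fun p => by simp [T.rot_rot_rot, c.oddPair_rot],
      fun p => by simp [T.rot_rot_rot, c.oddPair_rot]⟩
  | .opp => ⟨fun p => (T.opp p.1, c.crossElt p.1 * p.2), fun p => (T.opp p.1, c.crossElt p.1 * p.2),
      fun p => by simp [T.opp_opp, ← mul_assoc, c.crossElt_opp_mul],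
      fun p => by simp [T.opp_opp, ← mul_assoc, c.crossElt_opp_mul]⟩

/-- The action of paths on pairs consisting of a side and a frame. -/
def transport : Paths →* Equiv.Perm (H × SLtilde ι) :=
  PresentedGroup.toGroup (f := c.framePerm) (by
    intro r hr
    rcases hr with rfl | rfl
    · refine Equiv.ext fun p => ?_
      have h : qG (c.oddPair p.1) * (qG (c.oddPair p.1) * (qG (c.oddPair p.1) * p.2)) = p.2 := by
        rw [← mul_assoc, ← mul_assoc, mul_assoc (qG _), qG_cube, one_mul]
      simp [framePerm, pow_succ, T.rot_rot_rot, c.oddPair_rot, h]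
    · refine Equiv.ext fun p => ?_
      simp [framePerm, pow_succ, T.opp_opp, ← mul_assoc, c.crossElt_opp_mul])

theorem transport_of (m : Move) : c.transport (PresentedGroup.of m) = c.framePerm m :=
  PresentedGroup.toGroup.of _

theorem transport_fst (w : Paths) (p : H × SLtilde ι) :
    (c.transport w p).1 = T.follow w p.1 := by
  have hof : ∀ (m : Move) (p : H × SLtilde ι),
      (c.transport (PresentedGroup.of m) p).1 = T.follow (PresentedGroup.of m) p.1 := by
    intro m p
    rw [transport_of]
    cases m <;>
      simp [framePerm, Triangulation.follow, Triangulation.movePerm, Triangulation.rotPerm,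
        Triangulation.oppPerm]
  have hw : w ∈ Subgroup.closure (Set.range (PresentedGroup.of : Move → Paths)) := by
    rw [PresentedGroup.closure_range_of]
    trivial
  induction hw using Subgroup.closure_induction generalizing p with
  | mem w h =>
    obtain ⟨m, rfl⟩ := h
    exact hof m p
  | one => simp
  | mul w w' _ _ h h' =>
    rw [map_mul, map_mul, Equiv.Perm.mul_apply, Equiv.Perm.mul_apply, h, h']
  | inv w _ h =>
    rw [map_inv, map_inv, Equiv.Perm.eq_inv_iff_eq, ← h, ← Equiv.Perm.mul_apply,
      mul_inv_cancel, Equiv.Perm.one_apply]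

/-- Transporting the frame `1` along all paths which start at `x₀`. -/
def frame (x₀ : H) (w : Paths) : SLtilde ι := (c.transport w (x₀, 1)).2

theorem isFrame_frame (x₀ : H) : c.IsFrame (T.universalCover x₀) (T.proj x₀) (c.frame x₀) where
  rot w := by
    change (c.transport (_ * w) _).2 = _
    rw [map_mul, Equiv.Perm.mul_apply, transport_of]
    change qG (c.oddPair (c.transport w (x₀, 1)).1) * _ = _
    rw [transport_fst]
    rfl
  opp w := by
    change (c.transport (_ * w) _).2 = _
    rw [map_mul, Equiv.Perm.mul_apply, transport_of]
    change c.crossElt (c.transport w (x₀, 1)).1 * _ = _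
    rw [transport_fst]
    rfl

/-- The frame transported from a base side places the vertices consistently around every ideal
point, because the placement condition passes from a side to the next one starting at the same
vertex. -/
theorem exists_isLift (x₀ : H) : ∃ ℓ : (T.universalCover x₀).IdealPoint → LightCone ι,
    IsLift (T.universalCover x₀) (T.proj x₀) c ℓ := by
  have hF := c.isFrame_frame x₀
  have hp : ∀ w, c.IsPlaced (T.proj x₀ w) (c.frame x₀ w)
      ((c.frame x₀ w)⁻¹ • op (c.vertexScale (T.proj x₀ w) : Grassmann ι) • ptC) :=
    fun w => smul_inv_smul _ _
  refine ⟨Quot.lift (fun w => ⟨(c.frame x₀ w)⁻¹ •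
    op (c.vertexScale (T.proj x₀ w) : Grassmann ι) • ptC,
    smul_mem_lightCone _ (op_smul_ptC_mem_lightCone _)⟩) ?_, ?_⟩
  · rintro w _ rfl
    have h := isPlaced_rot_opp_iff.mpr (hp w)
    rw [← hF.opp, ← T.proj_opp, ← T.proj_rot, ← hF.rot] at h
    apply Subtype.ext
    exact (eq_inv_smul_iff.mpr h)
  · exact IsFramed.isLift (T.proj_rot x₀) (T.proj_opp x₀) ⟨_, hF, hp⟩

end Coord

end

section

variable {ι : Type u}

/-! ### The frames of a quadrilateral before and after a flip -/

section Group

variable {G : Type*} [Group G] {qθ qσ qμ qν x x' ma mb mc md : G}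

/-- The frames of the six sides in the two triangles of a quadrilateral with diagonal `e`, in terms
of the change of frames `ma, mb, mc, md` along its sides: the relations among the frames `A, B, E`
and `E', C, D` in the old triangles are equivalent to those in the new ones, `A, E, D` and
`B, C, E'`. -/
theorem quadrilateral_iff (hθ : qθ * (qθ * qθ) = 1) (hσ : qσ * (qσ * qσ) = 1)
    (hμ : qμ * (qμ * qμ) = 1) (hν : qν * (qν * qν) = 1)
    (h1 : md * (qσ * (qσ * x)) = qμ * (qμ * (ma * qθ)))
    (h2 : mc * (qσ * x) = qν * (mb * (qθ * qθ)))
    (h3 : mb * qθ = qν * (x' * (qμ * ma))) (A B C D E E' : G) :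
    ((A = qθ * E ∧ B = qθ * A ∧ E = qθ * B) ∧ (C = qσ * E' ∧ D = qσ * C ∧ E' = qσ * D) ∧
      E' = x * E ∧ E = x⁻¹ * E') ↔
    ((qμ * ma * qθ * E = qμ * (ma * A) ∧ md * D = qμ * (qμ * ma * qθ * E) ∧
        ma * A = qμ * (md * D)) ∧
      (mc * C = qν * (mb * B) ∧ qν * mc * qσ * E' = qν * (mc * C) ∧
        mb * B = qν * (qν * mc * qσ * E')) ∧
      qν * mc * qσ * E' = x' * (qμ * ma * qθ * E) ∧
      qμ * ma * qθ * E = x'⁻¹ * (qν * mc * qσ * E')) := by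
  have h4 : qν * mc * qσ * x = x' * (qμ * ma * qθ) := by
    calc qν * mc * qσ * x = qν * (mc * (qσ * x)) := by simp only [mul_assoc]
      _ = qν * (qν * (mb * qθ * qθ)) := by rw [h2, mul_assoc mb]
      _ = qν * (qν * qν) * (x' * (qμ * ma * qθ)) := by rw [h3]; simp only [mul_assoc]
      _ = _ := by rw [hν, one_mul]
  have c3 : ∀ {q : G}, q * (q * q) = 1 → ∀ y, q * (q * (q * y)) = y := fun {q} h y => by
    have : q * (q * (q * y)) = q * (q * q) * y := by simp only [mul_assoc]
    rw [this, h, one_mul]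
  constructor
  · rintro ⟨⟨rfl, rfl, -⟩, ⟨rfl, rfl, -⟩, rfl, -⟩
    have e1 : md * (qσ * (qσ * (x * E))) = qμ * (qμ * (ma * (qθ * E))) := by
      have := congrArg (· * E) h1
      simpa only [mul_assoc] using this
    have e2 : mc * (qσ * (x * E)) = qν * (mb * (qθ * (qθ * E))) := by
      have := congrArg (· * E) h2
      simpa only [mul_assoc] using this
    have e4 : qν * mc * qσ * (x * E) = x' * (qμ * ma * qθ * E) := by
      rw [← mul_assoc, h4, mul_assoc]
    refine ⟨⟨by simp only [mul_assoc], by rw [e1]; simp only [mul_assoc], ?_⟩,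
      ⟨e2, by simp only [mul_assoc], ?_⟩, e4, by rw [e4, inv_mul_cancel_left]⟩
    · rw [e1, c3 hμ]
    · rw [mul_assoc (qν * mc), mul_assoc qν, e2, c3 hν]
  · rintro ⟨⟨hA, hD, -⟩, ⟨hB, hC, -⟩, hE, -⟩
    have eA : A = qθ * E := by
      rw [mul_assoc, mul_assoc, mul_right_inj, mul_right_inj] at hA
      exact hA.symm
    have eC : C = qσ * E' := by
      rw [mul_assoc, mul_assoc, mul_right_inj, mul_right_inj] at hC
      exact hC.symm
    have eE : E' = x * E := by
      rw [← mul_assoc, ← h4, mul_assoc _ x, mul_right_inj] at hE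
      exact hE
    have eB : B = qθ * (qθ * E) := by
      have := congrArg (· * E) h2
      simp only [mul_assoc] at this
      rw [eC, eE, this, mul_right_inj, mul_right_inj] at hB
      exact hB.symm
    have eD : D = qσ * (qσ * (x * E)) := by
      have := congrArg (· * E) h1
      simp only [mul_assoc] at this hD
      rw [← this, mul_right_inj] at hD
      exact hD
    refine ⟨⟨eA, by rw [eB, eA], by rw [eB, c3 hθ]⟩, ⟨eC, by rw [eD, eC, eE], ?_⟩, eE, ?_⟩
    · rw [eD, c3 hσ, eE]
    · rw [eE, inv_mul_cancel_left]

end Group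

section FlipFrames

variable (θ σ : OddPair ι) (h q D : Pos ι)

/-- The change of frames along the side `a` of the quadrilateral. -/
def changeA : SLtilde ι := dG D⁻¹ * zG (h * θ.cPos)⁻¹

/-- The change of frames along the side `b` of the quadrilateral. -/
def changeB : SLtilde ι := nG * (dG (D * q⁻¹) * zG (θ.cPos * h⁻¹))

/-- The change of frames along the side `c` of the quadrilateral. -/
def changeC : SLtilde ι := dG D⁻¹ * zG (θ.cPos * (muPair (θ.scale h) σ q D).cPos⁻¹)

/-- The change of frames along the side `d` of the quadrilateral. -/
def changeD : SLtilde ι := dG (D * q⁻¹) * zG ((nuPair (θ.scale h) σ q D).cPos * θ.cPos⁻¹)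

variable {θ σ h q D}

theorem coe_congr {u w : (SMat ι)ˣ} {x y : SLtilde ι} (h : u = w)
    (hx : (x : Equiv.Perm (SMat ι)) = conj u) (hy : (y : Equiv.Perm (SMat ι)) = conj w) : x = y :=
  Subtype.ext (by rw [hx, hy, h])

theorem qG_eq (θ : OddPair ι) (h : Pos ι) : qG θ = zG h * qG (θ.scale h) * (zG h)⁻¹ := by
  rw [← qG_mul_zG, mul_inv_cancel_right]

theorem dG_mul_zG_inv (a b : Pos ι) : (dG a * zG b)⁻¹ = dG a⁻¹ * zG b⁻¹ := by
  rw [mul_inv_rev, ← map_inv, ← map_inv, zG_mul_dG]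

theorem changeA_mul_qG : changeA θ h D * qG θ =
    (dG D * zG θ.cPos)⁻¹ * (qG (θ.scale h) * (zG h)⁻¹) := by
  have e : zG (h * θ.cPos)⁻¹ * zG h = zG θ.cPos⁻¹ := by
    rw [← map_mul, mul_inv, mul_comm, mul_inv_cancel_left]
  rw [changeA, qG_eq θ h, dG_mul_zG_inv, ← e]
  simp only [mul_assoc]

theorem changeB_mul_qG : changeB θ h q D * qG θ =
    (dG (q * D⁻¹) * zG θ.cPos⁻¹ * nG)⁻¹ * (qG (θ.scale h) * (zG h)⁻¹) := by
  have e : zG (θ.cPos * h⁻¹) * zG h = zG θ.cPos := by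
    rw [← map_mul, inv_mul_cancel_right]
  have hn : (nG : SLtilde ι)⁻¹ = nG := inv_eq_of_mul_eq_one_left nG_mul_nG
  rw [changeB, qG_eq θ h, mul_inv_rev (dG _ * _), dG_mul_zG_inv, inv_inv, mul_inv, inv_inv,
    mul_comm q⁻¹, hn, ← e]
  simp only [mul_assoc]

theorem changeB_mul_qG_sq : changeB θ h q D * (qG θ * qG θ) =
    (dG (q * D⁻¹) * zG θ.cPos⁻¹ * nG)⁻¹ * (qG (θ.scale h) * qG (θ.scale h) * (zG h)⁻¹) := by
  rw [← mul_assoc, changeB_mul_qG, qG_eq θ h]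
  group

/-- The side `d` of the triangle `ABD`, hypothesis `h1` of `quadrilateral_iff`. -/
theorem changeD_mul (hF : FlipEq (θ.scale h) σ q D) :
    changeD θ σ h q D * (qG σ * (qG σ * (jG * dG q * (zG h)⁻¹))) =
      qG (muPair (θ.scale h) σ q D) * (qG (muPair (θ.scale h) σ q D) *
        (changeA θ h D * qG θ)) := by
  have H : dG (D * q⁻¹) * zG ((nuPair (θ.scale h) σ q D).cPos * (θ.scale h).cPos⁻¹) *
      (qG σ * qG σ * (jG * dG q) * (qG (θ.scale h) * qG (θ.scale h))) *
        (dG D * zG (θ.scale h).cPos) =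
      qG (muPair (θ.scale h) σ q D) * qG (muPair (θ.scale h) σ q D) :=
    coe_congr (flipMatrix_sideD hF) (by simp only [map_mul]; rfl) (by simp only [map_mul]; rfl)
  rw [θ.cPos_scale] at H
  have hq := qG_cube (θ.scale h)
  rw [changeA_mul_qG, ← mul_assoc (qG (muPair _ _ _ _)), ← H, mul_assoc _ (dG D * _),
    mul_inv_cancel_left, ← mul_assoc (qG σ)]
  generalize qG (θ.scale h) = r at hq ⊢
  rw [← changeD]
  calc _ = changeD θ σ h q D * (qG σ * qG σ * (jG * dG q * 1 * (zG h)⁻¹)) := by rw [mul_one]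
    _ = _ := by rw [← hq]; simp only [mul_assoc]

/-- The side `c` of the triangle `BCD`, hypothesis `h2` of `quadrilateral_iff`. -/
theorem changeC_mul (hF : FlipEq (θ.scale h) σ q D) :
    changeC θ σ h q D * (qG σ * (jG * dG q * (zG h)⁻¹)) =
      qG (nuPair (θ.scale h) σ q D) * (changeB θ h q D * (qG θ * qG θ)) := by
  have H : dG D⁻¹ * zG ((θ.scale h).cPos * (muPair (θ.scale h) σ q D).cPos⁻¹) *
      (qG σ * (jG * dG q) * qG (θ.scale h)) * (dG (q * D⁻¹) * zG (θ.scale h).cPos⁻¹ * nG) =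
      qG (nuPair (θ.scale h) σ q D) :=
    coe_congr (flipMatrix_sideC hF) (by simp only [map_mul]; rfl) rfl
  rw [θ.cPos_scale] at H
  have hq := qG_cube (θ.scale h)
  rw [changeB_mul_qG_sq, ← H, mul_assoc _ (dG _ * _ * _), mul_inv_cancel_left]
  generalize qG (θ.scale h) = r at hq ⊢
  rw [← changeC]
  calc _ = changeC θ σ h q D * (qG σ * (jG * dG q * 1 * (zG h)⁻¹)) := by rw [mul_one]
    _ = _ := by rw [← hq]; simp only [mul_assoc]

/-- The new diagonal, hypothesis `h3` of `quadrilateral_iff`. -/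
theorem changeB_mul (hF : FlipEq (θ.scale h) σ q D) :
    changeB θ h q D * qG θ = qG (nuPair (θ.scale h) σ q D) *
      (jG * dG q⁻¹ * (zG (σ.cPos * (θ.cPos * θ.cPos)⁻¹))⁻¹ *
        (qG (muPair (θ.scale h) σ q D) * changeA θ h D)) := by
  have H : dG (q * D⁻¹) * zG (θ.scale h).cPos⁻¹ * nG * (qG (nuPair (θ.scale h) σ q D) *
      (jG * dG q⁻¹ * zG ((θ.scale h).cPos * (θ.scale h).cPos * σ.cPos⁻¹)) *
        qG (muPair (θ.scale h) σ q D)) * (dG D⁻¹ * zG (θ.scale h).cPos⁻¹) = qG (θ.scale h) :=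
    coe_congr (flipMatrix_sideB hF) (by simp only [map_mul]; rfl) rfl
  rw [θ.cPos_scale] at H
  have e : (dG D⁻¹ * zG θ.cPos⁻¹) * (zG h)⁻¹ = changeA θ h D := by
    rw [changeA, mul_inv, mul_comm, map_mul zG, map_inv zG h, mul_assoc]
  have e' : (σ.cPos * (θ.cPos * θ.cPos)⁻¹)⁻¹ = θ.cPos * θ.cPos * σ.cPos⁻¹ := by
    rw [mul_inv_rev, inv_inv]
  rw [changeB_mul_qG, ← H, ← e, ← map_inv zG (_ * _), e']
  generalize dG (q * D⁻¹) * zG θ.cPos⁻¹ * nG = k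
  simp only [mul_assoc, inv_mul_cancel_left]

end FlipFrames

end

section

variable {ι : Type u} {H : Type v}

/-! ### The coordinates after a flip -/

namespace Triangulation

variable {T : Triangulation H} {e : H}

theorem opp_injective : Function.Injective T.opp := T.oppPerm.injective

theorem SameEdge.symm {x y : H} (h : T.SameEdge x y) : T.SameEdge y x := by
  rcases h with rfl | rfl
  · exact Or.inl rfl
  · exact Or.inr (T.opp_opp x).symm

theorem sameEdge_opp {x y : H} : T.SameEdge x (T.opp y) ↔ T.SameEdge x y := by
  constructor
  · rintro (h | h)
    · exact Or.inr (by rw [← h, T.opp_opp])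
    · exact Or.inl (opp_injective h)
  · rintro (rfl | rfl)
    · exact Or.inr rfl
    · exact Or.inl (T.opp_opp x)

/-- The edges of the sides of a quadrilateral and of its diagonal are different. -/
theorem DistinctSides.not_sameEdge (he : T.DistinctSides e) :
    List.Pairwise (fun x y => ¬ T.SameEdge x y)
      [e, T.rot e, T.rot (T.rot e), T.rot (T.opp e), T.rot (T.rot (T.opp e))] := by
  refine List.pairwise_cons.mpr ⟨?_, he⟩
  have h1 := he.flippable
  simp only [List.mem_cons, List.not_mem_nil, or_false, forall_eq_or_imp, forall_eq]
  exact ⟨h1.rot_notMem e (Or.inl rfl), h1.rot_rot_notMem e (Or.inl rfl),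
    h1.rot_notMem _ (Or.inr rfl), h1.rot_rot_notMem _ (Or.inr rfl)⟩

/-- The six sides in the two triangles of a quadrilateral are different. -/
theorem DistinctSides.nodup (he : T.DistinctSides e) :
    [e, T.rot e, T.rot (T.rot e), T.rot (T.opp e), T.rot (T.rot (T.opp e)), T.opp e].Nodup := by
  have h1 := he.not_sameEdge
  have h2 := T.opp_ne e
  simp only [SameEdge, List.pairwise_cons, List.nodup_cons, List.mem_cons, List.not_mem_nil,
    or_false, forall_eq_or_imp, forall_eq, not_or] at h1 ⊢
  grind

/-- A side belongs to the quadrilateral with diagonal `e`, or its triangle has no side on `e`. -/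
theorem side_cases (T : Triangulation H) (e x : H) :
    x = e ∨ x = T.rot e ∨ x = T.rot (T.rot e) ∨ x = T.rot (T.opp e) ∨
      x = T.rot (T.rot (T.opp e)) ∨ x = T.opp e ∨
      (¬ T.SameEdge e x ∧ ¬ T.SameEdge e (T.rot x) ∧ ¬ T.SameEdge e (T.rot (T.rot x))) := by
  have h3 := T.rot_rot_rot x
  by_cases h : T.SameEdge e x
  · rcases h with h | h <;> simp [h]
  by_cases h1 : T.SameEdge e (T.rot x)
  · rcases h1 with h1 | h1 <;> simp [← h1, h3]
  by_cases h2 : T.SameEdge e (T.rot (T.rot x))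
  · rcases h2 with h2 | h2 <;> simp [← h2, h3]
  simp [h, h1, h2]

theorem notMem_sides {x : H} (h : ¬ T.SameEdge e x) (h1 : ¬ T.SameEdge e (T.rot x))
    (h2 : ¬ T.SameEdge e (T.rot (T.rot x))) :
    x ∉ [e, T.rot e, T.rot (T.rot e), T.rot (T.opp e), T.rot (T.rot (T.opp e)), T.opp e] := by
  simp only [List.mem_cons, List.not_mem_nil, or_false]
  rintro (rfl | rfl | rfl | rfl | rfl | rfl)
  · exact h (Or.inl rfl)
  · exact h2 (Or.inl (T.rot_rot_rot e))
  · exact h1 (Or.inl (T.rot_rot_rot e))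
  · exact h2 (Or.inr (T.rot_rot_rot _))
  · exact h1 (Or.inr (T.rot_rot_rot _))
  · exact h (Or.inr rfl)

theorem not_sameEdge_of_notMem {x : H}
    (hx : x ∉ [e, T.rot e, T.rot (T.rot e), T.rot (T.opp e), T.rot (T.rot (T.opp e)), T.opp e]) :
    ¬ T.SameEdge e x ∧ ¬ T.SameEdge e (T.rot x) ∧ ¬ T.SameEdge e (T.rot (T.rot x)) := by
  simp only [List.mem_cons, List.not_mem_nil, or_false, not_or] at hx
  rcases T.side_cases e x with h | h | h | h | h | h | h
  · exact absurd h hx.1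
  · exact absurd h hx.2.1
  · exact absurd h hx.2.2.1
  · exact absurd h hx.2.2.2.1
  · exact absurd h hx.2.2.2.2.1
  · exact absurd h hx.2.2.2.2.2
  · exact h

section FlipEdge

variable (T) (he : T.DistinctSides e)

theorem flipEdge_rot_e : (T.flipEdge e he).rot e = T.rot (T.rot (T.opp e)) :=
  T.flipRot_mem (Or.inl rfl)

theorem flipEdge_rot_opp : (T.flipEdge e he).rot (T.opp e) = T.rot (T.rot e) := by
  rw [flipEdge]
  exact (T.flipRot_mem (Or.inr rfl)).trans (by rw [T.opp_opp])

theorem flipEdge_rot_a : (T.flipEdge e he).rot (T.rot e) = e :=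
  T.flipRot_left he.flippable (Or.inl rfl)

theorem flipEdge_rot_c : (T.flipEdge e he).rot (T.rot (T.opp e)) = T.opp e :=
  T.flipRot_left he.flippable (Or.inr rfl)

theorem flipEdge_rot_b : (T.flipEdge e he).rot (T.rot (T.rot e)) = T.rot (T.opp e) :=
  T.flipRot_right he.flippable (Or.inl rfl)

theorem flipEdge_rot_d : (T.flipEdge e he).rot (T.rot (T.rot (T.opp e))) = T.rot e :=
  (T.flipRot_right he.flippable (Or.inr rfl)).trans (by rw [T.opp_opp])

theorem flipEdge_rot_other {x : H} (h : ¬ T.SameEdge e x) (h1 : ¬ T.SameEdge e (T.rot x))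
    (h2 : ¬ T.SameEdge e (T.rot (T.rot x))) : (T.flipEdge e he).rot x = T.rot x :=
  T.flipRot_other h h1 h2

end FlipEdge

end Triangulation

open Triangulation

open Classical in
/-- The factor which multiplies the ratio of the side `x` by `v`, and the ratio on the other side
of the same edge accordingly. -/
def edgeFactor (T : Triangulation H) (ωσ ωι : EdgeOrientation T) (x : H) (v : Pos ι) (y : H) :
    Pos ι :=
  if y = x then v
  else if y = T.opp x then (if ωσ.toward x = ωι.toward x then v⁻¹ else v) else 1

section EdgeFactor

variable {T : Triangulation H} {ωσ ωι : EdgeOrientation T}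

theorem toward_opp_eq_iff (x : H) :
    ωσ.toward (T.opp x) = ωι.toward (T.opp x) ↔ ωσ.toward x = ωι.toward x := by
  rw [ωσ.toward_opp, ωι.toward_opp]; simp

theorem edgeFactor_self (x : H) (v : Pos ι) : edgeFactor T ωσ ωι x v x = v := if_pos rfl

theorem edgeFactor_of_not {x y : H} (h : ¬ T.SameEdge x y) (v : Pos ι) :
    edgeFactor T ωσ ωι x v y = 1 := by
  rw [edgeFactor, if_neg fun h' => h (Or.inl h'), if_neg fun h' => h (Or.inr h')]

theorem edgeFactor_opp (x : H) (v : Pos ι) (y : H) : edgeFactor T ωσ ωι x v (T.opp y) =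
    if ωσ.toward y = ωι.toward y then (edgeFactor T ωσ ωι x v y)⁻¹
    else edgeFactor T ωσ ωι x v y := by
  by_cases h : T.SameEdge x y
  · rcases h with rfl | rfl
    · rw [edgeFactor_self, edgeFactor, if_neg (T.opp_ne y), if_pos rfl]
    · rw [T.opp_opp, edgeFactor_self, edgeFactor, if_neg (T.opp_ne x), if_pos rfl]
      simp only [toward_opp_eq_iff]
      split_ifs
      · rw [inv_inv]
      · rfl
  · rw [edgeFactor_of_not h, edgeFactor_of_not (fun h' => h (sameEdge_opp.mp h')), inv_one,
      ite_self]

end EdgeFactor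

namespace Coord

variable {T : Triangulation H} {ωσ ωι : EdgeOrientation T} (c : Coord ι T ωσ ωι) (e : H)

/-- The odd coordinates of the triangle of `e`, in the standard position of the quadrilateral. -/
def scaledPair : OddPair ι := (c.oddPair e).scale (c.ratioPos e)

/-- The square root of the cross-ratio of `e`. -/
def crossSqrt : Pos ι := (c.crossPos e).sqrt

/-- The square of the denominator `𝒟` of the odd coordinates after the flip of `e`. -/
def flipNormSq : Pos ι :=
  ⟨1 + c.crossSqrt e * c.crossSqrt e + (1 / 2 : ℝ) • ((c.crossSqrt e : Grassmann ι) *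
    ((c.oddPair (T.opp e)).fst * (c.scaledPair e).snd +
      (c.oddPair (T.opp e)).snd * (c.scaledPair e).fst)),
    ((IsEven.one.add ((c.crossSqrt e).isEven.mul (c.crossSqrt e).isEven)).add
      (((c.crossSqrt e).isEven.mul
        (((c.oddPair (T.opp e)).fst_odd.mul (c.scaledPair e).snd_odd).add
          ((c.oddPair (T.opp e)).snd_odd.mul (c.scaledPair e).fst_odd))).smul _)), by
    have h1 := (IsPos.one.add (c.crossSqrt e * c.crossSqrt e).2).2
    have h2 : body ((c.oddPair (T.opp e)).fst * (c.scaledPair e).snd +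
        (c.oddPair (T.opp e)).snd * (c.scaledPair e).fst) = 0 := by
      rw [body_add, body_mul, body_mul, (c.scaledPair e).snd_odd.body,
        (c.scaledPair e).fst_odd.body]
      simp
    rw [body_add, body_smul, body_mul _ (_ + _), h2, mul_zero, mul_zero, add_zero]
    exact h1⟩

/-- The denominator `𝒟` of the odd coordinates after the flip of `e`. -/
def flipNorm : Pos ι := (c.flipNormSq e).sqrt

theorem flipEq : FlipEq (c.scaledPair e) (c.oddPair (T.opp e)) (c.crossSqrt e) (c.flipNorm e) :=
  congrArg Subtype.val (c.flipNormSq e).sqrt_mul_sqrt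

/-- The odd coordinates of the triangle `ABD`. -/
def flipMu : OddPair ι :=
  muPair (c.scaledPair e) (c.oddPair (T.opp e)) (c.crossSqrt e) (c.flipNorm e)

/-- The odd coordinates of the triangle `BCD`. -/
def flipNu : OddPair ι :=
  nuPair (c.scaledPair e) (c.oddPair (T.opp e)) (c.crossSqrt e) (c.flipNorm e)

/-- The `λ`-length of the new diagonal. -/
def flipDiag : Pos ι :=
  c.lamPos (T.rot (T.rot e)) * c.lamPos (T.rot (T.rot (T.opp e))) *
    (c.flipNorm e * c.flipNorm e) * (c.lamPos e)⁻¹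

open Classical in
/-- The `λ`-lengths after the flip of `e`. -/
def flipLam (x : H) : Pos ι := if T.SameEdge e x then c.flipDiag e else c.lamPos x

open Classical in
/-- The odd coordinates after the flip of `e`. -/
def flipOdd (x : H) : OddPair ι :=
  if x ∈ [T.rot e, e, T.rot (T.rot (T.opp e))] then c.flipMu e
  else if x ∈ [T.rot (T.rot e), T.rot (T.opp e), T.opp e] then c.flipNu e
  else c.oddPair x

/-- The ratio of the new diagonal. -/
def flipDiagRatio : Pos ι :=
  (c.oddPair (T.opp e)).cPos * ((c.oddPair e).cPos * (c.oddPair e).cPos)⁻¹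

/-- The ratios after the flip of `e`. -/
def flipRatio (x : H) : Pos ι :=
  c.ratioPos x * (edgeFactor T ωσ ωι e ((c.ratioPos e)⁻¹ * c.flipDiagRatio e) x *
    edgeFactor T ωσ ωι (T.rot e) (c.ratioPos e * (c.oddPair e).cPos)⁻¹ x *
    edgeFactor T ωσ ωι (T.rot (T.rot e)) ((c.oddPair e).cPos * (c.ratioPos e)⁻¹) x *
    edgeFactor T ωσ ωι (T.rot (T.opp e)) ((c.oddPair e).cPos * (c.flipMu e).cPos⁻¹) x *
    edgeFactor T ωσ ωι (T.rot (T.rot (T.opp e))) ((c.flipNu e).cPos * (c.oddPair e).cPos⁻¹) x)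

theorem flipRatio_opp (x : H) : c.flipRatio e (T.opp x) =
    if ωσ.toward x = ωι.toward x then (c.flipRatio e x)⁻¹ else c.flipRatio e x := by
  simp only [flipRatio, edgeFactor_opp]
  split_ifs with h
  · simp only [c.ratioPos_opp_of_eq h, mul_inv]
  · simp only [c.ratioPos_opp_of_ne h]

variable (he : T.DistinctSides e)

theorem flipEdge_toward (x : H) : ((ωσ.flipEdge e he).toward x = (ωι.flipEdge e he).toward x) ↔
    ωσ.toward x = ωι.toward x := by
  simp only [EdgeOrientation.flipEdge]
  split_ifs <;> simp

theorem flipOdd_of_notMem {x : H}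
    (hx : x ∉ [e, T.rot e, T.rot (T.rot e), T.rot (T.opp e), T.rot (T.rot (T.opp e)), T.opp e]) :
    c.flipOdd e x = c.oddPair x := by
  simp only [List.mem_cons, List.not_mem_nil, or_false, not_or] at hx
  rw [flipOdd, if_neg, if_neg] <;> simp [hx]

theorem flipOdd_rot (x : H) : c.flipOdd e ((T.flipEdge e he).rot x) = c.flipOdd e x := by
  have hn := he.nodup
  simp only [List.nodup_cons, List.mem_cons, List.not_mem_nil, or_false, not_or] at hn
  rcases T.side_cases e x with rfl | rfl | rfl | rfl | rfl | rfl | ⟨h, h1, h2⟩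
  · rw [T.flipEdge_rot_e he]; simp [flipOdd]
  · rw [T.flipEdge_rot_a he]; simp [flipOdd]
  · rw [T.flipEdge_rot_b he]; simp only [flipOdd, List.mem_cons, List.not_mem_nil]; grind
  · rw [T.flipEdge_rot_c he]; simp only [flipOdd, List.mem_cons, List.not_mem_nil]; grind
  · rw [T.flipEdge_rot_d he]; simp [flipOdd]
  · rw [T.flipEdge_rot_opp he]; simp only [flipOdd, List.mem_cons, List.not_mem_nil]; grind
  · rw [T.flipEdge_rot_other he h h1 h2]
    rw [flipOdd_of_notMem, flipOdd_of_notMem, c.oddPair_rot]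
    · exact notMem_sides h h1 h2
    · exact notMem_sides h1 h2 (by rwa [T.rot_rot_rot])

theorem flipLam_opp (x : H) : c.flipLam e (T.opp x) = c.flipLam e x := by
  by_cases h : T.SameEdge e x
  · rw [flipLam, flipLam, if_pos h, if_pos (sameEdge_opp.mpr h)]
  · rw [flipLam, flipLam, if_neg h, if_neg (fun h' => h (sameEdge_opp.mp h')), c.lamPos_opp]

/-- The coordinates after the flip of `e`. -/
def flipCoord : Coord ι (T.flipEdge e he) (ωσ.flipEdge e he) (ωι.flipEdge e he) where
  lam x := c.flipLam e x
  ratio x := c.flipRatio e x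
  odd₁ x := (c.flipOdd e x).fst
  odd₂ x := (c.flipOdd e x).snd
  lam_pos x := (c.flipLam e x).2
  lam_opp x := congrArg Subtype.val (c.flipLam_opp e x)
  ratio_pos x := (c.flipRatio e x).2
  ratio_opp x := by
    simp only [flipEdge_toward]
    change (c.flipRatio e (T.opp x) : Grassmann ι) = _
    rw [flipRatio_opp]
    split_ifs <;> rfl
  odd₁_isOdd x := (c.flipOdd e x).fst_odd
  odd₂_isOdd x := (c.flipOdd e x).snd_odd
  odd₁_rot x := congrArg OddPair.fst (c.flipOdd_rot e he x)
  odd₂_rot x := congrArg OddPair.snd (c.flipOdd_rot e he x)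

end Coord

end

section

variable {ι : Type u} {H : Type v}

open Triangulation

namespace Coord

/-! ### The change of frames under a flip -/

variable {T : Triangulation H} {ωσ ωι : EdgeOrientation T} (c : Coord ι T ωσ ωι)

/-- The contribution of the triangle of `x` to the cross-ratio of the edge of `x`. -/
def halfCross (x : H) : Pos ι := c.lamPos (T.rot x) * (c.lamPos (T.rot (T.rot x)))⁻¹

theorem crossPos_eq (x : H) : c.crossPos x = c.halfCross x * c.halfCross (T.opp x) := by
  rw [crossPos, halfCross, halfCross, mul_inv, mul_mul_mul_comm]

theorem vertexScale_eq (x : H) :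
    c.vertexScale x = Pos.two.sqrt * c.lamPos x * (c.halfCross x)⁻¹ := by
  rw [vertexScale, halfCross, mul_inv, inv_inv, mul_comm (c.lamPos (T.rot x))⁻¹,
    mul_assoc _ _ (_⁻¹)]

variable (e : H)

open Classical in
/-- The change of the normalised frame of the side `x` under the flip of `e`. -/
def flipChange (x : H) : SLtilde ι :=
  if x = T.rot e then changeA (c.oddPair e) (c.ratioPos e) (c.flipNorm e)
  else if x = T.rot (T.rot e) then
    changeB (c.oddPair e) (c.ratioPos e) (c.crossSqrt e) (c.flipNorm e)
  else if x = T.rot (T.opp e) then changeC (c.oddPair e) (c.oddPair (T.opp e)) (c.ratioPos e)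
    (c.crossSqrt e) (c.flipNorm e)
  else if x = T.rot (T.rot (T.opp e)) then changeD (c.oddPair e) (c.oddPair (T.opp e))
    (c.ratioPos e) (c.crossSqrt e) (c.flipNorm e)
  else if x = e then
    qG (c.flipMu e) * changeA (c.oddPair e) (c.ratioPos e) (c.flipNorm e) * qG (c.oddPair e)
  else if x = T.opp e then
    qG (c.flipNu e) * changeC (c.oddPair e) (c.oddPair (T.opp e)) (c.ratioPos e)
      (c.crossSqrt e) (c.flipNorm e) * qG (c.oddPair (T.opp e))
  else 1

theorem flipChange_of_notMem {x : H}
    (hx : x ∉ [e, T.rot e, T.rot (T.rot e), T.rot (T.opp e), T.rot (T.rot (T.opp e)), T.opp e]) :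
    c.flipChange e x = 1 := by
  simp only [List.mem_cons, List.not_mem_nil, or_false, not_or] at hx
  simp only [flipChange, hx, if_false]

variable {e} (he : T.DistinctSides e)

section Values

theorem flipChange_a :
    c.flipChange e (T.rot e) = changeA (c.oddPair e) (c.ratioPos e) (c.flipNorm e) := if_pos rfl

theorem flipChange_b : c.flipChange e (T.rot (T.rot e)) =
    changeB (c.oddPair e) (c.ratioPos e) (c.crossSqrt e) (c.flipNorm e) := by
  rw [flipChange, if_neg (T.rot_ne _), if_pos rfl]

include he

theorem flipChange_c : c.flipChange e (T.rot (T.opp e)) =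
    changeC (c.oddPair e) (c.oddPair (T.opp e)) (c.ratioPos e) (c.crossSqrt e) (c.flipNorm e) := by
  have hn := he.nodup
  simp only [List.nodup_cons, List.mem_cons, List.not_mem_nil, or_false, not_or] at hn
  rw [flipChange, if_neg (by grind), if_neg (by grind), if_pos rfl]

theorem flipChange_d : c.flipChange e (T.rot (T.rot (T.opp e))) =
    changeD (c.oddPair e) (c.oddPair (T.opp e)) (c.ratioPos e) (c.crossSqrt e) (c.flipNorm e) := by
  have hn := he.nodup
  simp only [List.nodup_cons, List.mem_cons, List.not_mem_nil, or_false, not_or] at hn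
  rw [flipChange, if_neg (by grind), if_neg (by grind), if_neg (by grind), if_pos rfl]

theorem flipChange_e : c.flipChange e e = qG (c.flipMu e) *
    changeA (c.oddPair e) (c.ratioPos e) (c.flipNorm e) * qG (c.oddPair e) := by
  have hn := he.nodup
  simp only [List.nodup_cons, List.mem_cons, List.not_mem_nil, or_false, not_or] at hn
  rw [flipChange, if_neg (by grind), if_neg (by grind), if_neg (by grind), if_neg (by grind),
    if_pos rfl]

theorem flipChange_opp : c.flipChange e (T.opp e) = qG (c.flipNu e) *
    changeC (c.oddPair e) (c.oddPair (T.opp e)) (c.ratioPos e) (c.crossSqrt e) (c.flipNorm e) *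
      qG (c.oddPair (T.opp e)) := by
  have hn := he.nodup
  simp only [List.nodup_cons, List.mem_cons, List.not_mem_nil, or_false, not_or] at hn
  rw [flipChange, if_neg (by grind), if_neg (by grind), if_neg (by grind), if_neg (by grind),
    if_neg (by grind), if_pos rfl]

end Values

theorem oddPair_flipCoord (x : H) : (c.flipCoord e he).oddPair x = c.flipOdd e x := rfl

theorem ratioPos_flipCoord (x : H) : (c.flipCoord e he).ratioPos x = c.flipRatio e x := rfl

theorem lamPos_flipCoord (x : H) : (c.flipCoord e he).lamPos x = c.flipLam e x := rfl

theorem flipOdd_mu {x : H} (hx : x ∈ [T.rot e, e, T.rot (T.rot (T.opp e))]) :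
    c.flipOdd e x = c.flipMu e := if_pos hx

include he in
theorem flipOdd_nu {x : H} (hx : x ∈ [T.rot (T.rot e), T.rot (T.opp e), T.opp e]) :
    c.flipOdd e x = c.flipNu e := by
  have hn := he.nodup
  simp only [List.nodup_cons, List.mem_cons, List.not_mem_nil, or_false, not_or] at hn hx
  rw [flipOdd, if_neg, if_pos]
  · simpa using hx
  · simp only [List.mem_cons, List.not_mem_nil, or_false]
    grind

theorem flipLam_of_not {x : H} (hx : ¬ T.SameEdge e x) : c.flipLam e x = c.lamPos x := if_neg hx

theorem flipLam_e : c.flipLam e e = c.flipDiag e := if_pos (Or.inl rfl)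

theorem flipLam_opp_e : c.flipLam e (T.opp e) = c.flipDiag e := if_pos (Or.inr rfl)

include he in
theorem flipLam_sides : c.flipLam e (T.rot e) = c.lamPos (T.rot e) ∧
    c.flipLam e (T.rot (T.rot e)) = c.lamPos (T.rot (T.rot e)) ∧
    c.flipLam e (T.rot (T.opp e)) = c.lamPos (T.rot (T.opp e)) ∧
    c.flipLam e (T.rot (T.rot (T.opp e))) = c.lamPos (T.rot (T.rot (T.opp e))) := by
  have h := he.not_sameEdge
  simp only [List.pairwise_cons, List.mem_cons, List.not_mem_nil,
    or_false, forall_eq_or_imp, forall_eq] at h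
  exact ⟨if_neg h.1.1, if_neg h.1.2.1, if_neg h.1.2.2.1, if_neg h.1.2.2.2⟩

/-! ### Cross-ratios after the flip -/

theorem crossSqrt_mul_self : c.crossSqrt e * c.crossSqrt e =
    (c.lamPos (T.rot e) * c.lamPos (T.rot (T.opp e))) *
    (c.lamPos (T.rot (T.rot e)) * c.lamPos (T.rot (T.rot (T.opp e))))⁻¹ :=
  (c.crossPos e).sqrt_mul_sqrt

theorem halfCross_a : (c.flipCoord e he).halfCross (T.rot e) =
    c.halfCross (T.rot e) * (c.flipNorm e * c.flipNorm e) := by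
  rw [halfCross, halfCross, flipEdge_rot_a, flipEdge_rot_e, lamPos_flipCoord, lamPos_flipCoord,
    (c.flipLam_sides he).2.2.2, flipLam_e, T.rot_rot_rot, flipDiag]
  generalize c.lamPos (T.rot (T.rot e)) = b
  generalize c.lamPos (T.rot (T.rot (T.opp e))) = d
  generalize c.flipNorm e * c.flipNorm e = n
  generalize (c.lamPos e)⁻¹ = k
  calc b * d * n * k * d⁻¹ = b * k * n * (d * d⁻¹) := by
        simp only [mul_comm, mul_left_comm, mul_assoc]
    _ = _ := by rw [mul_inv_cancel, mul_one]

theorem halfCross_c : (c.flipCoord e he).halfCross (T.rot (T.opp e)) =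
    c.halfCross (T.rot (T.opp e)) * (c.flipNorm e * c.flipNorm e) := by
  rw [halfCross, halfCross, flipEdge_rot_c, flipEdge_rot_opp, lamPos_flipCoord, lamPos_flipCoord,
    (c.flipLam_sides he).2.1, flipLam_opp_e, T.rot_rot_rot, flipDiag, c.lamPos_opp]
  generalize c.lamPos (T.rot (T.rot e)) = b
  generalize c.lamPos (T.rot (T.rot (T.opp e))) = d
  generalize c.flipNorm e * c.flipNorm e = n
  generalize (c.lamPos e)⁻¹ = k
  calc b * d * n * k * b⁻¹ = d * k * n * (b * b⁻¹) := by
        simp only [mul_comm, mul_left_comm, mul_assoc]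
    _ = _ := by rw [mul_inv_cancel, mul_one]

theorem halfCross_b : (c.flipCoord e he).halfCross (T.rot (T.rot e)) =
    c.halfCross (T.rot (T.rot e)) *
      (c.crossSqrt e * c.crossSqrt e * (c.flipNorm e * c.flipNorm e)⁻¹) := by
  rw [halfCross, halfCross, flipEdge_rot_b, flipEdge_rot_c, lamPos_flipCoord, lamPos_flipCoord,
    (c.flipLam_sides he).2.2.1, flipLam_opp_e, T.rot_rot_rot, flipDiag, crossSqrt_mul_self]
  generalize c.lamPos (T.rot (T.rot e)) = b
  generalize c.lamPos (T.rot (T.rot (T.opp e))) = d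
  generalize c.lamPos (T.rot (T.opp e)) = f
  generalize c.lamPos (T.rot e) = a
  generalize c.flipNorm e * c.flipNorm e = n
  generalize c.lamPos e = k
  simp only [mul_inv, inv_inv]
  calc f * (b⁻¹ * d⁻¹ * n⁻¹ * k) = f * (b⁻¹ * d⁻¹ * n⁻¹ * k) * (a * a⁻¹) := by
        rw [mul_inv_cancel, mul_one]
    _ = _ := by simp only [mul_comm, mul_left_comm, mul_assoc]

theorem halfCross_d : (c.flipCoord e he).halfCross (T.rot (T.rot (T.opp e))) =
    c.halfCross (T.rot (T.rot (T.opp e))) *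
      (c.crossSqrt e * c.crossSqrt e * (c.flipNorm e * c.flipNorm e)⁻¹) := by
  rw [halfCross, halfCross, flipEdge_rot_d, flipEdge_rot_a, lamPos_flipCoord, lamPos_flipCoord,
    (c.flipLam_sides he).1, flipLam_e, T.rot_rot_rot, flipDiag, crossSqrt_mul_self, c.lamPos_opp]
  generalize c.lamPos (T.rot (T.rot e)) = b
  generalize c.lamPos (T.rot (T.rot (T.opp e))) = d
  generalize c.lamPos (T.rot (T.opp e)) = f
  generalize c.lamPos (T.rot e) = a
  generalize c.flipNorm e * c.flipNorm e = n
  generalize c.lamPos e = k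
  simp only [mul_inv, inv_inv]
  calc a * (b⁻¹ * d⁻¹ * n⁻¹ * k) = a * (b⁻¹ * d⁻¹ * n⁻¹ * k) * (f * f⁻¹) := by
        rw [mul_inv_cancel, mul_one]
    _ = _ := by simp only [mul_comm, mul_left_comm, mul_assoc]

theorem crossSqrt_flipCoord : (c.flipCoord e he).crossSqrt e = (c.crossSqrt e)⁻¹ := by
  rw [crossSqrt, crossSqrt, ← Pos.sqrt_inv]
  congr 1
  rw [crossPos, crossPos]
  change _ * (_ * c.flipLam e ((T.flipEdge e he).rot ((T.flipEdge e he).rot (T.opp e))))⁻¹ = _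
  change c.flipLam e ((T.flipEdge e he).rot e) * c.flipLam e ((T.flipEdge e he).rot (T.opp e)) *
    (c.flipLam e ((T.flipEdge e he).rot ((T.flipEdge e he).rot e)) * _)⁻¹ = _
  rw [flipEdge_rot_e, flipEdge_rot_opp, flipEdge_rot_d, flipEdge_rot_b]
  obtain ⟨h1, h2, h3, h4⟩ := c.flipLam_sides he
  rw [h1, h2, h3, h4, mul_inv_rev (_ * _), inv_inv, mul_comm (c.lamPos (T.rot (T.rot (T.opp e))))]

theorem halfCross_of_notMem {x : H}
    (hx : x ∉ [e, T.rot e, T.rot (T.rot e), T.rot (T.opp e), T.rot (T.rot (T.opp e)), T.opp e]) :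
    (c.flipCoord e he).halfCross x = c.halfCross x := by
  obtain ⟨h, h1, h2⟩ := not_sameEdge_of_notMem hx
  rw [halfCross, halfCross, flipEdge_rot_other T he h h1 h2,
    flipEdge_rot_other T he h1 h2 (by rwa [T.rot_rot_rot]), lamPos_flipCoord, lamPos_flipCoord,
    flipLam_of_not _ h1, flipLam_of_not _ h2]

end Coord

end

section

variable {ι : Type u} {H : Type v}

open Triangulation

namespace Coord

variable {T : Triangulation H} {ωσ ωι : EdgeOrientation T} (c : Coord ι T ωσ ωι) {e : H}
  (he : T.DistinctSides e)

/-! ### The change of frames across an edge -/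

/-- The reversal of the edge across `b` is compensated by the factor `Z_{-1}` of `changeB`. -/
theorem crossSign_flipEdge_b :
    (crossSign (ωσ := ωσ.flipEdge e he) (ωι := ωι.flipEdge e he) (T.rot (T.rot e)) : SLtilde ι) *
      nG = crossSign (ωσ := ωσ) (ωι := ωι) (T.rot (T.rot e)) := by
  have h1 : (ωσ.flipEdge e he).toward (T.rot (T.rot e)) = !ωσ.toward (T.rot (T.rot e)) :=
    if_pos (Or.inl rfl)
  have h1' : (ωι.flipEdge e he).toward (T.rot (T.rot e)) = !ωι.toward (T.rot (T.rot e)) :=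
    if_pos (Or.inl rfl)
  simp only [crossSign, h1, h1', Bool.not_inj_iff]
  have h2 : (if ωσ.toward (T.rot (T.rot e)) = ωι.toward (T.rot (T.rot e)) then 1 else psiG) * nG =
      nG * (if ωσ.toward (T.rot (T.rot e)) = ωι.toward (T.rot (T.rot e)) then 1
        else (psiG : SLtilde ι)) := by
    split_ifs
    · rw [one_mul, mul_one]
    · exact psiG_mul_nG
  rw [mul_assoc, h2, ← mul_assoc]
  congr 1
  cases ωσ.toward (T.rot (T.rot e))
  · simp
  · simp [nG_mul_nG]

theorem crossSign_flipEdge {x : H} (hx : ¬ T.SameEdge (T.rot (T.rot e)) x) :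
    (crossSign (ωσ := ωσ.flipEdge e he) (ωι := ωι.flipEdge e he) x : SLtilde ι) =
      crossSign (ωσ := ωσ) (ωι := ωι) x := by
  have h1 : (ωσ.flipEdge e he).toward x = ωσ.toward x := if_neg hx
  have h1' : (ωι.flipEdge e he).toward x = ωι.toward x := if_neg hx
  simp only [crossSign, h1, h1']

/-- The frames on the two sides of an edge whose cross-ratio and ratio change by factors. -/
theorem crossElt_flipCoord_mul {x : H} {s : SLtilde ι} {m k : Pos ι} (hs : s = 1 ∨ s = nG)
    (hX : (crossSign (ωσ := ωσ.flipEdge e he) (ωι := ωι.flipEdge e he) x : SLtilde ι) * s =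
      crossSign (ωσ := ωσ) (ωι := ωι) x)
    (hχ : (c.flipCoord e he).crossPos x = c.crossPos x * (m * m)⁻¹)
    (hk : c.flipRatio e x = c.ratioPos x * k) :
    (c.flipCoord e he).crossElt x * (s * (dG m * zG k)) = c.crossElt x := by
  rw [crossElt, crossElt, hχ, Pos.sqrt_mul, Pos.sqrt_inv, Pos.sqrt_sq, ratioPos_flipCoord, hk, ← hX]
  have h1 : ∀ a b : Pos ι, s * (jG * dG a * zG b) = jG * dG a * zG b * s := by
    intro a b
    rcases hs with rfl | rfl
    · rw [one_mul, mul_one]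
    · rw [← mul_assoc, ← mul_assoc, nG_mul_jG, mul_assoc jG, nG_mul_dG, mul_assoc jG,
        mul_assoc (dG a), nG_mul_zG]
      simp only [mul_assoc]
  have h2 : ∀ q r : Pos ι, jG * dG (q * m⁻¹) * zG (r * k)⁻¹ * (dG m * zG k) =
      jG * dG q * zG r⁻¹ := by
    intro q r
    have e1 : dG (q * m⁻¹) * (zG (r * k)⁻¹ * (dG m * zG k)) = dG (q * m⁻¹ * m) *
        zG ((r * k)⁻¹ * k) := by
      rw [← mul_assoc (zG _), zG_mul_dG, map_mul dG (q * m⁻¹), map_mul zG _ k]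
      simp only [mul_assoc]
    rw [mul_assoc _ (zG _), mul_assoc jG, e1, inv_mul_cancel_right, mul_inv, mul_assoc r⁻¹,
      inv_mul_cancel, mul_one, mul_assoc]
  rw [← map_inv, ← map_inv]
  generalize (crossSign x : SLtilde ι) = K
  calc _ = K * (jG * dG ((c.crossPos x).sqrt * m⁻¹) * zG (c.ratioPos x * k)⁻¹ * s) *
        (dG m * zG k) := by simp only [mul_assoc]
    _ = K * s * (jG * dG ((c.crossPos x).sqrt * m⁻¹) * zG (c.ratioPos x * k)⁻¹ *
        (dG m * zG k)) := by rw [← h1]; simp only [mul_assoc]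
    _ = _ := by rw [h2]; simp only [mul_assoc]

include he in
theorem opp_side_notMem {x : H}
    (hx : x ∈ [T.rot e, T.rot (T.rot e), T.rot (T.opp e), T.rot (T.rot (T.opp e))]) : T.opp x ∉
      [e, T.rot e, T.rot (T.rot e), T.rot (T.opp e), T.rot (T.rot (T.opp e)), T.opp e] := by
  have h1 := he.not_sameEdge
  simp only [SameEdge, List.pairwise_cons, List.mem_cons, List.not_mem_nil,
    or_false, forall_eq_or_imp, forall_eq, not_or] at h1 hx ⊢
  have h2 := T.opp_opp x
  have h3 := T.opp_ne x
  have h4 := T.opp_opp e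
  have h5 := T.opp_injective (a₁ := x) (a₂ := e)
  rcases hx with rfl | rfl | rfl | rfl
  all_goals
    refine ⟨?_, ?_, ?_, ?_, ?_, ?_⟩
    all_goals
      intro h
      exact absurd h (by grind)

/-- The change of the frame of the side `x` under the flip of `e` is compatible with the change of
the coordinates on the side `x`. -/
def IsCompatible (x : H) : Prop :=
  ∃ (s : SLtilde ι) (m k : Pos ι), (s = 1 ∨ s = nG) ∧ c.flipChange e x = s * (dG m * zG k) ∧
    (crossSign (ωσ := ωσ.flipEdge e he) (ωι := ωι.flipEdge e he) x : SLtilde ι) * s =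
      crossSign (ωσ := ωσ) (ωι := ωι) x ∧
    (c.flipCoord e he).halfCross x = c.halfCross x * (m * m)⁻¹ ∧
    c.flipRatio e x = c.ratioPos x * k

include he in
theorem flipRatio_sides :
    c.flipRatio e e = c.flipDiagRatio e ∧
    c.flipRatio e (T.rot e) = c.ratioPos (T.rot e) * (c.ratioPos e * (c.oddPair e).cPos)⁻¹ ∧
    c.flipRatio e (T.rot (T.rot e)) =
      c.ratioPos (T.rot (T.rot e)) * ((c.oddPair e).cPos * (c.ratioPos e)⁻¹) ∧
    c.flipRatio e (T.rot (T.opp e)) =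
      c.ratioPos (T.rot (T.opp e)) * ((c.oddPair e).cPos * (c.flipMu e).cPos⁻¹) ∧
    c.flipRatio e (T.rot (T.rot (T.opp e))) =
      c.ratioPos (T.rot (T.rot (T.opp e))) * ((c.flipNu e).cPos * (c.oddPair e).cPos⁻¹) := by
  have h := he.not_sameEdge
  simp only [List.pairwise_cons, List.mem_cons, List.not_mem_nil,
    or_false, forall_eq_or_imp, forall_eq] at h
  have hs : ∀ {x y}, ¬ T.SameEdge x y → ¬ T.SameEdge y x := fun h h' => h h'.symm
  obtain ⟨⟨h1, h2, h3, h4⟩, ⟨h5, h6, h7⟩, ⟨h8, h9⟩, h10, -⟩ := h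
  refine ⟨?_, ?_, ?_, ?_, ?_⟩
  · rw [flipRatio, edgeFactor_self, edgeFactor_of_not (hs h1), edgeFactor_of_not (hs h2),
      edgeFactor_of_not (hs h3), edgeFactor_of_not (hs h4), mul_one, mul_one, mul_one, mul_one,
      mul_inv_cancel_left]
  · rw [flipRatio, edgeFactor_self, edgeFactor_of_not h1, edgeFactor_of_not (hs h5),
      edgeFactor_of_not (hs h6), edgeFactor_of_not (hs h7), mul_one, mul_one, mul_one, one_mul]
  · rw [flipRatio, edgeFactor_self, edgeFactor_of_not h2, edgeFactor_of_not h5,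
      edgeFactor_of_not (hs h8), edgeFactor_of_not (hs h9), mul_one, mul_one, one_mul, one_mul]
  · rw [flipRatio, edgeFactor_self, edgeFactor_of_not h3, edgeFactor_of_not h6,
      edgeFactor_of_not h8, edgeFactor_of_not (hs h10), mul_one, one_mul, one_mul, one_mul]
  · rw [flipRatio, edgeFactor_self, edgeFactor_of_not h4, edgeFactor_of_not h7,
      edgeFactor_of_not h9, edgeFactor_of_not h10, one_mul, one_mul, one_mul, one_mul]

theorem isCompatible_side {x : H}
    (hx : x ∈ [T.rot e, T.rot (T.rot e), T.rot (T.opp e), T.rot (T.rot (T.opp e))]) :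
    c.IsCompatible he x := by
  have h := he.not_sameEdge
  simp only [List.pairwise_cons, List.mem_cons, List.not_mem_nil,
    or_false, forall_eq_or_imp, forall_eq] at h hx
  obtain ⟨-, ⟨h5, -, -⟩, ⟨h8, h9⟩, -, -⟩ := h
  obtain ⟨-, ra, rb, rc, rd⟩ := c.flipRatio_sides he
  rcases hx with rfl | rfl | rfl | rfl
  · refine ⟨1, (c.flipNorm e)⁻¹, _, Or.inl rfl, ?_, ?_, ?_, ra⟩
    · rw [flipChange_a, changeA, one_mul]
    · rw [mul_one, crossSign_flipEdge he (fun h => h5 h.symm)]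
    · rw [c.halfCross_a he, mul_inv, inv_inv]
  · refine ⟨nG, c.flipNorm e * (c.crossSqrt e)⁻¹, _, Or.inr rfl, ?_, ?_, ?_, rb⟩
    · rw [flipChange_b, changeB]
    · rw [crossSign_flipEdge_b]
    · rw [c.halfCross_b he, mul_mul_mul_comm, ← mul_inv, mul_inv (_ * _), inv_inv,
        mul_comm (_ * _)⁻¹]
  · refine ⟨1, (c.flipNorm e)⁻¹, _, Or.inl rfl, ?_, ?_, ?_, rc⟩
    · rw [c.flipChange_c he, changeC, one_mul]
      rfl
    · rw [mul_one, crossSign_flipEdge he h8]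
    · rw [c.halfCross_c he, mul_inv, inv_inv]
  · refine ⟨1, c.flipNorm e * (c.crossSqrt e)⁻¹, _, Or.inl rfl, ?_, ?_, ?_, rd⟩
    · rw [c.flipChange_d he, changeD, one_mul]
      rfl
    · rw [mul_one, crossSign_flipEdge he h9]
    · rw [c.halfCross_d he, mul_mul_mul_comm, ← mul_inv, mul_inv (_ * _), inv_inv,
        mul_comm (_ * _)⁻¹]

theorem isCompatible_other {x : H}
    (hx : x ∉ [e, T.rot e, T.rot (T.rot e), T.rot (T.opp e), T.rot (T.rot (T.opp e)), T.opp e])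
    (hx' : T.opp x ∉
      [e, T.rot e, T.rot (T.rot e), T.rot (T.opp e), T.rot (T.rot (T.opp e)), T.opp e]) :
    c.IsCompatible he x := by
  have h0 : ∀ y ∈ [e, T.rot e, T.rot (T.rot e), T.rot (T.opp e), T.rot (T.rot (T.opp e)), T.opp e],
      ¬ T.SameEdge y x := by
    rintro y hy (rfl | rfl)
    · exact hx hy
    · exact hx' (by rwa [T.opp_opp])
  simp only [List.mem_cons, List.not_mem_nil, or_false, forall_eq_or_imp, forall_eq] at h0
  obtain ⟨h1, h2, h3, h4, h5, -⟩ := h0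
  refine ⟨1, 1, 1, Or.inl rfl, ?_, ?_, ?_, ?_⟩
  · rw [c.flipChange_of_notMem e hx, map_one, map_one, one_mul, one_mul]
  · rw [mul_one, crossSign_flipEdge he h3]
  · rw [c.halfCross_of_notMem he hx, mul_one, inv_one, mul_one]
  · rw [flipRatio, edgeFactor_of_not h1, edgeFactor_of_not h2, edgeFactor_of_not h3,
      edgeFactor_of_not h4, edgeFactor_of_not h5]
    simp only [mul_one]

variable {c he}

/-- The change of frames across an edge which is not flipped, starting at a side `x` such that the
triangle across `x` is not one of the two in the quadrilateral. -/
theorem IsCompatible.crossElt_mul {x : H} (h : c.IsCompatible he x)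
    (hx : T.opp x ∉
      [e, T.rot e, T.rot (T.rot e), T.rot (T.opp e), T.rot (T.rot (T.opp e)), T.opp e]) :
    (c.flipCoord e he).crossElt x * c.flipChange e x = c.flipChange e (T.opp x) * c.crossElt x := by
  obtain ⟨s, m, k, hs, hM, hX, hχ, hk⟩ := h
  rw [c.flipChange_of_notMem e hx, one_mul, hM]
  refine c.crossElt_flipCoord_mul he hs hX ?_ hk
  rw [crossPos_eq, crossPos_eq, hχ]
  change _ * (c.flipCoord e he).halfCross (T.opp x) = _
  rw [c.halfCross_of_notMem he hx]
  exact mul_right_comm _ _ _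

variable (c he)

theorem crossElt_mul_flipChange {x : H} (hx : ¬ T.SameEdge e x) :
    (c.flipCoord e he).crossElt x * c.flipChange e x = c.flipChange e (T.opp x) * c.crossElt x := by
  have hmem : ∀ y, ¬ T.SameEdge e y → y ∈
      [e, T.rot e, T.rot (T.rot e), T.rot (T.opp e), T.rot (T.rot (T.opp e)), T.opp e] →
      y ∈ [T.rot e, T.rot (T.rot e), T.rot (T.opp e), T.rot (T.rot (T.opp e))] := by
    intro y hy h
    simp only [SameEdge, not_or, List.mem_cons, List.not_mem_nil, or_false] at hy h ⊢
    tauto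
  by_cases h1 : x ∈
    [e, T.rot e, T.rot (T.rot e), T.rot (T.opp e), T.rot (T.rot (T.opp e)), T.opp e]
  · have h := hmem x hx h1
    exact (c.isCompatible_side he h).crossElt_mul (opp_side_notMem he h)
  by_cases h2 : T.opp x ∈
    [e, T.rot e, T.rot (T.rot e), T.rot (T.opp e), T.rot (T.rot (T.opp e)), T.opp e]
  · have h := hmem (T.opp x) (fun h => hx (sameEdge_opp.mp h)) h2
    have h3 := (c.isCompatible_side he h).crossElt_mul (opp_side_notMem he h)
    rw [T.opp_opp] at h3
    have h4 := (c.flipCoord e he).crossElt_opp_mul x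
    have h5 := c.crossElt_opp_mul x
    change (c.flipCoord e he).crossElt (T.opp x) * _ = 1 at h4
    rw [mul_eq_one_iff_inv_eq] at h4 h5
    rw [← h4, ← h5, inv_mul_eq_iff_eq_mul, ← mul_assoc, h3, mul_inv_cancel_right]
  · exact (c.isCompatible_other he h1 h2).crossElt_mul h2

end Coord

end

section

variable {ι : Type u} {H : Type v}

open Triangulation

namespace Coord

variable {T : Triangulation H} {ωσ ωι : EdgeOrientation T} (c : Coord ι T ωσ ωι) {e : H}
  (he : T.DistinctSides e)

/-! ### Frames before and after the flip -/

theorem crossElt_of_toward {x : H} (hσ : ωσ.toward x = true) (hι : ωι.toward x = true) :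
    c.crossElt x = jG * dG (c.crossSqrt x) * (zG (c.ratioPos x))⁻¹ := by
  rw [crossElt, crossSign, if_pos hσ, if_pos (hσ.trans hι.symm), one_mul, one_mul, crossSqrt]

theorem crossElt_flipCoord_e (hσ : ωσ.toward e = true) (hι : ωι.toward e = true) :
    (c.flipCoord e he).crossElt e =
      jG * dG (c.crossSqrt e)⁻¹ * (zG (c.flipDiagRatio e))⁻¹ := by
  have h := he.not_sameEdge
  simp only [List.pairwise_cons, List.mem_cons, List.not_mem_nil,
    or_false, forall_eq_or_imp, forall_eq] at h
  have hb : ¬ T.SameEdge (T.rot (T.rot e)) e := fun h' => h.1.2.1 h'.symm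
  rw [crossElt_of_toward, crossSqrt_flipCoord, ratioPos_flipCoord, (c.flipRatio_sides he).1]
  · exact (if_neg hb).trans hσ
  · exact (if_neg hb).trans hι

variable {K : Type} {U : Triangulation K} {π : K → H} (hrot : ∀ x, π (U.rot x) = T.rot (π x))
  (hopp : ∀ x, π (U.opp x) = T.opp (π x)) (hE : U.Flippable {w | T.SameEdge e (π w)})

include hrot hopp

/-- A family of frames, in terms of the quadrilaterals over the edge `e`. -/
theorem isFrame_iff_quadrilateral {G : K → SLtilde ι} : c.IsFrame U π G ↔
    (∀ x, π x = e →
      (G (U.rot x) = qG (c.oddPair e) * G x ∧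
        G (U.rot (U.rot x)) = qG (c.oddPair e) * G (U.rot x) ∧
        G x = qG (c.oddPair e) * G (U.rot (U.rot x))) ∧
      (G (U.rot (U.opp x)) = qG (c.oddPair (T.opp e)) * G (U.opp x) ∧
        G (U.rot (U.rot (U.opp x))) = qG (c.oddPair (T.opp e)) * G (U.rot (U.opp x)) ∧
        G (U.opp x) = qG (c.oddPair (T.opp e)) * G (U.rot (U.rot (U.opp x)))) ∧
      G (U.opp x) = c.crossElt e * G x ∧ G x = (c.crossElt e)⁻¹ * G (U.opp x)) ∧
    (∀ x, π x ∉ [e, T.rot e, T.rot (T.rot e), T.rot (T.opp e), T.rot (T.rot (T.opp e)), T.opp e] →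
      G (U.rot x) = qG (c.oddPair (π x)) * G x) ∧
    (∀ x, ¬ T.SameEdge e (π x) → G (U.opp x) = c.crossElt (π x) * G x) := by
  constructor
  · intro hF
    refine ⟨fun x hx => ⟨⟨?_, ?_, ?_⟩, ⟨?_, ?_, ?_⟩, ?_, ?_⟩, fun x _ => hF.rot x,
      fun x _ => hF.opp x⟩
    · rw [hF.rot, hx]
    · rw [hF.rot (U.rot x), hrot, hx, c.oddPair_rot]
    · have := hF.rot (U.rot (U.rot x))
      rwa [U.rot_rot_rot, hrot, hrot, hx, c.oddPair_rot, c.oddPair_rot] at this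
    · rw [hF.rot, hopp, hx]
    · rw [hF.rot (U.rot (U.opp x)), hrot, hopp, hx, c.oddPair_rot]
    · have := hF.rot (U.rot (U.rot (U.opp x)))
      rwa [U.rot_rot_rot, hrot, hrot, hopp, hx, c.oddPair_rot, c.oddPair_rot] at this
    · rw [hF.opp, hx]
    · rw [hF.opp, hx, inv_mul_cancel_left]
  · rintro ⟨hq, hr, ho⟩
    have ha : ∀ w y, π w = T.rot y → ∃ x, π x = y ∧ w = U.rot x := fun w y h =>
      ⟨U.rot (U.rot w), by rw [hrot, hrot, h, T.rot_rot_rot], (U.rot_rot_rot w).symm⟩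
    have hb : ∀ w y, π w = T.opp y → ∃ x, π x = y ∧ w = U.opp x := fun w y h =>
      ⟨U.opp w, by rw [hopp, h, T.opp_opp], (U.opp_opp w).symm⟩
    constructor
    · intro w
      rcases T.side_cases e (π w) with h | h | h | h | h | h | h
      · rw [h]
        exact (hq w h).1.1
      · obtain ⟨x, hx, rfl⟩ := ha _ _ h
        rw [h, c.oddPair_rot]
        exact (hq x hx).1.2.1
      · obtain ⟨_, hy, rfl⟩ := ha _ _ h
        obtain ⟨x, hx, rfl⟩ := ha _ _ hy
        rw [h, c.oddPair_rot, c.oddPair_rot, U.rot_rot_rot]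
        exact (hq x hx).1.2.2
      · obtain ⟨_, hy, rfl⟩ := ha _ _ h
        obtain ⟨x, hx, rfl⟩ := hb _ _ hy
        rw [h, c.oddPair_rot]
        exact (hq x hx).2.1.2.1
      · obtain ⟨_, hz, rfl⟩ := ha _ _ h
        obtain ⟨_, hy, rfl⟩ := ha _ _ hz
        obtain ⟨x, hx, rfl⟩ := hb _ _ hy
        rw [h, c.oddPair_rot, c.oddPair_rot, U.rot_rot_rot]
        exact (hq x hx).2.1.2.2
      · obtain ⟨x, hx, rfl⟩ := hb _ _ h
        rw [h]
        exact (hq x hx).2.1.1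
      · exact hr w (notMem_sides h.1 h.2.1 h.2.2)
    · intro w
      by_cases h : T.SameEdge e (π w)
      · rcases h with h | h
        · rw [h]
          exact (hq w h).2.2.1
        · obtain ⟨x, hx, rfl⟩ := hb _ _ h
          have := c.crossElt_opp_mul e
          rw [mul_eq_one_iff_eq_inv] at this
          rw [h, U.opp_opp, this]
          exact (hq x hx).2.2.2
      · exact ho w h

/-- A family of frames of the flipped triangulation, in terms of the quadrilaterals over the
edge `e`. -/
theorem isFrame_flip_iff_quadrilateral {G : K → SLtilde ι} :
    (c.flipCoord e he).IsFrame (U.flip _ hE) π G ↔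
    (∀ x, π x = e →
      (G x = qG (c.flipMu e) * G (U.rot x) ∧
        G (U.rot (U.rot (U.opp x))) = qG (c.flipMu e) * G x ∧
        G (U.rot x) = qG (c.flipMu e) * G (U.rot (U.rot (U.opp x)))) ∧
      (G (U.rot (U.opp x)) = qG (c.flipNu e) * G (U.rot (U.rot x)) ∧
        G (U.opp x) = qG (c.flipNu e) * G (U.rot (U.opp x)) ∧
        G (U.rot (U.rot x)) = qG (c.flipNu e) * G (U.opp x)) ∧
      G (U.opp x) = (c.flipCoord e he).crossElt e * G x ∧
      G x = ((c.flipCoord e he).crossElt e)⁻¹ * G (U.opp x)) ∧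
    (∀ x, π x ∉ [e, T.rot e, T.rot (T.rot e), T.rot (T.opp e), T.rot (T.rot (T.opp e)), T.opp e] →
      G (U.rot x) = qG (c.oddPair (π x)) * G x) ∧
    (∀ x, ¬ T.SameEdge e (π x) → G (U.opp x) = (c.flipCoord e he).crossElt (π x) * G x) := by
  have memE : ∀ x, π x = e → x ∈ {w | T.SameEdge e (π w)} := fun x h => Or.inl h
  have memE' : ∀ x, π x = e → U.opp x ∈ {w | T.SameEdge e (π w)} :=
    fun x h => hE.opp_mem _ (memE x h)
  have re : ∀ x, π x = e → (U.flip _ hE).rot x = U.rot (U.rot (U.opp x)) :=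
    fun x h => U.flipRot_mem (memE x h)
  have re' : ∀ x, π x = e → (U.flip _ hE).rot (U.opp x) = U.rot (U.rot x) :=
    fun x h => (U.flipRot_mem (memE' x h)).trans (by rw [U.opp_opp])
  have ra : ∀ x, π x = e → (U.flip _ hE).rot (U.rot x) = x :=
    fun x h => U.flipRot_left hE (memE x h)
  have rc : ∀ x, π x = e → (U.flip _ hE).rot (U.rot (U.opp x)) = U.opp x :=
    fun x h => U.flipRot_left hE (memE' x h)
  have rb : ∀ x, π x = e → (U.flip _ hE).rot (U.rot (U.rot x)) = U.rot (U.opp x) :=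
    fun x h => U.flipRot_right hE (memE x h)
  have rd : ∀ x, π x = e → (U.flip _ hE).rot (U.rot (U.rot (U.opp x))) = U.rot x :=
    fun x h => (U.flipRot_right hE (memE' x h)).trans (by rw [U.opp_opp])
  have ro : ∀ x, π x ∉
      [e, T.rot e, T.rot (T.rot e), T.rot (T.opp e), T.rot (T.rot (T.opp e)), T.opp e] →
      (U.flip _ hE).rot x = U.rot x := by
    intro x hx
    obtain ⟨h, h1, h2⟩ := not_sameEdge_of_notMem hx
    refine U.flipRot_other h ?_ ?_
    · simpa only [Set.mem_ofPred_eq, hrot] using h1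
    · simpa only [Set.mem_ofPred_eq, hrot] using h2
  have oa : c.flipOdd e (T.rot e) = c.flipMu e := c.flipOdd_mu (by simp)
  have oe : c.flipOdd e e = c.flipMu e := c.flipOdd_mu (by simp)
  have od : c.flipOdd e (T.rot (T.rot (T.opp e))) = c.flipMu e := c.flipOdd_mu (by simp)
  have ob : c.flipOdd e (T.rot (T.rot e)) = c.flipNu e := c.flipOdd_nu he (by simp)
  have oc : c.flipOdd e (T.rot (T.opp e)) = c.flipNu e := c.flipOdd_nu he (by simp)
  have oe' : c.flipOdd e (T.opp e) = c.flipNu e := c.flipOdd_nu he (by simp)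
  constructor
  · intro hF
    have hr : ∀ w, G ((U.flip _ hE).rot w) = qG (c.flipOdd e (π w)) * G w := hF.rot
    have ho : ∀ w, G (U.opp w) = (c.flipCoord e he).crossElt (π w) * G w := hF.opp
    refine ⟨fun x hx => ⟨⟨?_, ?_, ?_⟩, ⟨?_, ?_, ?_⟩, ?_, ?_⟩, fun x hx => ?_, fun x _ => ho x⟩
    · have := hr (U.rot x)
      rwa [ra x hx, hrot, hx, oa] at this
    · have := hr x
      rwa [re x hx, hx, oe] at this
    · have := hr (U.rot (U.rot (U.opp x)))
      rwa [rd x hx, hrot, hrot, hopp, hx, od] at this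
    · have := hr (U.rot (U.rot x))
      rwa [rb x hx, hrot, hrot, hx, ob] at this
    · have := hr (U.rot (U.opp x))
      rwa [rc x hx, hrot, hopp, hx, oc] at this
    · have := hr (U.opp x)
      rwa [re' x hx, hopp, hx, oe'] at this
    · rw [ho, hx]
    · rw [ho, hx, inv_mul_cancel_left]
    · rw [← ro x hx, hr, c.flipOdd_of_notMem e hx]
  · rintro ⟨hq, hr, ho⟩
    have ha : ∀ w y, π w = T.rot y → ∃ x, π x = y ∧ w = U.rot x := fun w y h =>
      ⟨U.rot (U.rot w), by rw [hrot, hrot, h, T.rot_rot_rot], (U.rot_rot_rot w).symm⟩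
    have hb : ∀ w y, π w = T.opp y → ∃ x, π x = y ∧ w = U.opp x := fun w y h =>
      ⟨U.opp w, by rw [hopp, h, T.opp_opp], (U.opp_opp w).symm⟩
    constructor
    · intro w
      rw [oddPair_flipCoord]
      rcases T.side_cases e (π w) with h | h | h | h | h | h | h
      · rw [h, oe, re w h]
        exact (hq w h).1.2.1
      · obtain ⟨x, hx, rfl⟩ := ha _ _ h
        rw [h, oa, ra x hx]
        exact (hq x hx).1.1
      · obtain ⟨_, hy, rfl⟩ := ha _ _ h
        obtain ⟨x, hx, rfl⟩ := ha _ _ hy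
        rw [h, ob, rb x hx]
        exact (hq x hx).2.1.1
      · obtain ⟨_, hy, rfl⟩ := ha _ _ h
        obtain ⟨x, hx, rfl⟩ := hb _ _ hy
        rw [h, oc, rc x hx]
        exact (hq x hx).2.1.2.1
      · obtain ⟨_, hz, rfl⟩ := ha _ _ h
        obtain ⟨_, hy, rfl⟩ := ha _ _ hz
        obtain ⟨x, hx, rfl⟩ := hb _ _ hy
        rw [h, od, rd x hx]
        exact (hq x hx).1.2.2
      · obtain ⟨x, hx, rfl⟩ := hb _ _ h
        rw [h, oe', re' x hx]
        exact (hq x hx).2.1.2.2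
      · have h' := notMem_sides h.1 h.2.1 h.2.2
        rw [ro w h', c.flipOdd_of_notMem e h']
        exact hr w h'
    · intro w
      change G (U.opp w) = _
      by_cases h : T.SameEdge e (π w)
      · rcases h with h | h
        · rw [h]
          exact (hq w h).2.2.1
        · obtain ⟨x, hx, rfl⟩ := hb _ _ h
          have := (c.flipCoord e he).crossElt_opp_mul e
          change (c.flipCoord e he).crossElt (T.opp e) * _ = 1 at this
          rw [mul_eq_one_iff_eq_inv] at this
          rw [h, U.opp_opp, this]
          exact (hq x hx).2.2.2
      · exact ho w h

/-- The change of frames turns the frames for the given coordinates into the frames for the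
coordinates after the flip, and conversely. -/
theorem isFrame_flip_iff (hσ : ωσ.toward e = true) (hι : ωι.toward e = true)
    {G : K → SLtilde ι} :
    (c.flipCoord e he).IsFrame (U.flip _ hE) π (fun x => c.flipChange e (π x) * G x) ↔
      c.IsFrame U π G := by
  rw [c.isFrame_flip_iff_quadrilateral he hrot hopp hE, c.isFrame_iff_quadrilateral hrot hopp]
  refine and_congr (forall₂_congr fun x hx => ?_) (and_congr (forall₂_congr fun x hx => ?_)
    (forall₂_congr fun x hx => ?_))
  · have h1 := changeD_mul (c.flipEq e)
    have h2 := changeC_mul (c.flipEq e)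
    have h3 := changeB_mul (c.flipEq e)
    rw [← c.crossElt_of_toward hσ hι] at h1 h2
    rw [quadrilateral_iff (qG_cube _) (qG_cube _) (qG_cube _) (qG_cube _) h1 h2 h3]
    simp only [hrot, hopp, hx]
    rw [c.flipChange_a, c.flipChange_b, c.flipChange_c he, c.flipChange_d he, c.flipChange_e he,
      c.flipChange_opp he, c.crossElt_flipCoord_e he hσ hι]
    exact Iff.rfl
  · have h := not_sameEdge_of_notMem hx
    rw [c.flipChange_of_notMem e hx, hrot, c.flipChange_of_notMem e, one_mul, one_mul]
    exact notMem_sides h.2.1 h.2.2 (by rw [T.rot_rot_rot]; exact h.1)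
  · rw [← mul_assoc, c.crossElt_mul_flipChange he hx, hopp, mul_assoc, mul_right_inj]

omit hrot hopp

/-- The change of frames along a side multiplies its first vertex by the factor by which
`vertexScale` changes. -/
theorem isPlaced_flip_iff {x : H} (hx : ¬ T.SameEdge e x) {G : SLtilde ι} {P : SMat ι} :
    (c.flipCoord e he).IsPlaced x (c.flipChange e x * G) P ↔ c.IsPlaced x G P := by
  have h : ∃ (s : SLtilde ι) (m k : Pos ι), (s = 1 ∨ s = nG) ∧
      c.flipChange e x = s * (dG m * zG k) ∧
      (c.flipCoord e he).halfCross x = c.halfCross x * (m * m)⁻¹ := by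
    by_cases h1 : x ∈
      [e, T.rot e, T.rot (T.rot e), T.rot (T.opp e), T.rot (T.rot (T.opp e)), T.opp e]
    · have h2 : x ∈ [T.rot e, T.rot (T.rot e), T.rot (T.opp e), T.rot (T.rot (T.opp e))] := by
        simp only [SameEdge, not_or, List.mem_cons, List.not_mem_nil, or_false] at hx h1 ⊢
        tauto
      obtain ⟨s, m, k, hs, hM, -, hχ, -⟩ := c.isCompatible_side he h2
      exact ⟨s, m, k, hs, hM, hχ⟩
    · refine ⟨1, 1, 1, Or.inl rfl, ?_, ?_⟩
      · rw [c.flipChange_of_notMem e h1, map_one, map_one, one_mul, one_mul]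
      · rw [c.halfCross_of_notMem he h1, mul_one, inv_one, mul_one]
  obtain ⟨s, m, k, hs, hM, hχ⟩ := h
  have e1 : (c.flipCoord e he).vertexScale x = c.vertexScale x * (m * m) := by
    rw [vertexScale_eq, vertexScale_eq, hχ, lamPos_flipCoord, c.flipLam_of_not hx, mul_inv, inv_inv,
      mul_assoc (_ * _)]
  have e2 : (s * (dG m * zG k)) • op (c.vertexScale x : Grassmann ι) • (ptC : SMat ι) =
      op ((c.flipCoord e he).vertexScale x : Grassmann ι) • ptC := by
    have e3 : s • (ptC : SMat ι) = ptC := by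
      rcases hs with rfl | rfl
      · exact one_smul _ _
      · exact nG_smul_ptC
    rw [smul_op_smul, mul_smul, mul_smul, zG_smul_ptC, dG_smul_ptC, smul_op_smul, e3,
      op_smul_op_smul, e1]
  rw [IsPlaced, IsPlaced, hM, mul_smul, ← e2, smul_left_cancel_iff]

variable {c}

/-- A vertex is placed by the frame of a side which starts there if it is placed by the frame of
the next side which starts there. -/
theorem IsFrame.isPlaced_iff (hrot : ∀ x, π (U.rot x) = T.rot (π x))
    (hopp : ∀ x, π (U.opp x) = T.opp (π x)) {G : K → SLtilde ι} (hF : c.IsFrame U π G) (x : K)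
    {P : SMat ι} : c.IsPlaced (π (U.rot (U.opp x))) (G (U.rot (U.opp x))) P ↔
      c.IsPlaced (π x) (G x) P := by
  rw [hF.rot, hF.opp, hrot, hopp, isPlaced_rot_opp_iff]

/-- Every ideal point is the start of a side which is not on a flipped edge, both before and after
the flip, so that it is enough to compare the placement along those sides. -/
theorem isFramed_flip_iff (hrot : ∀ x, π (U.rot x) = T.rot (π x))
    (hopp : ∀ x, π (U.opp x) = T.opp (π x))
    (hrot' : ∀ x, π ((U.flip _ hE).rot x) = (T.flipEdge e he).rot (π x))
    (hσ : ωσ.toward e = true) (hι : ωι.toward e = true) {ℓ : U.IdealPoint → LightCone ι} :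
    (c.flipCoord e he).IsFramed (U.flip _ hE) π (ℓ ∘ U.flipPoint _ hE) ↔ c.IsFramed U π ℓ := by
  have hE' : ∀ w, T.SameEdge e (π w) → ¬ T.SameEdge e (π (U.rot (U.opp w))) := fun w hw =>
    hE.rot_notMem _ (hE.opp_mem _ hw)
  have hE'' : ∀ w, T.SameEdge e (π w) →
      ¬ T.SameEdge e (π ((U.flip _ hE).rot ((U.flip _ hE).opp w))) := fun w hw => by
    have : (U.flip _ hE).rot ((U.flip _ hE).opp w) = U.rot (U.rot w) :=
      (U.flipRot_mem (hE.opp_mem _ hw)).trans (by rw [U.opp_opp])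
    rw [this]
    exact hE.rot_rot_notMem _ hw
  have hpt : ∀ w, ¬ T.SameEdge e (π w) →
      U.flipPoint _ hE ((U.flip _ hE).start w) = U.start w := fun w hw => if_neg hw
  have hiff : ∀ G : K → SLtilde ι, c.IsFrame U π G →
      ((∀ x, (c.flipCoord e he).IsPlaced (π x) (c.flipChange e (π x) * G x)
        (ℓ (U.flipPoint _ hE ((U.flip _ hE).start x)))) ↔
      ∀ x, c.IsPlaced (π x) (G x) (ℓ (U.start x))) := by
    intro G hF
    have hF' := (c.isFrame_flip_iff he hrot hopp hE hσ hι).mpr hF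
    have hw : ∀ w, ¬ T.SameEdge e (π w) →
        ((c.flipCoord e he).IsPlaced (π w) (c.flipChange e (π w) * G w)
          (ℓ (U.flipPoint _ hE ((U.flip _ hE).start w))) ↔
        c.IsPlaced (π w) (G w) (ℓ (U.start w))) := by
      intro w hw
      rw [hpt w hw, c.isPlaced_flip_iff he hw]
    constructor
    · intro h x
      by_cases hx : T.SameEdge e (π x)
      · rw [← hF.isPlaced_iff hrot hopp, ← U.start_rot_opp x]
        exact (hw _ (hE' x hx)).mp (h _)
      · exact (hw x hx).mp (h x)
    · intro h x
      by_cases hx : T.SameEdge e (π x)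
      · have h1 := hF'.isPlaced_iff hrot' hopp x
          (P := ℓ (U.flipPoint _ hE ((U.flip _ hE).start x)))
        rw [← (U.flip _ hE).start_rot_opp x] at h1 ⊢
        exact h1.mp ((hw _ (hE'' x hx)).mpr (h _))
      · exact (hw x hx).mpr (h x)
  constructor
  · rintro ⟨G, hF, hP⟩
    have hG : G = fun x => c.flipChange e (π x) * ((c.flipChange e (π x))⁻¹ * G x) :=
      funext fun x => (mul_inv_cancel_left _ _).symm
    rw [hG] at hF
    have hF' := (c.isFrame_flip_iff he hrot hopp hE hσ hι).mp hF
    refine ⟨_, hF', (hiff _ hF').mp fun x => ?_⟩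
    rw [mul_inv_cancel_left]
    exact hP x
  · rintro ⟨G, hF, hP⟩
    exact ⟨_, (c.isFrame_flip_iff he hrot hopp hE hσ hι).mpr hF, (hiff G hF).mpr hP⟩

end Coord

end

section

variable {ι : Type u} {H : Type v}

open Triangulation

namespace Coord

variable {T : Triangulation H} {ωσ ωι : EdgeOrientation T} (c : Coord ι T ωσ ωι) {e : H}
  (he : T.DistinctSides e)

/-! ### The Ptolemy transform -/

theorem proj_flipCover_rot (x₀ : H) (w : Paths) :
    T.proj x₀ ((T.flipCover e he x₀).rot w) = (T.flipEdge e he).rot (T.proj x₀ w) := by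
  change T.proj x₀ ((T.universalCover x₀).flipRot {w | T.SameEdge e (T.proj x₀ w)} w) =
    T.flipRot {x | T.SameEdge e x} (T.proj x₀ w)
  simp only [flipRot, Set.mem_ofPred_eq, T.proj_rot]
  split_ifs <;> simp_all [T.proj_rot, T.proj_opp]

theorem isPtolemyTransform_flipCoord (hσ : ωσ.toward e = true) (hι : ωι.toward e = true) :
    c.IsPtolemyTransform e he (c.flipCoord e he) where
  lam_eq x hx := congrArg Subtype.val (c.flipLam_of_not hx)
  ratio_eq x hx := by
    simp only [List.mem_cons, List.not_mem_nil, or_false, forall_eq_or_imp, forall_eq] at hx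
    obtain ⟨h1, h2, h3, h4, h5⟩ := hx
    have h : c.flipRatio e x = c.ratioPos x := by
      rw [flipRatio, edgeFactor_of_not h1, edgeFactor_of_not h2, edgeFactor_of_not h3,
        edgeFactor_of_not h4, edgeFactor_of_not h5]
      simp only [mul_one]
    exact congrArg Subtype.val h
  odd_eq x hx := by
    have h : c.flipOdd e x = c.oddPair x := by
      apply c.flipOdd_of_notMem
      simp only [List.mem_cons, List.not_mem_nil, or_false, not_or] at hx ⊢
      tauto
    exact ⟨congrArg OddPair.fst h, congrArg OddPair.snd h⟩
  exists_lift := c.exists_isLift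
  same_lift x₀ ℓ := by
    rw [isLift_iff_isFramed (T.proj_rot x₀) (T.proj_opp x₀),
      isLift_iff_isFramed (proj_flipCover_rot he x₀) (T.proj_opp x₀)]
    exact (isFramed_flip_iff he (T.flippable_cover he x₀) (T.proj_rot x₀) (T.proj_opp x₀)
      (proj_flipCover_rot he x₀) hσ hι).symm

theorem coe_flipNormSq : (c.flipNormSq e : Grassmann ι) = 1 + c.crossRatio e +
    (1 / 2 : ℝ) • ((c.crossSqrt e : Grassmann ι) *
      ((c.ratio e)⁻¹ʳ * c.odd₁ (T.opp e) * c.odd₂ e +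
        c.ratio e * c.odd₂ (T.opp e) * c.odd₁ e)) := by
  have h1 : (c.crossSqrt e : Grassmann ι) * c.crossSqrt e = c.crossRatio e :=
    congrArg Subtype.val (c.crossPos e).sqrt_mul_sqrt
  have h2 : (c.oddPair (T.opp e)).fst * (c.scaledPair e).snd =
      (c.ratio e)⁻¹ʳ * c.odd₁ (T.opp e) * c.odd₂ e := by
    change c.odd₁ (T.opp e) * ((c.ratio e)⁻¹ʳ * c.odd₂ e) = _
    rw [← mul_assoc, ((c.ratio_pos e).inverse.1.commute _).eq]
  have h3 : (c.oddPair (T.opp e)).snd * (c.scaledPair e).fst =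
      c.ratio e * c.odd₂ (T.opp e) * c.odd₁ e := by
    change c.odd₂ (T.opp e) * (c.ratio e * c.odd₁ e) = _
    rw [← mul_assoc, ((c.ratio_pos e).1.commute _).eq]
  rw [← h1, ← h2, ← h3]
  rfl

/-- The super Ptolemy relation for the new diagonal. -/
theorem lam_mul_flipDiag (w : Grassmann ι) (hw : (c.flipNormSq e : Grassmann ι) =
    1 + c.crossRatio e + (1 / 2 : ℝ) • ((c.crossSqrt e : Grassmann ι) * w)) :
    c.lam e * (c.flipDiag e : Grassmann ι) =
      (c.lam (T.rot e) * c.lam (T.rot (T.opp e)) +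
        c.lam (T.rot (T.rot e)) * c.lam (T.rot (T.rot (T.opp e)))) *
      (1 + (1 / 2 : ℝ) •
        (w * ((c.crossSqrt e : Grassmann ι) + (c.crossSqrt e : Grassmann ι)⁻¹ʳ)⁻¹ʳ)) := by
  have h1 : c.lamPos e * c.flipDiag e =
      c.lamPos (T.rot (T.rot e)) * c.lamPos (T.rot (T.rot (T.opp e))) * c.flipNormSq e := by
    rw [flipDiag, flipNorm, Pos.sqrt_mul_sqrt, mul_comm, inv_mul_cancel_right]
  have h2 : c.lamPos (T.rot e) * c.lamPos (T.rot (T.opp e)) =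
      c.lamPos (T.rot (T.rot e)) * c.lamPos (T.rot (T.rot (T.opp e))) * c.crossPos e := by
    rw [crossPos, mul_comm (_ * _) (_ * _ * _⁻¹), inv_mul_cancel_right]
  have h3 : c.crossSqrt e * c.crossSqrt e = c.crossPos e := (c.crossPos e).sqrt_mul_sqrt
  obtain ⟨t, ht⟩ : ∃ t, t = c.lamPos (T.rot (T.rot e)) * c.lamPos (T.rot (T.rot (T.opp e))) :=
    ⟨_, rfl⟩
  rw [← ht] at h1 h2
  obtain ⟨q, hq⟩ : ∃ q, q = c.crossSqrt e := ⟨_, rfl⟩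
  rw [← hq] at h3 hw ⊢
  obtain ⟨p, hp⟩ : ∃ p : Pos ι, (p : Grassmann ι) = q + (q⁻¹ : Pos ι) :=
    ⟨⟨_, q.2.add q⁻¹.2⟩, rfl⟩
  have g1 : c.lam e * (c.flipDiag e : Grassmann ι) = t * c.flipNormSq e := congrArg Subtype.val h1
  have g2 : c.lam (T.rot e) * c.lam (T.rot (T.opp e)) = t * c.crossRatio e :=
    congrArg Subtype.val h2
  have g3 : (q : Grassmann ι) * q = c.crossRatio e := congrArg Subtype.val h3
  have g4 : c.lam (T.rot (T.rot e)) * c.lam (T.rot (T.rot (T.opp e))) = t :=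
    congrArg Subtype.val ht.symm
  have g5 : (q : Grassmann ι) * p = 1 + c.crossRatio e := by
    rw [hp, mul_add, q.mul_inv_coe, g3, add_comm]
  have g6 : (q : Grassmann ι) * p * (w * (p⁻¹ : Pos ι)) = q * w := by
    rw [mul_assoc, p⁻¹.comm w, p.mul_inv_cancel_left_coe]
  rw [g1, g2, g4, hw, ← Pos.coe_inv, ← hp, ← Pos.coe_inv, ← g6, ← g5, ← mul_smul_comm,
    ← mul_one_add, ← mul_assoc, g5, mul_add (t : Grassmann ι), mul_one, add_comm (t : Grassmann ι)]

end Coord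

end

end SuperTeich

end

theorem mainTheorem4 {ι : Type*} {H : Type*} [Finite H]
    (T : Triangulation H) (hT : T.Connected)
    (side : H) (hside : T.DistinctSides side)
    (ωσ ωι : EdgeOrientation T)
    (hωσ : ωσ.toward side = true) (hωι : ωι.toward side = true)
    (C : Coord ι T ωσ ωι) :
    -- the sides of the quadrilateral `ABCD` with diagonal `CA`
    let sideA := T.rot side
    let sideB := T.rot (T.rot side)
    let sideC := T.rot (T.opp side)
    let sideD := T.rot (T.rot (T.opp side))
    -- the old coordinates
    let a := C.lam sideA
    let b := C.lam sideB
    let c := C.lam sideC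
    let d := C.lam sideD
    let e := C.lam side
    let h := C.ratio side
    let θ₁ := C.odd₁ side
    let θ₂ := C.odd₂ side
    let σ₁ := C.odd₁ (T.opp side)
    let σ₂ := C.odd₂ (T.opp side)
    let χ := (a * c) * (b * d)⁻¹ʳ
    let q := gsqrt χ
    let w := h⁻¹ʳ * σ₁ * θ₂ + h * σ₂ * θ₁
    let 𝒟 := gsqrt (1 + χ + (1 / 2 : ℝ) • (q * w))
    -- the new odd coordinates
    let μ₁ := (h * θ₁ + q * σ₁) * 𝒟⁻¹ʳ
    let μ₂ := (h⁻¹ʳ * θ₂ + q * σ₂) * 𝒟⁻¹ʳ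
    let ν₁ := (σ₁ - q * h * θ₁) * 𝒟⁻¹ʳ
    let ν₂ := (σ₂ - q * h⁻¹ʳ * θ₂) * 𝒟⁻¹ʳ
    ∃ C' : Coord ι (T.flipEdge side hside) (ωσ.flipEdge side hside) (ωι.flipEdge side hside),
      C.IsPtolemyTransform side hside C' ∧
      -- the new diagonal
      e * C'.lam side = (a * c + b * d) * (1 + (1 / 2 : ℝ) • (w * (q + q⁻¹ʳ)⁻¹ʳ)) ∧
      -- the triangle `ABD`
      (∀ s ∈ [sideA, side, sideD], C'.odd₁ s = μ₁ ∧ C'.odd₂ s = μ₂) ∧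
      -- the triangle `BCD`
      (∀ s ∈ [sideB, sideC, T.opp side], C'.odd₁ s = ν₁ ∧ C'.odd₂ s = ν₂) ∧
      -- the ratios
      C'.ratio sideA = C.ratio sideA * (h * cc θ₁ θ₂)⁻¹ʳ ∧
      C'.ratio sideB = C.ratio sideB * cc θ₁ θ₂ * h⁻¹ʳ ∧
      C'.ratio sideC = C.ratio sideC * (cc θ₁ θ₂ * (cc μ₁ μ₂)⁻¹ʳ) ∧
      C'.ratio sideD = C.ratio sideD * (cc ν₁ ν₂ * (cc θ₁ θ₂)⁻¹ʳ) ∧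
      C'.ratio side = cc σ₁ σ₂ * ((cc θ₁ θ₂) ^ 2)⁻¹ʳ := by
  intro sideA sideB sideC sideD a b c d e h θ₁ θ₂ σ₁ σ₂ χ q w 𝒟 μ₁ μ₂ ν₁ ν₂
  have hnorm : (C.flipNormSq side : Grassmann ι) = 1 + χ + (1 / 2 : ℝ) • (q * w) :=
    C.coe_flipNormSq
  have h𝒟 : 𝒟 = C.flipNorm side := congrArg gsqrt hnorm.symm
  have hmu : (C.flipMu side).fst = μ₁ ∧ (C.flipMu side).snd = μ₂ := by
    simp only [μ₁, μ₂, h𝒟]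
    exact ⟨rfl, rfl⟩
  have hnu : (C.flipNu side).fst = ν₁ ∧ (C.flipNu side).snd = ν₂ := by
    simp only [ν₁, ν₂, h𝒟, mul_assoc]
    exact ⟨rfl, rfl⟩
  obtain ⟨re, ra, rb, rc, rd⟩ := C.flipRatio_sides hside
  refine ⟨C.flipCoord side hside, C.isPtolemyTransform_flipCoord hside hωσ hωι, ?_,
    fun s hs => ?_, fun s hs => ?_, ?_, ?_, ?_, ?_, ?_⟩
  · have h := C.lam_mul_flipDiag w hnorm
    rw [← C.flipLam_e] at h
    exact h
  · have h : C.flipOdd side s = C.flipMu side := C.flipOdd_mu hs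
    exact ⟨(congrArg OddPair.fst h).trans hmu.1, (congrArg OddPair.snd h).trans hmu.2⟩
  · have h : C.flipOdd side s = C.flipNu side := C.flipOdd_nu hside hs
    exact ⟨(congrArg OddPair.fst h).trans hnu.1, (congrArg OddPair.snd h).trans hnu.2⟩
  · exact congrArg Subtype.val ra
  · rw [mul_assoc]
    exact congrArg Subtype.val rb
  · rw [← hmu.1, ← hmu.2]
    exact congrArg Subtype.val rc
  · rw [← hnu.1, ← hnu.2]
    exact congrArg Subtype.val rd
  · rw [pow_two]
    exact congrArg Subtype.val re
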